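/- **Setting.** Let $\mathcal H$ be a finite class of functions $\mathcal X\to\{0,1\}$ that contains a constant function, let $Q\subseteq\mathcal X$ be a separating set for $\mathcal H$ (distinct $h,h'\in\mathcal H$ differ somewhere on $Q$), $s=|Q|$, let $k,T\ge 1$, $\alpha,\delta\in(0,1]$, and let an ERM oracle for $\mathcal H$ be given: for a finite batch of cost-sensitive examples $(x,c)$, $c\in\mathbb R^{\{0,1\}}$, it returns some $h\in\mathcal H$ minimizing $\sum c(h(x))$. For a distribution $\pi$ on $\mathcal H$ write $\pi(x)=\Pr_{h\sim\pi}[h(x)=1]$ and $\mathrm{Error}(\pi,\bar x,\bar y)=\mathbb E_{h\sim\pi}\sum_{i\le k}\mathbf 1[h(\bar x^i)\ne\bar y^i]$. An auditor is a function $d:\mathcal X^2\to[0,1]$; for a predictor $p$, a tuple $\bar x\in\mathcal X^k$ and a sensitivity $a$ it objects to $(l,r)$ iff $p(\bar x^l)-p(\bar x^r)>d(\bar x^l,\bar x^r)+a$. A monotone auditing scheme is a panel of $m\ge1$ auditors and a monotone $\bar f:\{0,1\}^m\to\{0,1\}$ with $\bar f(0,\dots,0)=0$; it finds a violation on $(l,r)$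 iff $\bar f$ of the auditors' objections to $(l,r)$ is $1$; its report is $\mathrm{Null}$ if there is no violation, and otherwise one arbitrarily selected violating pair. $\mathrm{Unfair}_a(p)\in\{0,1\}$ is $1$ iff the report is not $\mathrm{Null}$. **Protocol.** In round $t\le T$ the learner deploys a distribution $\pi^t$ on $\mathcal H$; an adversary, knowing everything that happened on the learner's side in earlier rounds, fixes $\bar x^t\in\mathcal X^k$, $\bar y^t\in\{0,1\}^k$ and a monotone auditing scheme; the learner draws $h^t\sim\pi^t$, predicts $h^t(\bar x^{t,i})$, and sees $\bar y^{t,i}$ only for those $i$ with $h^t(\bar x^{t,i})=1$. **Algorithm** (Context-Semi-Bandit-FTPL with geometric resampling, plus online gradient descent). Let $\epsilon=\alpha$, $\mu=T^{-1/3}$, $R=\lceil 64\alpha^{-2}\log(2kT/\delta)\rceil$, $M=\lceil 16k/(\mu e)\rceil$, $\omega=\mu^2e/(512sk^4)$. Start with an empty history of cost-sensitive examples and $\lambda^1=0$. The policy $\pi^t$ is the law of the oracle's answer to the history together with the fake examples $(q,(z_{q,i,0},z_{q,i,1}))$, $q\in Q$, $i\le k$, where the $z_{q,i,b}$ are independent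 with the Laplace density $\frac{\omega}{2}e^{-\omega|z|}$; a draw from $\pi^t$ uses fresh noise and one oracle call. In round $t$: 1. Draw $h^{t_1},\dots,h^{t_R}$ from $\pi^t$, let $\tilde\pi^t$ be the uniform distribution on them, and query the scheme with $\tilde\pi^t$ at sensitivity $\alpha-\frac\epsilon2$; let $\rho^t$ be the report. 2. Draw $h^t$ from $\pi^t$, predict with it and observe the one-sided labels. The cost of the prediction $b=h^t(\bar x^{t,i})$ is $c^{t,i}=\frac1k v+\lambda^t u$, with $v=2\cdot\mathbf 1[\bar y^{t,i}=0]$ if $b=1$ and $v=1$ if $b=0$, and, if $\rho^t=(l,r)$, $u=\mathbf 1[i=l,b=1]+\mathbf 1[i=r,b=0]$, while $u=0$ if $\rho^t=\mathrm{Null}$. 3. For each $i\le k$ draw $M$ further hypotheses from $\pi^t$, let $J^{t,i}$ be the index of the first one that agrees with $h^t$ on $\bar x^{t,i}$, or $M$ if there is none, and append to the history the example $\bar x^{t,i}$ with cost $J^{t,i}c^{t,i}$ for the prediction $h^t(\bar x^{t,i})$ and cost $0$ for the other prediction. 4. Put $\lambda^{t+1}=\max\{0,\lambda^t+\mu(U^t-\mu\lambda^t)\}$,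 where $U^t=[\pi^t(\bar x^{t,l})-\pi^t(\bar x^{t,r})]-[\tilde\pi^t(\bar x^{t,l})-\tilde\pi^t(\bar x^{t,r})]+\frac\epsilon2$ if $\rho^t=(l,r)$, and $U^t=0$ if $\rho^t=\mathrm{Null}$. **Theorem.** There is an absolute constant $C$ such that, for all such data and every such adversary, with probability at least $1-\delta$ the set $\Delta\mathcal H^{fair}$ of the distributions $\pi$ on $\mathcal H$ with $\mathrm{Unfair}^t_0(\pi)=0$ for all $t\le T$ is nonempty and, simultaneously, $$\sum_{t=1}^T\mathrm{Error}(\pi^t,\bar x^t,\bar y^t)-\min_{\pi\in\Delta\mathcal H^{fair}}\sum_{t=1}^T\mathrm{Error}(\pi,\bar x^t,\bar y^t)\le C\,s^{3/2}k^{11/2}T^{2/3}\log|\mathcal H|\,\log\tfrac2\delta,$$ $$\sum_{t=1}^T\mathrm{Unfair}^t_\alpha(\pi^t)\le C\,\alpha^{-1}s^{3/2}k^{9/2}T^{5/6}\log|\mathcal H|\,\log\tfrac2\delta.$$ In every round, and surely, the number of oracle calls made for the draws from $\pi^t$ is at most $C\big(\alpha^{-2}\log\frac{2kT}{\delta}+k^2T^{1/3}\big)$.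 -/

import Mathlib

open MeasureTheory

universe u

noncomputable section

namespace FairOnline

variable {X : Type u}

/-! ### Policies -/

/-- The probability `π(x) = Pr_{h ∼ π}[h(x) = 1]` of a positive prediction, for a vector `π` of
weights on the hypothesis class `H`. -/
def mix {H : Finset (X → Bool)} (π : H → ℝ) (x : X) : ℝ :=
  ∑ h : H, π h * (if h.1 x = true then 1 else 0)

/-- The predictor of the uniform distribution over the hypotheses `g 0, …, g (R - 1)`. -/
def empirical {H : Finset (X → Bool)} {R : ℕ} (g : Fin R → H) (x : X) : ℝ :=
  (∑ r, if (g r).1 x = true then (1 : ℝ) else 0) / R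

/-- Expected number of misclassified individuals of a `k`-tuple. -/
def error {H : Finset (X → Bool)} {k : ℕ} (π : H → ℝ) (x : Fin k → X) (y : Fin k → Bool) : ℝ :=
  ∑ h : H, π h * ∑ i, (if h.1 (x i) ≠ y i then 1 else 0)

/-! ### Auditors and monotone auditing schemes -/

/-- An auditor, given by its dissimilarity function with values in `[0,1]`
(symmetry is not needed and not required). -/
structure Auditor (X : Type u) where
  dist : X → X → ℝ
  dist_mem : ∀ x x', dist x x' ∈ Set.Icc (0 : ℝ) 1

open Classical in
/-- The objection matrix of an auditor to the predictor `p` on the tuple `x` at sensitivity `a`. -/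
def Auditor.objections {k : ℕ} (j : Auditor X) (p : X → ℝ) (x : Fin k → X) (a : ℝ) :
    Matrix (Fin k) (Fin k) Bool :=
  fun l r => decide (p (x l) - p (x r) > j.dist (x l) (x r) + a)

/-- Functions aggregating `m` objection matrices into one. -/
abbrev Aggregation (m k : ℕ) : Type :=
  (Fin m → Matrix (Fin k) (Fin k) Bool) → Matrix (Fin k) (Fin k) Bool

/-- Independent monotone aggregation functions: every entry is the same monotone function `fbar`
of the corresponding entries (`false ≤ true`, pointwise order on profiles). -/
def Aggregation.IsMonotone {m k : ℕ} (f : Aggregation m k) : Prop :=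
  ∃ fbar : (Fin m → Bool) → Bool, Monotone fbar ∧ ∀ A l r, f A l r = fbar (fun j => A j l r)

/-- Nothing is reported when no auditor objects to anything. -/
def Aggregation.NoSpontaneous {m k : ℕ} (f : Aggregation m k) : Prop :=
  f (fun _ _ _ => false) = fun _ _ => false

/-- An auditing scheme: a nonempty panel, an aggregation function, and the arbitrary rule `pick`
that selects one of the violating pairs. -/
structure Scheme (X : Type u) (k : ℕ) where
  m : ℕ
  m_pos : 0 < m
  panel : Fin m → Auditor X
  agg : Aggregation m k
  pick : (X → ℝ) → ℝ → Matrix (Fin k) (Fin k) Bool → Fin k × Fin k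
  pick_spec : ∀ (p : X → ℝ) (a : ℝ) (A : Matrix (Fin k) (Fin k) Bool),
    (∃ l r, A l r = true) → A (pick p a A).1 (pick p a A).2 = true

/-- The aggregated violation matrix. -/
def Scheme.violations {k : ℕ} (S : Scheme X k) (p : X → ℝ) (x : Fin k → X) (a : ℝ) :
    Matrix (Fin k) (Fin k) Bool :=
  S.agg (fun j => (S.panel j).objections p x a)

open Classical in
/-- The report of the scheme: `none` (Null) or one violating pair. -/
def Scheme.report {k : ℕ} (S : Scheme X k) (p : X → ℝ) (x : Fin k → X) (a : ℝ) :
    Option (Fin k × Fin k) :=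
  if ∃ l r, S.violations p x a l r = true then some (S.pick p a (S.violations p x a)) else none

/-- What the adversary fixes in one round. -/
structure Round (X : Type u) (k : ℕ) where
  x : Fin k → X
  y : Fin k → Bool
  scheme : Scheme X k

/-- Unfairness loss of a predictor in a round. -/
def Round.unfair {k : ℕ} (ρ : Round X k) (p : X → ℝ) (a : ℝ) : ℝ :=
  match ρ.scheme.report p ρ.x a with
  | some _ => 1
  | none => 0

/-- Unfairness proxy loss of `p`, the report having been elicited with the predictor `p'`. -/
def unfairProxy {k : ℕ} (x : Fin k → X) (rep : Option (Fin k × Fin k)) (p p' : X → ℝ) (β : ℝ) :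
    ℝ :=
  match rep with
  | some lr => (p (x lr.1) - p (x lr.2)) - (p' (x lr.1) - p' (x lr.2)) + β
  | none => 0

/-! ### The optimization oracle and computations that call it -/

/-- A batch: a finite multiset of cost-sensitive examples `(x, c)`, where `c b` is the cost of
predicting `b` on `x`. -/
abbrev Batch (X : Type u) : Type u := Multiset (X × (Bool → ℝ))

/-- Total cost of a hypothesis on a batch. -/
def batchCost (S : Batch X) (h : X → Bool) : ℝ := (S.map fun e => e.2 (h e.1)).sum

/-- `erm` is a batch empirical risk minimization oracle for `H` (ties are broken arbitrarily). -/
def IsERM {H : Finset (X → Bool)} (erm : Batch X → H) : Prop :=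
  ∀ S : Batch X, ∀ h ∈ H, batchCost S (erm S).1 ≤ batchCost S h

/-- Computations that may query an oracle (`Q` is the type of queries, `A` that of answers, `B`
that of results). -/
inductive OracleProg (Q A B : Type u) : Type u
  | ret : B → OracleProg Q A B
  | ask : Q → (A → OracleProg Q A B) → OracleProg Q A B

namespace OracleProg

variable {Q A B : Type u}

/-- The result of the computation. -/
def eval (o : Q → A) : OracleProg Q A B → B
  | ret b => b
  | ask q c => eval o (c (o q))

/-- The number of oracle calls made by the computation. -/
def calls (o : Q → A) : OracleProg Q A B → ℕ
  | ret _ => 0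
  | ask q c => calls o (c (o q)) + 1

/-- Ask `n` queries one after the other and continue with the answers. -/
def askAll : (n : ℕ) → (Fin n → Q) → ((Fin n → A) → OracleProg Q A B) → OracleProg Q A B
  | 0, _, c => c Fin.elim0
  | n + 1, q, c => ask (q 0) fun a => askAll n (Fin.tail q) fun as => c (Fin.cons a as)

end OracleProg

/-! ### The algorithm -/

/-- Parameters: violation size `α`, sensitivity `ε`, number `R` of elicitation draws, resampling
cap `M`, Laplace parameter `ω`, step size `μ`. -/
structure Params where
  α : ℝ
  ε : ℝ
  R : ℕ
  M : ℕ
  ω : ℝ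
  μ : ℝ

/-- The Laplace distribution with density `(ω / 2) exp (- ω |z|)`. -/
def laplace (ω : ℝ) : Measure ℝ :=
  volume.withDensity fun z => ENNReal.ofReal (ω / 2 * Real.exp (-(ω * |z|)))

/-- A noise vector: for every point `q` of the separating set, a cost vector for the context
`(q, …, q)`, with one cost for each individual `i : Fin k` and each prediction for `i`. -/
abbrev Noise (Q : Finset X) (k : ℕ) : Type u := (Q × Fin k) × Bool → ℝ

/-- The law of the noise: independent Laplace coordinates. -/
def noiseLaw (Q : Finset X) (k : ℕ) (ω : ℝ) : Measure (Noise Q k) :=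
  Measure.pi fun _ => laplace ω

/-- State of the learner: the batch of estimated costs of the past, and the multiplier. -/
structure LearnerState (X : Type u) where
  hist : Batch X
  lam : ℝ

/-- The oracle query of Follow-The-Perturbed-Leader: the past, with the fake noisy examples. -/
def ftplQuery {Q : Finset X} {k : ℕ} (hist : Batch X) (z : Noise Q k) : Batch X :=
  hist + (Finset.univ : Finset (Q × Fin k)).val.map fun q => (q.1.1, fun b => z (q, b))

/-- The policy `π ∈ ΔH` deployed implicitly: the law of the oracle's answer to `ftplQuery`. -/
def ftplPolicy {H : Finset (X → Bool)} (erm : Batch X → H) (Q : Finset X) (k : ℕ) (ω : ℝ)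
    (hist : Batch X) (h : H) : ℝ :=
  (noiseLaw Q k ω).real {z | erm (ftplQuery hist z) = h}

/-- Names of the draws from the deployed policy in one round: the elicitation draws, the draw that
is played, and the resampling draws for each individual. -/
abbrev DrawIdx (R M k : ℕ) : Type := (Fin R ⊕ Unit) ⊕ Fin (k * M)

/-- What a round produces on the learner's side. -/
structure Outcome (H : Finset (X → Bool)) (R M k : ℕ) where
  /-- the elicitation draws, defining the approximate policy -/
  elicited : Fin R → H
  /-- the pair reported by the auditing scheme for the approximate policy, if any -/
  report : Option (Fin k × Fin k)
  /-- the hypothesis used for predicting -/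
  played : H
  /-- the hypotheses drawn in geometric resampling -/
  resampled : Fin k → Fin M → H
  /-- the estimated costs to be appended to the history -/
  estimate : Batch X

/-- Observed cost of the prediction `b` actually made on individual `i`. The label part is, up to
the factor `1 / k`, equal to `2 * 1[y = 0]` for a positive prediction, whose label is seen, and to
`1` for a negative one, whose label is not seen: this is the misclassification loss plus the term
`1 - y`, which does not depend on the prediction. The other part is `lam` times the
prediction-dependent part `h(x^l) - h(x^r)` of the unfairness proxy loss, plus the constant `lam`.
Summed over `i`, these nonnegative costs are the Lagrangian loss plus a term that is
independent of the hypothesis. -/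
def observedCost {k : ℕ} (lam : ℝ) (rep : Option (Fin k × Fin k)) (i : Fin k) (b : Bool)
    (label : Option Bool) : ℝ :=
  (match label with
    | some y => if y = true then 0 else 2
    | none => 1) / k +
  lam * (match rep with
    | some lr => (if i = lr.1 ∧ b = true then 1 else 0) + (if i = lr.2 ∧ b = false then 1 else 0)
    | none => 0)

/-- Geometric resampling: the number of redraws until the prediction `b` on `x` is
seen again, capped at `M` (the number of indices before which it has not been seen). -/
def resampleCount {H : Finset (X → Bool)} {M : ℕ} (g : Fin M → H) (x : X) (b : Bool) : ℕ :=
  (Finset.univ.filter fun n : Fin M => ∀ n' < n, (g n').1 x ≠ b).card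

/-- Estimated costs: the cost of the prediction made is multiplied by the resampling count, the
cost of the other prediction is estimated by `0`. -/
def estimatedCosts {H : Finset (X → Bool)} {M k : ℕ} (lam : ℝ) (x : Fin k → X)
    (rep : Option (Fin k × Fin k)) (h : H) (labels : Fin k → Option Bool)
    (g : Fin k → Fin M → H) : Batch X :=
  (Finset.univ : Finset (Fin k)).val.map fun i =>
    (x i, fun b =>
      if b = h.1 (x i) then
        (resampleCount (g i) (x i) b : ℝ) * observedCost lam rep i b (labels i)
      else 0)

/-- One-sided feedback: the labels of the individuals with a positive prediction. -/
def oneSided {k : ℕ} (y : Fin k → Bool) (pred : Fin k → Bool) : Fin k → Option Bool :=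
  fun i => if pred i = true then some (y i) else none

/-- One round of the learner. It has access to the individuals `x`, to the auditing scheme through
`audit`, and to the labels through `feedback`. Every draw from the implicit policy uses fresh noise
and one oracle call. -/
def roundProg {H : Finset (X → Bool)} {Q : Finset X} {k : ℕ} (P : Params) (st : LearnerState X)
    (x : Fin k → X) (audit : (X → ℝ) → ℝ → Option (Fin k × Fin k))
    (feedback : (Fin k → Bool) → Fin k → Option Bool)
    (z : DrawIdx P.R P.M k → Noise Q k) :
    OracleProg (Batch X) H (Outcome H P.R P.M k) :=
  .askAll P.R (fun r => ftplQuery st.hist (z (.inl (.inl r)))) fun elicited =>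
    let rep := audit (empirical elicited) (P.α - P.ε / 2)
    .ask (ftplQuery st.hist (z (.inl (.inr ())))) fun h =>
      let labels := feedback fun i => h.1 (x i)
      .askAll (k * P.M) (fun j => ftplQuery st.hist (z (.inr j))) fun redraws =>
        let g : Fin k → Fin P.M → H := fun i n => redraws (finProdFinEquiv (i, n))
        .ret ⟨elicited, rep, h, g, estimatedCosts st.lam x rep h labels g⟩

/-- An adaptive adversary: it fixes the round as a function of all that happened on the learner's
side in the earlier rounds (most recent round first). -/
abbrev Adversary (H : Finset (X → Bool)) (R M k : ℕ) : Type u :=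
  List (Outcome H R M k) → Round X k

/-- The learner's state after given outcomes: the estimated costs are appended to the history, and
the multiplier makes a projected gradient ascent step on the regularized Lagrangian loss
of the deployed policy. -/
def stateAfter {H : Finset (X → Bool)} (erm : Batch X → H) (Q : Finset X) {k : ℕ} (P : Params)
    (adv : Adversary H P.R P.M k) : List (Outcome H P.R P.M k) → LearnerState X
  | [] => ⟨0, 0⟩
  | o :: past =>
    let st := stateAfter erm Q P adv past
    let π := ftplPolicy erm Q k P.ω st.hist
    ⟨st.hist + o.estimate,
      max 0 (st.lam + P.μ *
        (unfairProxy (adv past).x o.report (mix π) (empirical o.elicited) (P.ε / 2)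
          - P.μ * st.lam))⟩

/-- The learner's computation in the round that follows the outcomes `past`. -/
def nextRound {H : Finset (X → Bool)} (erm : Batch X → H) (Q : Finset X) {k : ℕ} (P : Params)
    (adv : Adversary H P.R P.M k) (past : List (Outcome H P.R P.M k))
    (z : DrawIdx P.R P.M k → Noise Q k) :
    OracleProg (Batch X) H (Outcome H P.R P.M k) :=
  roundProg P (stateAfter erm Q P adv past) (adv past).x
    (fun p a => (adv past).scheme.report p (adv past).x a) (oneSided (adv past).y) z

/-- All the noise used in `T` rounds. -/
abbrev Tape (Q : Finset X) (P : Params) (k T : ℕ) : Type u :=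
  Fin T → DrawIdx P.R P.M k → Noise Q k

/-- The law of the tape: all noise vectors are independent. -/
def tapeLaw (Q : Finset X) (P : Params) (k T : ℕ) : Measure (Tape Q P k T) :=
  Measure.pi fun _ => Measure.pi fun _ => noiseLaw Q k P.ω

/-- The outcomes of the first `t` rounds (most recent first); only `t ≤ T` matters. -/
def run {H : Finset (X → Bool)} (erm : Batch X → H) {Q : Finset X} {k T : ℕ} (P : Params)
    (adv : Adversary H P.R P.M k) (z : Tape Q P k T) : ℕ → List (Outcome H P.R P.M k)
  | 0 => []
  | t + 1 =>
    let past := run erm P adv z t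
    if ht : t < T then (nextRound erm Q P adv past (z ⟨t, ht⟩)).eval erm :: past else past

section Quantities

variable {H : Finset (X → Bool)} (erm : Batch X → H) {Q : Finset X} {k T : ℕ} (P : Params)
  (adv : Adversary H P.R P.M k) (z : Tape Q P k T)

/-- The round fixed by the adversary at time `t`. -/
def roundAt (t : Fin T) : Round X k := adv (run erm P adv z t)

/-- The policy `π^t` deployed at time `t`. -/
def policyAt (t : Fin T) : H → ℝ :=
  ftplPolicy erm Q k P.ω (stateAfter erm Q P adv (run erm P adv z t)).hist

/-- Number of oracle calls at time `t`. -/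
def callsAt (t : Fin T) : ℕ := (nextRound erm Q P adv (run erm P adv z t) (z t)).calls erm

/-- The policies with no violation of sensitivity `a` on the realized sequence. -/
def fairPolicies (a : ℝ) : Set (H → ℝ) :=
  {π | π ∈ stdSimplex ℝ H ∧ ∀ t : Fin T, (roundAt erm P adv z t).unfair (mix π) a = 0}

/-- Regret of the deployed policies against a class of policies, on the realized sequence. -/
def regret (U : Set (H → ℝ)) : ℝ :=
  (∑ t : Fin T, error (policyAt erm P adv z t) (roundAt erm P adv z t).x (roundAt erm P adv z t).y)
  - sInf ((fun π : H → ℝ =>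
      ∑ t : Fin T, error π (roundAt erm P adv z t).x (roundAt erm P adv z t).y) '' U)

/-- Number of rounds in which the deployed policy has an `a`-violation. -/
def violationCount (a : ℝ) : ℝ :=
  ∑ t : Fin T, (roundAt erm P adv z t).unfair (mix (policyAt erm P adv z t)) a

end Quantities

/-! ### Standing assumptions and the choice of the parameters -/

/-- `Q` separates the hypotheses of `H`. -/
def IsSeparating (H : Finset (X → Bool)) (Q : Finset X) : Prop :=
  ∀ h ∈ H, ∀ h' ∈ H, h ≠ h' → ∃ x ∈ Q, h x ≠ h' x

/-- `H` contains a constant classifier. -/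
def HasConstant (H : Finset (X → Bool)) : Prop := ∃ b : Bool, (fun _ => b) ∈ H

/-- The parameters, with `ε = α` and `μ = T ^ (-1/3)`, for a separating set of size `s`. -/
def chosenParams (k T s : ℕ) (α δ : ℝ) : Params where
  α := α
  ε := α
  R := ⌈64 * α ^ (-2 : ℤ) * Real.log (2 * k * T / δ)⌉₊
  M := ⌈16 * k / ((T : ℝ) ^ (-(1 / 3) : ℝ) * Real.exp 1)⌉₊
  ω := ((T : ℝ) ^ (-(1 / 3) : ℝ)) ^ 2 * Real.exp 1 / (512 * s * (k : ℝ) ^ 4)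
  μ := (T : ℝ) ^ (-(1 / 3) : ℝ)

end FairOnline

end

/-! The proof plays two online learners against each other on a Lagrangian loss: FTPL chooses the
policy, and regularized gradient ascent chooses the multiplier. Only the bandit estimates and the
elicitation draws can fail, and a single nonnegative process controls both.

FTPL. The expected least perturbed cost is a potential Φ of the history. Appending a batch raises Φ
at least by the mean cost of the policy that has already seen the batch
(`sum_ftplPolicy_mul_le_potential`). A Laplace density changes by at most a factor exp(ω|a|) under a
shift by a, so the deployed policy and that later one have comparable weights (`ftplPolicy_stable`).
Telescoping Φ therefore bounds the regret on the estimated costs surely, for every adaptive history.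

From estimated to true regret. For each comparator f, the exponential of θ times the accumulated gap
between true and estimated regret, compensated by μ(1 + λ²/2) in every round, is a supermartingale
(`lintegral_exp_gapSum_le`). The auditors' report depends only on the elicitation draws and is thus
independent of the draws used for estimation. Resampling is unbiased up to a term 1/(eM), and its
second moment is only M times the square of the cost scale. The average of these exponentials over
f, plus the number of rounds in which the elicited hypotheses misrepresent the policy (Hoeffding),
has mean at most δ at the end. Markov's inequality gives an event of probability at least 1 - δ on
which everything else is deterministic.

On that event, a report makes the proxy loss of the deployed policy at least α/4, and no report
excludes an α-violation (`unfair_mul_le_proxyAt`). A fair comparator always has nonpositive proxy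
loss, because some auditor objects to the elicited policy and not to the comparator
(`proxyAt_nonpos_of_fair`). Adding the two regret bounds, the regularizer's -μλ²/2 cancels the
compensator, which leaves a bound on regret/k + λ(α/4)·(number of violations) for every fixed λ ≥ 0
(`sum_error_add_lam_mul_le`). The choice λ = 0 bounds the regret. The choice λ = T^(1/6), with
regret at least -kT, bounds the violations. -/

/-! ### Product measures and the Laplace distribution -/

theorem MeasureTheory.Measure.pi_le_pi {ι : Type*} [Fintype ι] {α : ι → Type*}
    [∀ i, MeasurableSpace (α i)] {μ ν : ∀ i, Measure (α i)} [∀ i, SigmaFinite (μ i)]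
    (h : ∀ i, μ i ≤ ν i) : Measure.pi μ ≤ Measure.pi ν := by
  refine Measure.le_iff.2 fun s hs => ?_
  -- `OuterMeasure.pi` is the largest outer measure bounded on boxes by the products, so it suffices
  -- to compare boxes.
  have : (Measure.pi μ).toOuterMeasure ≤ OuterMeasure.pi fun i => (ν i).toOuterMeasure := by
    rw [OuterMeasure.le_pi]
    intro t _
    change Measure.pi μ _ ≤ _
    rw [Measure.pi_pi]
    exact Finset.prod_le_prod' fun i _ => h i _
  refine (this s).trans ?_
  rw [Measure.pi, toMeasure_apply _ _ hs]

theorem MeasureTheory.Measure.pi_smul {ι : Type*} [Fintype ι] {α : ι → Type*}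
    [∀ i, MeasurableSpace (α i)] (ν : ∀ i, Measure (α i)) [∀ i, SigmaFinite (ν i)]
    (c : ι → NNReal) : Measure.pi (fun i => c i • ν i) = (∏ i, c i) • Measure.pi ν := by
  refine Measure.pi_eq fun s _ => ?_
  rw [Measure.smul_apply, Measure.pi_pi]
  simp only [Measure.smul_apply, ENNReal.smul_def, smul_eq_mul, Finset.prod_mul_distrib,
    ENNReal.ofNNReal_finsetProd]

namespace FairOnline

theorem laplace_apply (ω : ℝ) {s : Set ℝ} (hs : MeasurableSet s) :
    laplace ω s = ∫⁻ z, s.indicator (fun z => ENNReal.ofReal (ω / 2 * Real.exp (-(ω * |z|)))) z := by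
  rw [laplace, withDensity_apply _ hs, lintegral_indicator hs]

theorem laplace_le_volume {ω : ℝ} (hω : 0 < ω) : laplace ω ≤ (ω / 2).toNNReal • volume := by
  refine Measure.le_iff.2 fun s hs => ?_
  rw [laplace, withDensity_apply _ hs, Measure.smul_apply, ENNReal.smul_def, smul_eq_mul,
    ← setLIntegral_const]
  refine lintegral_mono fun z => ENNReal.ofReal_le_ofReal ?_
  have : Real.exp (-(ω * |z|)) ≤ 1 := Real.exp_le_one_iff.2 (by have := abs_nonneg z; nlinarith)
  nlinarith

/-- By the triangle inequality for |z|, a translation changes the logarithm of the density by at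
most ω|a|. This is the source of the stability of the policy. -/
theorem laplace_map_add_le {ω : ℝ} (hω : 0 < ω) (a : ℝ) :
    (laplace ω).map (· + a) ≤ (Real.exp (ω * |a|)).toNNReal • laplace ω := by
  refine Measure.le_iff.2 fun s hs => ?_
  rw [Measure.map_apply (by fun_prop) hs, laplace_apply ω (hs.preimage (by fun_prop)),
    Measure.smul_apply, ENNReal.smul_def, smul_eq_mul, laplace_apply ω hs,
    ← lintegral_const_mul' _ _ ENNReal.coe_ne_top,
    ← lintegral_add_right_eq_self (μ := volume) (fun z => ((Real.exp (ω * |a|)).toNNReal : ENNReal) *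
      s.indicator (fun z => ENNReal.ofReal (ω / 2 * Real.exp (-(ω * |z|)))) z) a]
  refine lintegral_mono fun z => ?_
  by_cases hz : z + a ∈ s
  · rw [Set.indicator_of_mem (show z ∈ (· + a) ⁻¹' s from hz), Set.indicator_of_mem hz]
    change _ ≤ ENNReal.ofReal _ * _
    rw [← ENNReal.ofReal_mul (Real.exp_pos _).le]
    refine ENNReal.ofReal_le_ofReal ?_
    rw [mul_left_comm, ← Real.exp_add]
    have h1 : |z + a| ≤ |z| + |a| := abs_add_le z a
    gcongr
    nlinarith
  · rw [Set.indicator_of_notMem (show z ∉ (· + a) ⁻¹' s from hz)]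
    exact zero_le

theorem laplace_mgf_aux {ω θ : ℝ} (hθ : |θ| < ω) :
    Integrable (fun z : ℝ => Real.exp (θ * z - ω * |z|)) ∧
      ∫ z : ℝ, Real.exp (θ * z - ω * |z|) = 1 / (ω + θ) + 1 / (ω - θ) := by
  obtain ⟨h1, h2⟩ := abs_lt.1 hθ
  have e1 : Set.EqOn (fun z : ℝ => Real.exp ((ω + θ) * z)) (fun z => Real.exp (θ * z - ω * |z|))
      (Set.Iic 0) := fun z hz => by
    have : |z| = -z := abs_of_nonpos hz
    simp only [this]; congr 1; ring
  have e2 : Set.EqOn (fun z : ℝ => Real.exp ((θ - ω) * z)) (fun z => Real.exp (θ * z - ω * |z|))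
      (Set.Ioi 0) := fun z hz => by
    have : |z| = z := abs_of_pos hz
    simp only [this]; congr 1; ring
  have i1 := (integrableOn_exp_mul_Iic (a := ω + θ) (by linarith) 0).congr_fun e1 measurableSet_Iic
  have i2 := (integrableOn_exp_mul_Ioi (a := θ - ω) (by linarith) 0).congr_fun e2 measurableSet_Ioi
  have hu : (Set.Iic (0:ℝ)) ∪ Set.Ioi 0 = Set.univ := Set.Iic_union_Ioi
  have hi : Integrable (fun z : ℝ => Real.exp (θ * z - ω * |z|)) := by
    rw [← integrableOn_univ, ← hu]
    exact i1.union i2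
  refine ⟨hi, ?_⟩
  rw [← intervalIntegral.integral_Iic_add_Ioi i1 i2, ← setIntegral_congr_fun measurableSet_Iic e1,
    ← setIntegral_congr_fun measurableSet_Ioi e2, integral_exp_mul_Iic (by linarith),
    integral_exp_mul_Ioi (by linarith)]
  have : θ - ω ≠ 0 := by linarith
  have : ω - θ ≠ 0 := by linarith
  have : ω + θ ≠ 0 := by linarith
  simp
  rw [← neg_sub ω θ, neg_div_neg_eq, one_div]

theorem laplace_mgf {ω θ : ℝ} (hθ : |θ| < ω) :
    Integrable (fun z : ℝ => Real.exp (θ * z)) (laplace ω) ∧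
      ∫ z, Real.exp (θ * z) ∂(laplace ω) = ω ^ 2 / (ω ^ 2 - θ ^ 2) := by
  have hω : 0 < ω := (abs_nonneg θ).trans_lt hθ
  obtain ⟨h1, h2⟩ := laplace_mgf_aux hθ
  have hm : Measurable fun z : ℝ => ENNReal.ofReal (ω / 2 * Real.exp (-(ω * |z|))) := by fun_prop
  have e : ∀ z : ℝ, (ENNReal.ofReal (ω / 2 * Real.exp (-(ω * |z|)))).toReal • Real.exp (θ * z)
      = ω / 2 * Real.exp (θ * z - ω * |z|) := fun z => by
    rw [ENNReal.toReal_ofReal (by positivity), smul_eq_mul, mul_assoc, ← Real.exp_add]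
    congr 2; ring
  constructor
  · rw [laplace, integrable_withDensity_iff_integrable_smul' hm (by simp)]
    simp_rw [e]
    exact h1.const_mul _
  · rw [laplace, integral_withDensity_eq_integral_toReal_smul hm (by simp)]
    simp_rw [e]
    rw [integral_const_mul, h2]
    obtain ⟨h1, h2⟩ := abs_lt.1 hθ
    have : ω - θ ≠ 0 := by linarith
    have : ω + θ ≠ 0 := by linarith
    have : ω ^ 2 - θ ^ 2 ≠ 0 := by
      rw [sq_sub_sq]; positivity
    field_simp
    ring

/-- The total mass is the moment generating function at 0. -/
theorem isProbabilityMeasure_laplace {ω : ℝ} (hω : 0 < ω) : IsProbabilityMeasure (laplace ω) := by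
  obtain ⟨-, h⟩ := laplace_mgf (ω := ω) (θ := 0) (by simpa using hω)
  have h3 : (laplace ω).real Set.univ = 1 := by
    have : ω ^ 2 ≠ 0 := by positivity
    simpa [this] using h
  refine ⟨?_⟩
  rw [Measure.real, ENNReal.toReal_eq_one_iff] at h3
  exact h3

end FairOnline

/-! ### Noise vectors: translations, ties and exponential moments -/

namespace FairOnline

section Batches

variable {X : Type u}

@[simp] theorem batchCost_zero (f : X → Bool) : batchCost 0 f = 0 := by simp [batchCost]

theorem batchCost_add (S S' : Batch X) (f : X → Bool) :
    batchCost (S + S') f = batchCost S f + batchCost S' f := by simp [batchCost]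

/-- The total perturbation of a hypothesis. -/
noncomputable def noiseCost {Q : Finset X} {k : ℕ} (f : X → Bool) (z : Noise Q k) : ℝ :=
  ∑ q : Q × Fin k, z (q, f q.1.1)

theorem batchCost_ftplQuery {Q : Finset X} {k : ℕ} (hist : Batch X) (z : Noise Q k)
    (f : X → Bool) : batchCost (ftplQuery hist z) f = batchCost hist f + noiseCost f z := by
  rw [ftplQuery, batchCost_add]
  simp only [batchCost, Multiset.map_map]
  rfl

theorem measurable_noiseCost {Q : Finset X} {k : ℕ} (f : X → Bool) :
    Measurable (noiseCost (Q := Q) (k := k) f) := by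
  unfold noiseCost; fun_prop

theorem noiseCost_add {Q : Finset X} {k : ℕ} (f : X → Bool) (z v : Noise Q k) :
    noiseCost f (z + v) = noiseCost f z + noiseCost f v := by
  simp [noiseCost, Finset.sum_add_distrib]

end Batches

section Law

variable {X : Type u} {Q : Finset X} {k : ℕ} {ω : ℝ}

theorem isProbabilityMeasure_noiseLaw (hω : 0 < ω) : IsProbabilityMeasure (noiseLaw Q k ω) := by
  have := isProbabilityMeasure_laplace hω
  unfold noiseLaw; infer_instance

theorem noiseLaw_map_add_le (hω : 0 < ω) (v : Noise Q k) :
    (noiseLaw Q k ω).map (· + v) ≤ (Real.exp (ω * ∑ j, |v j|)).toNNReal • noiseLaw Q k ω := by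
  have := isProbabilityMeasure_laplace hω
  have hs : ∀ j, IsProbabilityMeasure ((laplace ω).map (· + v j)) := fun j =>
    Measure.isProbabilityMeasure_map (by fun_prop)
  have h1 : (noiseLaw Q k ω).map (· + v) = Measure.pi fun j => (laplace ω).map (· + v j) := by
    rw [← Measure.pi_map_pi (fun j => by fun_prop)]
    rfl
  have h2 := Measure.pi_smul (fun _ : (Q × Fin k) × Bool => laplace ω)
    fun j => (Real.exp (ω * |v j|)).toNNReal
  rw [h1]
  refine (Measure.pi_le_pi fun j => laplace_map_add_le hω (v j)).trans (le_of_eq ?_)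
  rw [h2, noiseLaw, Finset.mul_sum, Real.exp_sum,
    Real.toNNReal_prod_of_nonneg fun _ _ => (Real.exp_pos _).le]

theorem volume_setOf_linear_eq_zero {E : Type*} [NormedAddCommGroup E] [NormedSpace ℝ E]
    [MeasurableSpace E] [BorelSpace E] [FiniteDimensional ℝ E] (μ : Measure E)
    [μ.IsAddHaarMeasure] (L : E →ₗ[ℝ] ℝ) (hL : L ≠ 0) (c : ℝ) : μ {z | L z = c} = 0 := by
  rcases Set.eq_empty_or_nonempty {z | L z = c} with h | ⟨z₀, hz₀⟩
  · simp [h]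
  have : {z | L z = c} = (AffineSubspace.mk' z₀ (LinearMap.ker L) : Set E) := by
    ext z
    have : L z₀ = c := hz₀
    simp [AffineSubspace.mem_mk', sub_eq_zero, this]
  rw [this]
  refine Measure.addHaar_affineSubspace μ _ fun h => hL ?_
  have := congrArg AffineSubspace.direction h
  rw [AffineSubspace.direction_mk', AffineSubspace.direction_top, LinearMap.ker_eq_top] at this
  exact this

/-- The noise has a bounded density, and the difference of two noise costs is a linear functional
that is nonzero because `f` and `g` differ on `Q`. Its level sets are hyperplanes or empty, hence
null. -/
theorem noiseLaw_tie_eq_zero (hω : 0 < ω) (hk : 0 < k) {f g : X → Bool}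
    (hfg : ∃ q ∈ Q, f q ≠ g q) (c : ℝ) :
    noiseLaw Q k ω {z | noiseCost f z - noiseCost g z = c} = 0 := by
  classical
  have := isProbabilityMeasure_laplace hω
  have hle : noiseLaw Q k ω ≤
      (∏ _j : (Q × Fin k) × Bool, (ω / 2).toNNReal) • (volume : Measure (Noise Q k)) := by
    rw [show (volume : Measure (Noise Q k)) = Measure.pi fun _ => volume from rfl,
      ← Measure.pi_smul]
    exact Measure.pi_le_pi fun _ => laplace_le_volume hω
  refine Measure.absolutelyContinuous_of_le hle ?_
  rw [Measure.smul_apply, ENNReal.smul_def, smul_eq_mul]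
  refine mul_eq_zero_of_right _ ?_
  let L : Noise Q k →ₗ[ℝ] ℝ :=
    ∑ q : Q × Fin k, (LinearMap.proj (R := ℝ) (φ := fun _ : (Q × Fin k) × Bool => ℝ) (q, f q.1.1)
      - LinearMap.proj (q, g q.1.1))
  have hL : ∀ z, L z = noiseCost f z - noiseCost g z := fun z => by
    simp [L, noiseCost, Finset.sum_sub_distrib]
  have := volume_setOf_linear_eq_zero (volume : Measure (Noise Q k)) L ?_ c
  · simpa only [hL] using this
  · obtain ⟨q, hq, hne⟩ := hfg
    intro h0
    -- The unit vector at a point where `f` and `g` differ is charged to `f` and not to `g`.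
    have h1 := hL (Pi.single ((⟨q, hq⟩, ⟨0, hk⟩), f q) 1)
    have h2 : noiseCost f (Pi.single ((⟨q, hq⟩, ⟨0, hk⟩), f q) 1 : Noise Q k) = 1 := by
      rw [noiseCost, Finset.sum_eq_single ((⟨q, hq⟩, ⟨0, hk⟩) : Q × Fin k)]
      · simp
      · intro b _ hb
        exact Pi.single_eq_of_ne (by simp [hb]) _
      · simp
    have h3 : noiseCost g (Pi.single ((⟨q, hq⟩, ⟨0, hk⟩), f q) 1 : Noise Q k) = 0 := by
      refine Finset.sum_eq_zero fun b _ => Pi.single_eq_of_ne ?_ _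
      rintro h
      obtain ⟨rfl, h⟩ := Prod.ext_iff.1 h
      exact hne h.symm
    rw [h0, h2, h3] at h1
    norm_num at h1

theorem noiseCost_mgf {θ : ℝ} (hθ : |θ| < ω) (f : X → Bool) :
    Integrable (fun z => Real.exp (θ * noiseCost f z)) (noiseLaw Q k ω) ∧
      ∫ z, Real.exp (θ * noiseCost f z) ∂(noiseLaw Q k ω)
        = (ω ^ 2 / (ω ^ 2 - θ ^ 2)) ^ (Q.card * k) := by
  have hω : 0 < ω := (abs_nonneg θ).trans_lt hθ
  have := isProbabilityMeasure_laplace hω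
  -- For each pair (point, individual), `f` reads exactly one of the two coordinates. The unread
  -- ones contribute a factor 1, which makes the integrand a product over all coordinates.
  have e : ∀ z : Noise Q k, Real.exp (θ * noiseCost f z)
      = ∏ j : (Q × Fin k) × Bool, (if f j.1.1.1 = j.2 then Real.exp (θ * z j) else 1) := by
    intro z
    rw [noiseCost, Finset.mul_sum, Real.exp_sum]
    conv_rhs => rw [Fintype.prod_prod_type]
    refine Finset.prod_congr rfl fun q _ => ?_
    dsimp only
    rw [Finset.prod_ite_eq, if_pos (Finset.mem_univ _)]
  obtain ⟨hi, hI⟩ := laplace_mgf hθ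
  have e' : ∀ (p : Prop) [Decidable p], (fun x : ℝ => if p then Real.exp (θ * x) else 1)
      = if p then (fun x => Real.exp (θ * x)) else fun _ => 1 := fun p _ => by
    split_ifs <;> rfl
  simp_rw [e]
  constructor
  · refine Integrable.fintype_prod (μ := fun _ : (Q × Fin k) × Bool => laplace ω)
      (f := fun j x => if f j.1.1.1 = j.2 then Real.exp (θ * x) else 1) fun j => ?_
    rw [e']
    split_ifs
    · exact hi
    · exact integrable_const _
  · rw [noiseLaw, integral_fintype_prod_eq_prod
      (f := fun (j : (Q × Fin k) × Bool) (x : ℝ) => if f j.1.1.1 = j.2 then Real.exp (θ * x) else 1)]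
    have : ∀ j : (Q × Fin k) × Bool,
        ∫ x, (if f j.1.1.1 = j.2 then Real.exp (θ * x) else 1) ∂(laplace ω)
          = if f j.1.1.1 = j.2 then ω ^ 2 / (ω ^ 2 - θ ^ 2) else 1 := fun j => by
      rw [e']
      split_ifs
      · exact hI
      · simp
    simp_rw [this]
    rw [Fintype.prod_prod_type]
    simp [div_pow]

/-- The scale is θ = ±ω/(2√n) with n = sk: each of the n factors is 4n/(4n - 1) ≤ exp(2/(3n)), and
e^(2/3) < 2. Both signs are needed, for the upper and the lower bound of the potential. -/
theorem noiseCost_mgf_le {θ : ℝ} (hω : 0 < ω) (hn : 0 < Q.card * k)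
    (hθ : θ ^ 2 = ω ^ 2 / (4 * (Q.card * k : ℕ))) (f : X → Bool) :
    Integrable (fun z => Real.exp (θ * noiseCost f z)) (noiseLaw Q k ω) ∧
      ∫ z, Real.exp (θ * noiseCost f z) ∂(noiseLaw Q k ω) ≤ 2 := by
  set n := Q.card * k
  have hn' : (1 : ℝ) ≤ n := by exact_mod_cast hn
  have hlt : |θ| < ω := by
    refine abs_lt_of_sq_lt_sq ?_ hω.le
    rw [hθ, div_lt_iff₀ (by positivity)]
    have : 0 < ω ^ 2 := by positivity
    nlinarith
  obtain ⟨h1, h2⟩ := noiseCost_mgf (Q := Q) (k := k) hlt f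
  refine ⟨h1, h2.trans_le ?_⟩
  have hK : ω ^ 2 / (ω ^ 2 - θ ^ 2) ≤ Real.exp (2 / 3 / n) := by
    have h3 : ω ^ 2 / (ω ^ 2 - θ ^ 2) = 1 / (4 * n - 1) + 1 := by
      rw [hθ]
      have : (4 * n - 1 : ℝ) ≠ 0 := by linarith
      have : ω ^ 2 - ω ^ 2 / (4 * n) ≠ 0 := by
        have : ω ^ 2 - ω ^ 2 / (4 * n) = ω ^ 2 * (4 * n - 1) / (4 * n) := by field_simp
        rw [this]; positivity
      field_simp
      ring
    rw [h3]
    refine le_trans ?_ (Real.add_one_le_exp _)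
    refine add_le_add_left ?_ 1
    rw [div_div, div_le_div_iff₀ (by linarith) (by positivity)]
    linarith
  calc (ω ^ 2 / (ω ^ 2 - θ ^ 2)) ^ n ≤ (Real.exp (2 / 3 / n)) ^ n := by
        refine pow_le_pow_left₀ (div_nonneg (sq_nonneg _) ?_) hK n
        nlinarith [sq_abs θ, abs_nonneg θ]
    _ = Real.exp (2 / 3) := by
        rw [← Real.exp_nat_mul]; congr 1; field_simp
    _ ≤ 2 := by
        rw [← Real.le_log_iff_exp_le (by norm_num)]
        linarith [Real.log_two_gt_d9]

theorem integrable_laplace_id (hω : 0 < ω) : Integrable (fun z : ℝ => z) (laplace ω) := by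
  have h1 := (laplace_mgf (ω := ω) (θ := ω / 2) (by rw [abs_of_pos] <;> linarith)).1
  have h2 := (laplace_mgf (ω := ω) (θ := -(ω / 2)) (by rw [abs_neg, abs_of_pos] <;> linarith)).1
  refine ((h1.add h2).const_mul (2 / ω)).mono' (by fun_prop) (Filter.Eventually.of_forall fun z => ?_)
  have e1 := Real.add_one_le_exp (ω / 2 * z)
  have e2 := Real.add_one_le_exp (-(ω / 2) * z)
  have p1 := Real.exp_pos (ω / 2 * z)
  have p2 := Real.exp_pos (-(ω / 2) * z)
  rw [Real.norm_eq_abs, Pi.add_apply, ← div_le_iff₀' (by positivity),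
    div_div_eq_mul_div, div_le_iff₀ two_pos, ← le_div_iff₀ hω, abs_le', le_div_iff₀ hω,
    le_div_iff₀ hω]
  constructor
  · linarith
  · linarith

theorem integrable_noiseCost (hω : 0 < ω) (f : X → Bool) :
    Integrable (noiseCost f) (noiseLaw Q k ω) := by
  have := isProbabilityMeasure_laplace hω
  unfold noiseCost
  refine integrable_finsetSum _ fun q _ => ?_
  have := (measurePreserving_eval (fun _ : (Q × Fin k) × Bool => laplace ω) (q, f q.1.1)).integrable_comp
    (g := fun z : ℝ => z) (by fun_prop)
  exact this.2 (integrable_laplace_id hω)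

end Law

end FairOnline

/-! ### Follow-The-Perturbed-Leader: the deployed policy, its stability and its potential -/

namespace FairOnline

variable {X : Type u}

/-- For uncountable `X` a singleton is not measurable in the product σ-algebra. Within the finite
class, however, finitely many evaluations isolate a hypothesis. -/
instance hypothesesMeasurableSingletonClass {H : Finset (X → Bool)} : MeasurableSingletonClass H where
  measurableSet_singleton h := by
    classical
    have hx : ∀ h' : H, ∃ s : Set H, MeasurableSet s ∧ h ∈ s ∧ (h' ≠ h → h' ∉ s) := fun h' => by
      by_cases e : h' = h
      · exact ⟨Set.univ, .univ, trivial, fun h => absurd e h⟩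
      · obtain ⟨x, hx⟩ := Function.ne_iff.1 fun e' => e (Subtype.ext e')
        refine ⟨(fun g : H => g.1 x) ⁻¹' {h.1 x}, ?_, rfl, fun _ => hx⟩
        exact ((measurable_pi_apply x).comp measurable_subtype_coe) (measurableSet_singleton _)
    choose s hs h1 h2 using hx
    have : ({h} : Set H) = ⋂ h', s h' := by
      ext g
      simp only [Set.mem_singleton_iff, Set.mem_iInter]
      constructor
      · rintro rfl; exact h1
      · intro hg
        by_contra hne
        exact h2 g hne (hg g)
    rw [this]
    exact .iInter hs

variable {H : Finset (X → Bool)} {erm : Batch X → H} {Q : Finset X} {k : ℕ} {ω : ℝ}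

/-- The noise vectors for which `h` minimizes the perturbed cost. -/
def argminSet (H : Finset (X → Bool)) (Q : Finset X) (k : ℕ) (hist : Batch X) (h : H) :
    Set (Noise Q k) :=
  {z | ∀ h' : H, batchCost hist h + noiseCost h z ≤ batchCost hist h' + noiseCost h' z}

theorem measurableSet_argminSet (hist : Batch X) (h : H) :
    MeasurableSet (argminSet H Q k hist h) := by
  rw [argminSet, Set.ofPred_forall]
  refine .iInter fun h' => measurableSet_le ?_ ?_
  · exact (measurable_noiseCost _).const_add _
  · exact (measurable_noiseCost _).const_add _

/-- The tie-breaking rule of the oracle is arbitrary and need not be measurable. Off the null set of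
ties the answer is the unique minimizer, so the events are null-measurable and the policy does not
depend on the rule. -/
theorem ftpl_eq_ae_argminSet (hω : 0 < ω) (hk : 0 < k) (hsep : IsSeparating H Q) (herm : IsERM erm)
    (hist : Batch X) (h : H) :
    {z | erm (ftplQuery hist z) = h} =ᵐ[noiseLaw Q k ω] argminSet H Q k hist h := by
  have hties : ∀ᵐ z ∂noiseLaw Q k ω, ∀ h' : H, h' ≠ h →
      noiseCost h.1 z - noiseCost h'.1 z ≠ batchCost hist h' - batchCost hist h := by
    rw [ae_all_iff]
    intro h'
    by_cases hne : h' = h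
    · simp [hne]
    · have := noiseLaw_tie_eq_zero (ω := ω) hω hk
        (hsep h h.2 h' h'.2 fun e => hne (Subtype.ext e.symm)) (batchCost hist h' - batchCost hist h)
      filter_upwards [measure_eq_zero_iff_ae_notMem.1 this] with z hz _ using hz
  filter_upwards [hties] with z hz
  refine propext ⟨fun he h' => ?_, fun hm => ?_⟩
  · have := herm (ftplQuery hist z) h' h'.2
    rw [show erm (ftplQuery hist z) = h from he] at this
    simpa only [batchCost_ftplQuery] using this
  · by_contra hne
    have h1 := herm (ftplQuery hist z) h h.2
    have h2 := hm (erm (ftplQuery hist z))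
    simp only [batchCost_ftplQuery] at h1
    exact hz _ hne (by linarith)

theorem aemeasurable_ftpl (hω : 0 < ω) (hk : 0 < k) (hsep : IsSeparating H Q) (herm : IsERM erm)
    (hist : Batch X) : AEMeasurable (fun z => erm (ftplQuery hist z)) (noiseLaw Q k ω) := by
  refine NullMeasurable.aemeasurable fun s _ => ?_
  rw [← Set.biUnion_preimage_singleton]
  exact .biUnion s.to_countable fun h _ =>
    ((measurableSet_argminSet hist h).nullMeasurableSet).congr
      (ftpl_eq_ae_argminSet hω hk hsep herm hist h).symm

/-- The law of a draw from the deployed policy, as a measure on the hypothesis class. -/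
noncomputable def drawLaw (erm : Batch X → H) (Q : Finset X) (k : ℕ) (ω : ℝ) (hist : Batch X) : Measure H :=
  (noiseLaw Q k ω).map fun z => erm (ftplQuery hist z)

section Policy

variable (hω : 0 < ω) (hk : 0 < k) (hsep : IsSeparating H Q) (herm : IsERM erm)
include hω hk hsep herm

theorem isProbabilityMeasure_drawLaw (hist : Batch X) :
    IsProbabilityMeasure (drawLaw erm Q k ω hist) := by
  have := isProbabilityMeasure_noiseLaw (Q := Q) (k := k) hω
  exact Measure.isProbabilityMeasure_map (aemeasurable_ftpl hω hk hsep herm hist)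

theorem drawLaw_real_singleton (hist : Batch X) (h : H) :
    (drawLaw erm Q k ω hist).real {h} = ftplPolicy erm Q k ω hist h := by
  rw [drawLaw, map_measureReal_apply_of_aemeasurable (aemeasurable_ftpl hω hk hsep herm hist)
    (measurableSet_singleton h)]
  rfl

theorem integral_drawLaw (hist : Batch X) (F : H → ℝ) :
    ∫ h, F h ∂(drawLaw erm Q k ω hist) = ∑ h, ftplPolicy erm Q k ω hist h * F h := by
  have := isProbabilityMeasure_drawLaw hω hk hsep herm hist
  rw [integral_fintype (Integrable.of_finite)]
  simp_rw [drawLaw_real_singleton hω hk hsep herm, smul_eq_mul]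

theorem integral_ftpl (hist : Batch X) (F : H → ℝ) :
    ∫ z, F (erm (ftplQuery hist z)) ∂(noiseLaw Q k ω) = ∑ h, ftplPolicy erm Q k ω hist h * F h := by
  rw [← integral_drawLaw hω hk hsep herm, drawLaw, integral_map
    (aemeasurable_ftpl hω hk hsep herm hist) (by fun_prop)]

theorem integrable_ftpl (hist : Batch X) (F : H → ℝ) :
    Integrable (fun z => F (erm (ftplQuery hist z))) (noiseLaw Q k ω) := by
  have := isProbabilityMeasure_drawLaw hω hk hsep herm hist
  have h : Integrable F (drawLaw erm Q k ω hist) := .of_finite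
  exact h.comp_aemeasurable (aemeasurable_ftpl hω hk hsep herm hist)

theorem ftplPolicy_mem_stdSimplex (hist : Batch X) :
    ftplPolicy erm Q k ω hist ∈ stdSimplex ℝ H := by
  have := isProbabilityMeasure_drawLaw hω hk hsep herm hist
  refine ⟨fun h => measureReal_nonneg, ?_⟩
  have := integral_drawLaw hω hk hsep herm hist fun _ => 1
  simpa using this.symm

theorem ftplPolicy_eq (hist : Batch X) (h : H) :
    ftplPolicy erm Q k ω hist h = (noiseLaw Q k ω).real (argminSet H Q k hist h) :=
  measureReal_congr (ftpl_eq_ae_argminSet hω hk hsep herm hist h)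

/-- Stability: appending a batch with costs in `[0, B]` changes the probability of every hypothesis
at most by the factor `exp (ω s B)`. -/
theorem ftplPolicy_stable (hist E : Batch X) {B : ℝ} (hB : ∀ h : H, batchCost E h ∈ Set.Icc 0 B)
    (h : H) : ftplPolicy erm Q k ω hist h
      ≤ Real.exp (ω * (Q.card * B)) * ftplPolicy erm Q k ω (hist + E) h := by
  classical
  have := isProbabilityMeasure_noiseLaw (Q := Q) (k := k) hω
  have hB0 : 0 ≤ B := (hB h).1.trans (hB h).2
  rw [ftplPolicy_eq hω hk hsep herm, ftplPolicy_eq hω hk hsep herm]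
  -- One copy of each separating point suffices. The shift lowers the cost of `h` by `B` at all s
  -- points, but that of any other hypothesis by at most (s - 1)`B`. The advantage `B` covers
  -- whatever `E` can charge to `h`, so a minimizer stays a minimizer. The shift has ℓ¹ norm s`B`.
  let v : Noise Q k := fun j => if j.1.2 = ⟨0, hk⟩ ∧ h.1 j.1.1 = j.2 then -B else 0
  have hv : ∀ f : X → Bool, noiseCost f v
      = ∑ q : Q, if h.1 q = f q then -B else 0 := fun f => by
    rw [noiseCost, Fintype.sum_prod_type]
    refine Finset.sum_congr rfl fun q _ => ?_
    simp only [v]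
    rw [Finset.sum_eq_single (⟨0, hk⟩ : Fin k) (fun b _ hb => by simp [hb]) (by simp)]
    simp
  have hself : noiseCost h.1 v = -(Q.card * B) := by simp [hv]
  have hother : ∀ h' : H, h' ≠ h → -(Q.card * B) + B ≤ noiseCost h'.1 v := fun h' hne => by
    obtain ⟨q, hq, hqne⟩ := hsep h h.2 h' h'.2 fun e => hne (Subtype.ext e.symm)
    have hsum : ∑ q' : Q, (if q' = ⟨q, hq⟩ then B else 0) + ∑ _q' : Q, -B ≤ noiseCost h'.1 v := by
      rw [hv, ← Finset.sum_add_distrib]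
      refine Finset.sum_le_sum fun q' _ => ?_
      by_cases e : q' = ⟨q, hq⟩
      · subst e; simp [hqne]
      · simp only [e, if_false]; split_ifs <;> linarith
    simp at hsum
    linarith
  have hsub : argminSet H Q k hist h ⊆ (· + v) ⁻¹' argminSet H Q k (hist + E) h := by
    intro z hz h'
    by_cases hne : h' = h
    · rw [hne]
    · have h1 := hz h'
      have h2 := hother h' hne
      have h3 := (hB h).2
      have h4 := (hB h').1
      simp only [batchCost_add, noiseCost_add]
      linarith
  have hv1 : ∑ j, |v j| = Q.card * B := by
    have habs : ∀ j, |v j| = -v j := fun j => by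
      simp only [v]; split_ifs
      · rw [abs_neg, neg_neg, abs_of_nonneg hB0]
      · simp
    simp_rw [habs, Finset.sum_neg_distrib]
    rw [← neg_neg (Q.card * B : ℝ), ← hself, noiseCost, Fintype.sum_prod_type]
    congr 1
    refine Finset.sum_congr rfl fun q _ => ?_
    rw [Finset.sum_eq_single (h.1 q.1.1)]
    · intro b _ hb
      simp [v, hb.symm]
    · simp
  have h1 := noiseLaw_map_add_le (k := k) hω v (argminSet H Q k (hist + E) h)
  rw [Measure.map_apply (by fun_prop) (measurableSet_argminSet _ _), hv1, Measure.smul_apply,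
    ENNReal.smul_def, smul_eq_mul] at h1
  have h2 := (measure_mono hsub).trans h1
  rw [Measure.real, Measure.real]
  have h3 := ENNReal.toReal_mono (ENNReal.mul_ne_top ENNReal.coe_ne_top (measure_ne_top _ _)) h2
  rwa [ENNReal.toReal_mul, ENNReal.coe_toReal, Real.coe_toNNReal _ (Real.exp_pos _).le] at h3

end Policy

/-- The least perturbed cost. -/
noncomputable def leastCost (erm : Batch X → H) (hist : Batch X) (z : Noise Q k) : ℝ :=
  batchCost (ftplQuery hist z) (erm (ftplQuery hist z)).1

/-- The potential of Follow-The-Perturbed-Leader: the expected least perturbed cost. -/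
noncomputable def ftplPotential (erm : Batch X → H) (Q : Finset X) (k : ℕ) (ω : ℝ) (hist : Batch X) : ℝ :=
  ∫ z, leastCost (Q := Q) (k := k) erm hist z ∂(noiseLaw Q k ω)

theorem leastCost_le (herm : IsERM erm) (hist : Batch X) (z : Noise Q k) (h : H) :
    leastCost erm hist z ≤ batchCost hist h + noiseCost h.1 z := by
  rw [← batchCost_ftplQuery]
  exact herm _ h h.2

theorem leastCost_eq_iInf (herm : IsERM erm) (hist : Batch X) (z : Noise Q k) :
    leastCost erm hist z = ⨅ h : H, (batchCost hist h + noiseCost h.1 z) := by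
  have : Nonempty H := ⟨erm 0⟩
  refine le_antisymm (le_ciInf fun h => leastCost_le herm hist z h) ?_
  refine (ciInf_le (Set.finite_range _).bddBelow (erm (ftplQuery hist z))).trans_eq ?_
  rw [leastCost, batchCost_ftplQuery]

theorem integrable_leastCost (hω : 0 < ω) (herm : IsERM erm) (hist : Batch X) :
    Integrable (leastCost (Q := Q) (k := k) erm hist) (noiseLaw Q k ω) := by
  have := isProbabilityMeasure_noiseLaw (Q := Q) (k := k) hω
  have hi : ∀ h : H, Integrable (fun z => batchCost hist h + noiseCost h.1 z) (noiseLaw Q k ω) :=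
    fun h => (integrable_const _).add (integrable_noiseCost hω _)
  refine (integrable_finsetSum Finset.univ fun h _ => (hi h).abs).mono' ?_ ?_
  · rw [funext fun z => leastCost_eq_iInf herm hist z]
    exact (Measurable.iInf fun h => (measurable_noiseCost _).const_add _).aestronglyMeasurable
  · refine Filter.Eventually.of_forall fun z => ?_
    rw [leastCost, batchCost_ftplQuery]
    exact Finset.single_le_sum
      (f := fun h : H => |batchCost hist h + noiseCost h.1 z|) (fun h _ => abs_nonneg _)
      (Finset.mem_univ (erm (ftplQuery hist z)))

/-- Be-the-leader, in expectation. -/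
theorem sum_ftplPolicy_mul_le_potential (hω : 0 < ω) (hk : 0 < k) (hsep : IsSeparating H Q)
    (herm : IsERM erm) (hist E : Batch X) :
    ∑ h, ftplPolicy erm Q k ω (hist + E) h * batchCost E h
      ≤ ftplPotential erm Q k ω (hist + E) - ftplPotential erm Q k ω hist := by
  rw [← integral_ftpl hω hk hsep herm (hist + E) fun h => batchCost E h, ftplPotential,
    ftplPotential, ← integral_sub (integrable_leastCost hω herm _) (integrable_leastCost hω herm _)]
  refine integral_mono (integrable_ftpl hω hk hsep herm _ fun h => batchCost E h)
    ((integrable_leastCost hω herm _).sub (integrable_leastCost hω herm _)) fun z => ?_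
  -- The minimizer for the longer history is a candidate for the shorter one.
  have := leastCost_le herm hist z (erm (ftplQuery (hist + E) z))
  simp only
  rw [leastCost, batchCost_ftplQuery, batchCost_add]
  linarith

/-- Be-the-leader concerns the policy that has seen `E`. Stability passes to the one deployed
before, at the price of a factor exp(-ωsB) ≥ 1 - ωsB; nonnegativity of the costs is what makes this
legitimate. -/
theorem one_sub_mul_sum_le_potential (hω : 0 < ω) (hk : 0 < k) (hsep : IsSeparating H Q)
    (herm : IsERM erm) (hist E : Batch X) {B : ℝ} (hB : ∀ h : H, batchCost E h ∈ Set.Icc 0 B) :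
    (1 - ω * (Q.card * B)) * ∑ h, ftplPolicy erm Q k ω hist h * batchCost E h
      ≤ ftplPotential erm Q k ω (hist + E) - ftplPotential erm Q k ω hist := by
  refine le_trans ?_ (sum_ftplPolicy_mul_le_potential hω hk hsep herm hist E)
  rw [Finset.mul_sum]
  refine Finset.sum_le_sum fun h _ => ?_
  rw [← mul_assoc]
  refine mul_le_mul_of_nonneg_right ?_ (hB h).1
  have h1 := ftplPolicy_stable hω hk hsep herm hist E hB h
  have h0 : 0 ≤ ftplPolicy erm Q k ω hist h := measureReal_nonneg
  have h2 := Real.add_one_le_exp (-(ω * (Q.card * B)))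
  calc _ ≤ Real.exp (-(ω * (Q.card * B))) * ftplPolicy erm Q k ω hist h := by
        gcongr; linarith
    _ ≤ Real.exp (-(ω * (Q.card * B))) *
        (Real.exp (ω * (Q.card * B)) * ftplPolicy erm Q k ω (hist + E) h) := by gcongr
    _ = _ := by rw [← mul_assoc, ← Real.exp_add]; simp

/-- The least cost is at most that of `h`, whose mean noise is at most 1/θ since x ≤ (e^(θx) - 1)/θ
and the exponential moment is at most 2. -/
theorem ftplPotential_le (hω : 0 < ω) (herm : IsERM erm) (hn : 0 < Q.card * k) (hist : Batch X)
    (h : H) {θ : ℝ} (hθ : 0 < θ) (hθ2 : θ ^ 2 = ω ^ 2 / (4 * (Q.card * k : ℕ))) :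
    ftplPotential erm Q k ω hist ≤ batchCost hist h + 1 / θ := by
  have := isProbabilityMeasure_noiseLaw (Q := Q) (k := k) hω
  obtain ⟨h1, h2⟩ := noiseCost_mgf_le hω hn hθ2 h.1
  have hle : ftplPotential erm Q k ω hist
      ≤ ∫ z, (batchCost hist h - 1 / θ + 1 / θ * Real.exp (θ * noiseCost h.1 z))
        ∂(noiseLaw Q k ω) := by
    refine integral_mono (integrable_leastCost hω herm _)
      ((integrable_const _).add (h1.const_mul _)) fun z => ?_
    refine (leastCost_le herm hist z h).trans ?_
    have := Real.add_one_le_exp (θ * noiseCost h.1 z)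
    have h3 : noiseCost h.1 z = 1 / θ * (θ * noiseCost h.1 z) := by field_simp
    have h4 : 1 / θ * (θ * noiseCost h.1 z + 1) ≤ 1 / θ * Real.exp (θ * noiseCost h.1 z) := by
      gcongr
    linarith
  rw [integral_add (integrable_const _) (h1.const_mul _), integral_const_mul] at hle
  have : 1 / θ * ∫ z, Real.exp (θ * noiseCost h.1 z) ∂(noiseLaw Q k ω) ≤ 1 / θ * 2 := by gcongr
  simp at hle this ⊢
  linarith

/-- This is the soft-min bound on the expected minimum of |H| noise costs: the exponential of the
extreme one is dominated by the sum of all, which costs log |H|. -/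
theorem le_ftplPotential_zero (hω : 0 < ω) (hn : 0 < Q.card * k)
    {θ : ℝ} (hθ : 0 < θ) (hθ2 : θ ^ 2 = ω ^ 2 / (4 * (Q.card * k : ℕ))) (herm : IsERM erm) :
    -((Real.log H.card + 1) / θ) ≤ ftplPotential erm Q k ω 0 := by
  have := isProbabilityMeasure_noiseLaw (Q := Q) (k := k) hω
  have hH : 0 < (H.card : ℝ) := by exact_mod_cast Finset.card_pos.2 ⟨_, (erm 0).2⟩
  have hm := fun h : H => noiseCost_mgf_le (θ := -θ) hω hn (by rw [neg_sq, hθ2]) h.1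
  have hle : ∫ z, (-(1 / θ * (Real.log H.card - 1)) + ∑ h : H, -(1 / θ * (1 / H.card)) *
      Real.exp (-θ * noiseCost h.1 z)) ∂(noiseLaw Q k ω) ≤ ftplPotential erm Q k ω 0 := by
    refine integral_mono ((integrable_const _).add
      (integrable_finsetSum _ fun h _ => (hm h).1.const_mul _)) (integrable_leastCost hω herm _)
      fun z => ?_
    set e := erm (ftplQuery 0 z) with he
    have h1 : leastCost erm 0 z = noiseCost e.1 z := by
      rw [leastCost, batchCost_ftplQuery, batchCost_zero, zero_add]
    -- Centering at log |H| linearizes the logarithm, so that the sum is only averaged over `H` and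
    -- its mean is at most 2.
    have h2 := Real.add_one_le_exp (-θ * noiseCost e.1 z - Real.log H.card)
    rw [Real.exp_sub, Real.exp_log hH] at h2
    have h3 : Real.exp (-θ * noiseCost e.1 z) ≤ ∑ h : H, Real.exp (-θ * noiseCost h.1 z) :=
      Finset.single_le_sum (f := fun h : H => Real.exp (-θ * noiseCost h.1 z))
        (fun h _ => (Real.exp_pos _).le) (Finset.mem_univ e)
    have h4 : Real.exp (-θ * noiseCost e.1 z) / H.card
      ≤ (∑ h : H, Real.exp (-θ * noiseCost h.1 z)) / H.card := by gcongr
    simp only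
    rw [h1, ← Finset.mul_sum]
    have h5 : 1 / θ * (-θ * noiseCost e.1 z - Real.log H.card + 1) ≤
      1 / θ * ((∑ h : H, Real.exp (-θ * noiseCost h.1 z)) / H.card) := by
        gcongr; linarith
    have h6 : noiseCost e.1 z = 1 / θ * (θ * noiseCost e.1 z) := by field_simp
    rw [h6]
    have h7 : -(1 / θ * (1 / (H.card:ℝ))) * ∑ h : H, Real.exp (-θ * noiseCost h.1 z)
      = -(1 / θ * ((∑ h : H, Real.exp (-θ * noiseCost h.1 z)) / H.card)) := by ring
    rw [h7]
    linarith
  rw [integral_add (integrable_const _)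
      (integrable_finsetSum _ fun h _ => (hm h).1.const_mul _),
    integral_finsetSum _ fun h _ => (hm h).1.const_mul _] at hle
  simp_rw [integral_const_mul] at hle
  have hs : ∑ h : H, -(1 / θ * (1 / (H.card:ℝ))) * (2:ℝ) ≤ ∑ h : H, -(1 / θ * (1 / (H.card : ℝ))) *
      ∫ z, Real.exp (-θ * noiseCost h.1 z) ∂(noiseLaw Q k ω) := by
    refine Finset.sum_le_sum fun h _ => ?_
    refine mul_le_mul_of_nonpos_left (hm h).2 ?_
    have : 0 < 1 / θ * (1 / (H.card : ℝ)) := by positivity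
    linarith
  have hc : ∑ h : H, -(1 / θ * (1 / (H.card:ℝ))) * (2:ℝ) = -(1 / θ * 2) := by
    simp
    field_simp
  have hc2 : ∫ _z, -(1 / θ * (Real.log H.card - 1)) ∂(noiseLaw Q k ω)
      = -(1 / θ * (Real.log H.card - 1)) := by simp
  rw [hc2] at hle
  have : -((Real.log H.card + 1) / θ) = -(1 / θ * (Real.log H.card - 1)) + -(1 / θ * 2) := by ring
  linarith

end FairOnline

/-! ### Adaptive processes driven by independent inputs -/

namespace FairOnline

/-- The states visited by an adaptive process driven by the inputs `z 0, …, z (T - 1)`. -/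
def adaptiveRun {S Ω : Type*} {T : ℕ} (step : S → Ω → S) (s : S) (z : Fin T → Ω) : ℕ → S
  | 0 => s
  | t + 1 => if ht : t < T then step (adaptiveRun step s z t) (z ⟨t, ht⟩)
      else adaptiveRun step s z t

/-- Splitting off the first input rather than the last lets the induction restart from an arbitrary
state. -/
theorem adaptiveRun_succ {S Ω : Type*} {T : ℕ} (step : S → Ω → S) (s : S) (z : Fin (T + 1) → Ω)
    (t : ℕ) : adaptiveRun step s z (t + 1) = adaptiveRun step (step s (z 0)) (Fin.tail z) t := by
  induction t with
  | zero => simp [adaptiveRun]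
  | succ t ih =>
    rw [adaptiveRun, ih]
    simp only [Nat.add_lt_add_iff_right]
    conv_rhs => rw [adaptiveRun]
    rfl

/-- A nonnegative functional of an adaptive process that in every step grows in mean at most
by `η` grows in mean at most by `T η` in `T` steps. -/
theorem lintegral_adaptiveRun_le {S Ω D : Type*} [MeasurableSpace Ω] [MeasurableSpace D] [Fintype D]
    [DiscreteMeasurableSpace D] (P : Measure Ω) [IsProbabilityMeasure P] (next : S → D → S)
    (draw : S → Ω → D) (hd : ∀ s, AEMeasurable (draw s) P) (Y : S → ENNReal) (η : ENNReal)
    (hY : ∀ s, ∫⁻ ω, Y (next s (draw s ω)) ∂P ≤ Y s + η) (T : ℕ) (s : S) :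
    AEMeasurable (fun z : Fin T → Ω => Y (adaptiveRun (fun s ω => next s (draw s ω)) s z T))
      (Measure.pi fun _ => P) ∧
    ∫⁻ z : Fin T → Ω, Y (adaptiveRun (fun s ω => next s (draw s ω)) s z T) ∂(Measure.pi fun _ => P)
      ≤ Y s + T * η := by
  classical
  induction T generalizing s with
  | zero =>
    simp only [adaptiveRun]
    exact ⟨aemeasurable_const, by simp⟩
  | succ T ih =>
    have mp := measurePreserving_piFinSuccAbove (fun _ : Fin (T + 1) => P) 0
    let G : Ω × (Fin T → Ω) → ENNReal := fun p =>
      Y (adaptiveRun (fun s ω => next s (draw s ω)) (next s (draw s p.1)) p.2 T)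
    have hG : AEMeasurable G (P.prod (Measure.pi fun _ => P)) := by
      -- The states carry no σ-algebra. Since a draw takes finitely many values, the integrand is a
      -- finite sum of products, each of an indicator in the first input and a function of the other
      -- inputs.
      have : G = fun p => ∑ d : D, (if draw s p.1 = d then 1 else 0) *
          Y (adaptiveRun (fun s ω => next s (draw s ω)) (next s d) p.2 T) := by
        funext p
        simp [G]
      rw [this]
      refine Finset.aemeasurable_fun_sum _ fun d _ => AEMeasurable.mul ?_ ?_
      · exact ((Measurable.of_discrete (f := fun d' : D => if d' = d then (1 : ENNReal) else 0)).comp_aemeasurable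
          (hd s)).comp_fst
      · exact (ih (next s d)).1.comp_snd
    have hF : ∀ z : Fin (T + 1) → Ω, Y (adaptiveRun (fun s ω => next s (draw s ω)) s z (T + 1))
        = G (MeasurableEquiv.piFinSuccAbove (fun _ => Ω) 0 z) := fun z => by
      rw [adaptiveRun_succ]
      rfl
    simp_rw [hF]
    constructor
    · exact hG.comp_quasiMeasurePreserving mp.quasiMeasurePreserving
    · rw [mp.lintegral_comp_emb (MeasurableEquiv.measurableEmbedding _), lintegral_prod _ hG]
      calc _ ≤ ∫⁻ ω, (Y (next s (draw s ω)) + T * η) ∂P := lintegral_mono fun ω => (ih _).2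
        _ = ∫⁻ ω, Y (next s (draw s ω)) ∂P + T * η := by
          rw [lintegral_add_right _ measurable_const]; simp
        _ ≤ Y s + η + T * η := by gcongr; exact hY s
        _ = _ := by push_cast; ring

end FairOnline

/-! ### Decoupling, Hoeffding's inequality and an exponential moment bound -/

namespace FairOnline

section Product

variable {ι A : Type*} [Fintype ι] [MeasurableSpace A] (ν : Measure A) [IsProbabilityMeasure ν]

theorem measurePreserving_splice (p : ι → Prop) [DecidablePred p] :
    MeasurePreserving (fun q : (ι → A) × (ι → A) => fun j => if p j then q.1 j else q.2 j)
      ((Measure.pi fun _ => ν).prod (Measure.pi fun _ => ν)) (Measure.pi fun _ => ν) := by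
  have hm : Measurable (fun q : (ι → A) × (ι → A) => fun j => if p j then q.1 j else q.2 j) := by
    refine measurable_pi_lambda _ fun j => ?_
    split_ifs <;> fun_prop
  refine ⟨hm, (Measure.pi_eq fun s hs => ?_).symm⟩
  rw [Measure.map_apply hm (.univ_pi hs)]
  have : (fun q : (ι → A) × (ι → A) => fun j => if p j then q.1 j else q.2 j) ⁻¹' (Set.univ.pi s)
      = (Set.univ.pi fun j => if p j then s j else Set.univ) ×ˢ
        (Set.univ.pi fun j => if p j then Set.univ else s j) := by
    ext q
    simp only [Set.mem_preimage, Set.mem_univ_pi, Set.mem_prod, ← forall_and]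
    refine forall_congr' fun j => ?_
    split_ifs <;> simp
  rw [this, Measure.prod_prod, Measure.pi_pi, Measure.pi_pi, ← Finset.prod_mul_distrib]
  refine Finset.prod_congr rfl fun j _ => ?_
  split_ifs <;> simp

/-- If `F d d'` depends on `d` only through the coordinates in `p` and on `d'` only through the
others, then its two arguments may be averaged independently. -/
theorem lintegral_le_of_splice [Finite A] [DiscreteMeasurableSpace A] (p : ι → Prop)
    [DecidablePred p] (F : (ι → A) → (ι → A) → ENNReal)
    (hF : ∀ d d', F (fun j => if p j then d j else d' j) (fun j => if p j then d j else d' j)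
      = F d d') {c : ENNReal} (hc : ∀ d, ∫⁻ d', F d d' ∂(Measure.pi fun _ => ν) ≤ c) :
    ∫⁻ d, F d d ∂(Measure.pi fun _ => ν) ≤ c := by
  rw [← (measurePreserving_splice ν p).lintegral_comp (f := fun d => F d d) (.of_discrete)]
  simp_rw [hF]
  rw [lintegral_prod _ (Measurable.of_discrete).aemeasurable]
  exact (lintegral_mono hc).trans (by simp)

theorem hoeffding_pi [Finite A] [DiscreteMeasurableSpace A] {f : A → ℝ}
    (hf : ∀ a, f a ∈ Set.Icc (0 : ℝ) 1) {R : ℕ} (hR : 0 < R) {e : Fin R → ι}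
    (he : Function.Injective e) {τ : ℝ} (hτ : 0 ≤ τ) :
    (Measure.pi fun _ : ι => ν).real {d | τ ≤ |∫ a, f a ∂ν - (∑ r, f (d (e r))) / R|}
      ≤ 2 * Real.exp (-(2 * R * τ ^ 2)) := by
  have hR' : (0 : ℝ) < R := by exact_mod_cast hR
  -- The one-sided tail is stated for any range of length 1, so that it applies to `f` and to `-f`.
  have one : ∀ (a b : ℝ) (g : A → ℝ), b - a = 1 → (∀ x, g x ∈ Set.Icc a b) →
      (Measure.pi fun _ : ι => ν).real {d | R * τ ≤ ∑ r, (g (d (e r)) - ∫ x, g x ∂ν)}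
        ≤ Real.exp (-(2 * R * τ ^ 2)) := by
    intro a b g hab hg
    have hind := (ProbabilityTheory.iIndepFun_pi (μ := fun _ : ι => ν)
      (X := fun _ x => g x - ∫ x, g x ∂ν) (fun _ => (Measurable.of_discrete).aemeasurable)).precomp he
    have hsub : ∀ r ∈ (Finset.univ : Finset (Fin R)),
        ProbabilityTheory.HasSubgaussianMGF (fun d : ι → A => g (d (e r)) - ∫ x, g x ∂ν)
        ((‖b - a‖₊ / 2) ^ 2) (Measure.pi fun _ : ι => ν) := by
      intro r _
      have h := ProbabilityTheory.hasSubgaussianMGF_of_mem_Icc (μ := Measure.pi fun _ : ι => ν)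
        (X := fun d : ι → A => g (d (e r))) (a := a) (b := b)
        ((Measurable.of_discrete (f := g)).comp (measurable_pi_apply (e r))).aemeasurable
        (.of_forall fun d => hg _)
      have hint : ∫ d : ι → A, g (d (e r)) ∂(Measure.pi fun _ : ι => ν) = ∫ x, g x ∂ν := by
        have := integral_map (μ := Measure.pi fun _ : ι => ν) (φ := Function.eval (e r)) (f := g)
          (measurable_pi_apply _).aemeasurable (by fun_prop)
        rw [(measurePreserving_eval (fun _ : ι => ν) (e r)).map_eq] at this
        exact this.symm
      rwa [hint] at h
    have := ProbabilityTheory.HasSubgaussianMGF.measure_sum_ge_le_of_iIndepFun hind hsub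
      (ε := R * τ) (by positivity)
    refine this.trans (le_of_eq ?_)
    rw [hab]
    simp
    field_simp
  have h1 := one 0 1 f (by norm_num) hf
  have h2 := one (-1) 0 (fun a => -f a) (by norm_num) fun a => by
    have := hf a
    constructor <;> simp at this ⊢ <;> linarith
  have hsub : {d : ι → A | τ ≤ |∫ a, f a ∂ν - (∑ r, f (d (e r))) / R|} ⊆
      {d | R * τ ≤ ∑ r, (f (d (e r)) - ∫ x, f x ∂ν)} ∪
      {d | R * τ ≤ ∑ r, (-f (d (e r)) - ∫ x, -f x ∂ν)} := by
    intro d hd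
    have hd' : τ ≤ |∫ a, f a ∂ν - (∑ r, f (d (e r))) / R| := hd
    simp only [Set.mem_union, Set.mem_ofPred_eq, Finset.sum_sub_distrib, integral_neg,
      Finset.sum_neg_distrib]
    simp only [Finset.sum_const, Finset.card_univ, Fintype.card_fin, nsmul_eq_mul]
    rcases le_abs'.1 hd' with h | h
    · left
      have : ∫ a, f a ∂ν + τ ≤ (∑ r, f (d (e r))) / R := by linarith
      rw [le_div_iff₀ hR'] at this
      linarith
    · right
      have : (∑ r, f (d (e r))) / R ≤ ∫ a, f a ∂ν - τ := by linarith
      rw [div_le_iff₀ hR'] at this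
      linarith
  calc _ ≤ _ := measureReal_mono hsub
    _ ≤ _ := measureReal_union_le _ _
    _ ≤ _ := by linarith

end Product

/-- The exponential moment of the difference between true and estimated regret in a round. -/
theorem integral_exp_le_of_bounded {Ω : Type*} [MeasurableSpace Ω] (P : Measure Ω)
    [IsProbabilityMeasure P] {A B : Ω → ℝ} (hAm : Measurable A) (hBm : Measurable B)
    {M S a₀ b₀ bias β θ : ℝ} (hM : 1 ≤ M) (hA : ∀ ω, A ω ∈ Set.Icc 0 (M * S))
    (hB : ∀ ω, B ω ∈ Set.Icc 0 (M * S)) (ha₀ : a₀ ∈ Set.Icc 0 S) (hb₀ : b₀ ∈ Set.Icc 0 S)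
    (hEA : ∫ ω, A ω ∂P ≤ a₀) (hEA' : a₀ - bias ≤ ∫ ω, A ω ∂P) (hEB : ∫ ω, B ω ∂P ≤ b₀)
    (hbias : 0 ≤ bias) (hβ : β ∈ Set.Icc (0 : ℝ) 1) (hθ : 0 ≤ θ) (hθ1 : θ * ((1 + M) * S) ≤ 1) :
    ∫⁻ ω, ENNReal.ofReal (Real.exp (θ * (a₀ - (1 - β) * A ω + B ω - b₀))) ∂P
      ≤ ENNReal.ofReal (Real.exp (θ * (β * S + bias + 9 * θ * M * S ^ 2))) := by
  obtain ⟨hβ0, hβ1⟩ := hβ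
  obtain ⟨ha0, ha1⟩ := ha₀
  obtain ⟨hb0, hb1⟩ := hb₀
  have hS : 0 ≤ S := ha0.trans ha1
  have hiA : Integrable A P := Integrable.of_mem_Icc 0 (M * S) hAm.aemeasurable (.of_forall hA)
  have hiB : Integrable B P := Integrable.of_mem_Icc 0 (M * S) hBm.aemeasurable (.of_forall hB)
  -- `U` comes from e^x ≤ 1 + x + x², which needs only x ≤ 1. The square is at most three times the
  -- sum of the squares, and A² ≤ MS·A, B² ≤ MS·B make the bound linear in `A` and `B`. As their
  -- means are at most S, the second-order part is 9θ²MS² rather than of order M²S².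
  let U : Ω → ℝ := fun ω => (1 + θ * (a₀ - b₀) + 3 * θ ^ 2 * S ^ 2) +
    (3 * θ ^ 2 * (M * S) - θ * (1 - β)) * A ω + (3 * θ ^ 2 * (M * S) + θ) * B ω
  have hiU : Integrable U P := ((integrable_const _).add (hiA.const_mul _)).add (hiB.const_mul _)
  have hexp : ∀ x : ℝ, x ≤ 1 → Real.exp x ≤ 1 + x + x ^ 2 := by
    intro x hx
    by_cases h : -1 ≤ x
    · have := Real.abs_exp_sub_one_sub_id_le (abs_le.2 ⟨h, hx⟩)
      linarith [(abs_le.1 this).2]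
    · have h1 : Real.exp x ≤ 1 := Real.exp_le_one_iff.2 (by linarith)
      nlinarith
  have hle : ∀ ω, Real.exp (θ * (a₀ - (1 - β) * A ω + B ω - b₀)) ≤ U ω := by
    intro ω
    obtain ⟨hA0, hA1⟩ := hA ω
    obtain ⟨hB0, hB1⟩ := hB ω
    have hAA : 0 ≤ (1 - β) * A ω := mul_nonneg (by linarith) hA0
    have hAle : (1 - β) * A ω ≤ A ω := by nlinarith
    refine (hexp _ ?_).trans ?_
    · refine le_trans (mul_le_mul_of_nonneg_left ?_ hθ) hθ1
      linarith
    · have hsq : (a₀ - (1 - β) * A ω + B ω - b₀) ^ 2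
          ≤ 3 * (S ^ 2 + M * S * A ω + M * S * B ω) := by
        have e1 : (a₀ - b₀) ^ 2 ≤ S ^ 2 := by
          exact sq_le_sq' (by linarith) (by linarith)
        have e2 : ((1 - β) * A ω) ^ 2 ≤ M * S * A ω := by
          calc ((1 - β) * A ω) ^ 2 ≤ (A ω) ^ 2 := by gcongr
            _ ≤ _ := by nlinarith
        have e3 : (B ω) ^ 2 ≤ M * S * B ω := by nlinarith
        nlinarith [sq_nonneg ((a₀ - b₀) + (1 - β) * A ω), sq_nonneg ((a₀ - b₀) - B ω),
          sq_nonneg ((1 - β) * A ω + B ω)]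
      have := mul_le_mul_of_nonneg_left hsq (sq_nonneg θ)
      simp only [U]
      nlinarith
  calc _ ≤ ∫⁻ ω, ENNReal.ofReal (U ω) ∂P :=
        lintegral_mono fun ω => ENNReal.ofReal_le_ofReal (hle ω)
    _ = ENNReal.ofReal (∫ ω, U ω ∂P) := (ofReal_integral_eq_lintegral_ofReal hiU
        (.of_forall fun ω => (Real.exp_pos _).le.trans (hle ω))).symm
    _ ≤ _ := by
      refine ENNReal.ofReal_le_ofReal ?_
      have hIU : ∫ ω, U ω ∂P = (1 + θ * (a₀ - b₀) + 3 * θ ^ 2 * S ^ 2) +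
          (3 * θ ^ 2 * (M * S) - θ * (1 - β)) * ∫ ω, A ω ∂P
            + (3 * θ ^ 2 * (M * S) + θ) * ∫ ω, B ω ∂P := by
        simp only [U]
        have e1 := integral_add ((integrable_const (μ := P) (1 + θ * (a₀ - b₀) + 3 * θ ^ 2 * S ^ 2)).add
          (hiA.const_mul (3 * θ ^ 2 * (M * S) - θ * (1 - β))))
          (hiB.const_mul (3 * θ ^ 2 * (M * S) + θ))
        have e2 := integral_add (integrable_const (μ := P) (1 + θ * (a₀ - b₀) + 3 * θ ^ 2 * S ^ 2))
          (hiA.const_mul (3 * θ ^ 2 * (M * S) - θ * (1 - β)))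
        simp only [Pi.add_apply] at e1
        rw [e1, e2, integral_const_mul, integral_const_mul]
        simp
      rw [hIU]
      refine le_trans ?_ (Real.add_one_le_exp _)
      have t1 : 3 * θ ^ 2 * (M * S) * ∫ ω, A ω ∂P ≤ 3 * θ ^ 2 * (M * S) * S := by
        gcongr; linarith
      have t2 : 3 * θ ^ 2 * (M * S) * ∫ ω, B ω ∂P ≤ 3 * θ ^ 2 * (M * S) * S := by
        gcongr; linarith
      have t3 : θ * ∫ ω, B ω ∂P ≤ θ * b₀ := by gcongr
      have t4 : θ * (1 - β) * (a₀ - bias) ≤ θ * (1 - β) * ∫ ω, A ω ∂P :=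
        mul_le_mul_of_nonneg_left hEA' (mul_nonneg hθ (by linarith))
      have t5 : 3 * θ ^ 2 * S ^ 2 ≤ 3 * θ ^ 2 * (M * S) * S := by
        have : 0 ≤ 3 * θ ^ 2 * S ^ 2 := by positivity
        nlinarith
      have t6 : θ * (1 - β) * bias ≤ θ * bias := by
        have : 0 ≤ θ * bias := by positivity
        nlinarith
      have t7 : θ * β * a₀ ≤ θ * β * S := by gcongr
      nlinarith

end FairOnline

/-! ### Geometric resampling and the estimated costs -/

namespace FairOnline

variable {X : Type u} {H : Finset (X → Bool)} {R M k : ℕ}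

/-- The elicitation draws. -/
def elicitedOf (d : DrawIdx R M k → H) : Fin R → H := fun r => d (.inl (.inl r))

/-- The draw used for predicting. -/
def playedOf (d : DrawIdx R M k → H) : H := d (.inl (.inr ()))

/-- The resampling draws. -/
def resampledOf (d : DrawIdx R M k → H) : Fin k → Fin M → H :=
  fun i n => d (.inr (finProdFinEquiv (i, n)))

section Resampling

variable (ν : Measure H) [IsProbabilityMeasure ν]

/-- The event is a box: it constrains the played draw and the first `n` redraws for individual `i`,
which are independent. -/
theorem measureReal_played_and_resampled (x : X) (b : Bool) (i : Fin k) (n : Fin M) :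
    (Measure.pi fun _ : DrawIdx R M k => ν).real
      {d | (playedOf d).1 x = b ∧ ∀ n' < n, (resampledOf d i n').1 x ≠ b}
      = ν.real {h | h.1 x = b} * (1 - ν.real {h | h.1 x = b}) ^ (n : ℕ) := by
  classical
  let s : DrawIdx R M k → Set H := Sum.elim (Sum.elim (fun _ => Set.univ) fun _ => {h | h.1 x = b})
    fun j => if (finProdFinEquiv.symm j).1 = i ∧ (finProdFinEquiv.symm j).2 < n
      then {h | h.1 x = b}ᶜ else Set.univ
  have hs : {d : DrawIdx R M k → H |
      (playedOf d).1 x = b ∧ ∀ n' < n, (resampledOf d i n').1 x ≠ b} = Set.univ.pi s := by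
    ext d
    simp only [Set.mem_ofPred_eq, Set.mem_univ_pi, Sum.forall, s, Sum.elim_inl, Sum.elim_inr,
      Set.mem_univ, implies_true, true_and, playedOf, resampledOf]
    refine and_congr ⟨fun h _ => h, fun h => h ()⟩ ⟨fun h j => ?_, fun h n' hn' => ?_⟩
    · split_ifs with hj
      · have := h _ hj.2
        rw [← hj.1, Prod.mk.eta, Equiv.apply_symm_apply] at this
        exact this
      · trivial
    · have := h (finProdFinEquiv (i, n'))
      simpa [hn'] using this
  rw [hs, Measure.real, Measure.pi_pi, ENNReal.toReal_prod, Fintype.prod_sum_type,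
    Fintype.prod_sum_type, ← finProdFinEquiv.prod_comp, Fintype.prod_prod_type]
  simp only [s, Sum.elim_inl, Sum.elim_inr, measure_univ, Equiv.symm_apply_apply,
    Finset.prod_const_one, one_mul, Finset.univ_unique, Finset.prod_singleton,
    ENNReal.toReal_one]
  have hc : (ν {h | h.1 x = b}ᶜ).toReal = 1 - ν.real {h | h.1 x = b} := by
    exact probReal_compl_eq_one_sub (.of_discrete)
  have h1 : ∀ (i' : Fin k) (n' : Fin M),
      (ν (if i' = i ∧ n' < n then {h | h.1 x = b}ᶜ else Set.univ)).toReal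
        = if i' = i then (if n' < n then 1 - ν.real {h | h.1 x = b} else 1) else 1 := by
    intro i' n'
    by_cases h1 : i' = i <;> by_cases h2 : n' < n <;> simp [h1, h2, hc]
  simp_rw [h1]
  congr 1
  rw [Finset.prod_eq_single i (fun i' _ hi => by simp [hi]) (by simp)]
  simp only [if_true, Finset.prod_ite, Finset.prod_const_one, mul_one, Finset.prod_const]
  congr 1
  rw [← Fin.card_Iio n]
  congr 1
  ext
  simp

/-- The count is the number of indices without an earlier success, so its mean is a geometric sum.
Multiplying the cost by it compensates the probability of observing that cost, up to the effect of
the cap `M`. -/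
theorem integral_resampleCount (x : X) (b : Bool) (i : Fin k) :
    ∫ d, (if (playedOf d).1 x = b then (resampleCount (resampledOf d i) x b : ℝ) else 0)
      ∂(Measure.pi fun _ : DrawIdx R M k => ν) = 1 - (1 - ν.real {h | h.1 x = b}) ^ M := by
  classical
  have e : ∀ d : DrawIdx R M k → H,
      (if (playedOf d).1 x = b then (resampleCount (resampledOf d i) x b : ℝ) else 0)
      = ∑ n : Fin M, Set.indicator
        {d | (playedOf d).1 x = b ∧ ∀ n' < n, (resampledOf d i n').1 x ≠ b} 1 d := fun d => by
    simp only [resampleCount, Finset.card_filter, Set.indicator_apply, Set.mem_ofPred_eq,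
      Pi.one_apply]
    split_ifs with h <;> simp [h]
  simp_rw [e]
  rw [integral_finsetSum _ fun _ _ => Integrable.of_finite]
  simp_rw [integral_indicator_one (Set.Finite.measurableSet (Set.toFinite _)),
    measureReal_played_and_resampled]
  rw [Fin.sum_univ_eq_sum_range fun n => ν.real {h : H | h.1 x = b} *
    (1 - ν.real {h : H | h.1 x = b}) ^ n, ← Finset.mul_sum]
  have := mul_neg_geom_sum (1 - ν.real {h : H | h.1 x = b}) M
  rwa [sub_sub_cancel] at this

theorem resampleCount_le (g : Fin M → H) (x : X) (b : Bool) : resampleCount g x b ≤ M := by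
  unfold resampleCount
  exact (Finset.card_filter_le _ _).trans (by simp)

end Resampling

section Costs

/-- The cost of the prediction `b` for individual `i`. -/
noncomputable def roundCost (lam : ℝ) (rep : Option (Fin k × Fin k)) (y : Fin k → Bool) (i : Fin k)
    (b : Bool) : ℝ :=
  observedCost lam rep i b (oneSided y (fun _ => b) i)

/-- The total cost of the predictions of a hypothesis. -/
noncomputable def roundLoss (lam : ℝ) (rep : Option (Fin k × Fin k)) (x : Fin k → X)
    (y : Fin k → Bool) (f : X → Bool) : ℝ :=
  ∑ i, roundCost lam rep y i (f (x i))

theorem roundCost_nonneg {lam : ℝ} (hlam : 0 ≤ lam) (rep : Option (Fin k × Fin k))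
    (y : Fin k → Bool) (i : Fin k) (b : Bool) : 0 ≤ roundCost lam rep y i b := by
  unfold roundCost observedCost
  refine add_nonneg (div_nonneg ?_ k.cast_nonneg) (mul_nonneg hlam ?_)
  · split
    · split_ifs <;> norm_num
    · norm_num
  · split
    · split_ifs <;> norm_num
    · norm_num

/-- The label part is at most 2/k per individual and the unfairness part touches only the two
reported ones. Bounding both predictions at once keeps the scale S = 2 + 2λ free of `k`, for losses,
estimates and bias alike. -/
theorem exists_roundCost_bound (hk : 0 < k) {lam : ℝ} (hlam : 0 ≤ lam)
    (rep : Option (Fin k × Fin k)) (y : Fin k → Bool) :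
    ∃ c : Fin k → ℝ, (∀ i b, roundCost lam rep y i b ≤ c i) ∧ ∑ i, c i ≤ 2 + 2 * lam := by
  have hk' : (k : ℝ) ≠ 0 := by positivity
  have hv : ∀ (o : Option Bool), (match o with
    | some y => if y = true then (0 : ℝ) else 2
    | none => 1 : ℝ) / k ≤ 2 / k := fun o => by
    gcongr
    split
    · split_ifs <;> norm_num
    · norm_num
  cases rep with
  | none =>
    refine ⟨fun _ => 2 / k, fun i b => ?_, ?_⟩
    · have := hv (oneSided y (fun _ => b) i)
      simp only [roundCost, observedCost, mul_zero, add_zero]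
      exact this
    · simp only [Finset.sum_const, Finset.card_univ, Fintype.card_fin, nsmul_eq_mul]
      rw [mul_div_cancel₀ _ hk']
      linarith
  | some lr =>
    refine ⟨fun i => 2 / k + lam * ((if i = lr.1 then 1 else 0) + (if i = lr.2 then 1 else 0)),
      fun i b => ?_, ?_⟩
    · simp only [roundCost, observedCost]
      refine add_le_add (hv _) (mul_le_mul_of_nonneg_left (add_le_add ?_ ?_) hlam)
      · split_ifs <;> simp_all
      · split_ifs <;> simp_all
    · rw [Finset.sum_add_distrib, ← Finset.mul_sum, Finset.sum_add_distrib]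
      simp only [Finset.sum_const, Finset.card_univ, Fintype.card_fin, nsmul_eq_mul,
        Finset.sum_ite_eq', Finset.mem_univ, if_true]
      rw [mul_div_cancel₀ _ hk']
      linarith

/-- The batch appended to the history, as a function of the draws. -/
noncomputable def estimateOf (lam : ℝ) (rep : Option (Fin k × Fin k)) (x : Fin k → X)
    (y : Fin k → Bool) (d : DrawIdx R M k → H) : Batch X :=
  estimatedCosts lam x rep (playedOf d) (oneSided y fun i => (playedOf d).1 (x i)) (resampledOf d)

/-- The estimated cost of a randomized classifier that predicts `b` on individual `i` with
probability `w i b`. -/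
noncomputable def estimatedLoss (lam : ℝ) (rep : Option (Fin k × Fin k)) (x : Fin k → X)
    (y : Fin k → Bool) (d : DrawIdx R M k → H) (w : Fin k → Bool → ℝ) : ℝ :=
  ∑ i, ∑ b, w i b * roundCost lam rep y i b *
    (if (playedOf d).1 (x i) = b then (resampleCount (resampledOf d i) (x i) b : ℝ) else 0)

/-- One-sided feedback is enough: a cost enters only for the prediction made, and whether its label
is seen depends on that prediction alone. -/
theorem batchCost_estimateOf (lam : ℝ) (rep : Option (Fin k × Fin k)) (x : Fin k → X)
    (y : Fin k → Bool) (d : DrawIdx R M k → H) (f : X → Bool) :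
    batchCost (estimateOf lam rep x y d) f
      = estimatedLoss lam rep x y d fun i b => if f (x i) = b then 1 else 0 := by
  have : batchCost (estimateOf lam rep x y d) f = ∑ i, (if f (x i) = (playedOf d).1 (x i) then
        (resampleCount (resampledOf d i) (x i) (f (x i)) : ℝ) *
          observedCost lam rep i (f (x i)) (oneSided y (fun i => (playedOf d).1 (x i)) i)
      else 0) := by
    simp only [batchCost, estimateOf, estimatedCosts, Multiset.map_map]
    rfl
  rw [this, estimatedLoss]
  refine Finset.sum_congr rfl fun i _ => ?_
  rw [Finset.sum_eq_single (f (x i)) (fun b _ hb => by simp [hb.symm]) (by simp)]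
  by_cases h : f (x i) = (playedOf d).1 (x i)
  · simp [h, roundCost, oneSided, mul_comm]
  · rw [if_neg h, if_neg (Ne.symm h), mul_zero]

theorem estimatedLoss_mem_Icc (hk : 0 < k) {lam : ℝ} (hlam : 0 ≤ lam)
    (rep : Option (Fin k × Fin k)) (x : Fin k → X)
    (y : Fin k → Bool) (d : DrawIdx R M k → H) {w : Fin k → Bool → ℝ}
    (hw : ∀ i b, w i b ∈ Set.Icc (0 : ℝ) 1) :
    estimatedLoss lam rep x y d w ∈ Set.Icc 0 (M * (2 + 2 * lam)) := by
  obtain ⟨c, hc, hcs⟩ := exists_roundCost_bound hk hlam rep y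
  constructor
  · refine Finset.sum_nonneg fun i _ => Finset.sum_nonneg fun b _ => mul_nonneg (mul_nonneg
      (hw i b).1 (roundCost_nonneg hlam _ _ _ _)) ?_
    split_ifs
    · exact Nat.cast_nonneg _
    · exact le_rfl
  · calc _ ≤ ∑ i, M * c i := ?_
      _ = M * ∑ i, c i := by rw [Finset.mul_sum]
      _ ≤ _ := by gcongr
    refine Finset.sum_le_sum fun i _ => ?_
    rw [Finset.sum_eq_single ((playedOf d).1 (x i))
      (fun b _ hb => by rw [if_neg hb.symm, mul_zero]) (by simp), if_pos rfl, mul_comm]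
    have h1 : (resampleCount (resampledOf d i) (x i) ((playedOf d).1 (x i)) : ℝ) ≤ M := by
      exact Nat.cast_le.2 (resampleCount_le _ _ _)
    have h2 := roundCost_nonneg hlam rep y i ((playedOf d).1 (x i))
    have h3 := hw i ((playedOf d).1 (x i))
    refine mul_le_mul h1 ?_ (mul_nonneg h3.1 h2) (Nat.cast_nonneg _)
    exact (mul_le_of_le_one_left h2 h3.2).trans (hc _ _)

theorem batchCost_estimateOf_mem_Icc (hk : 0 < k) {lam : ℝ} (hlam : 0 ≤ lam)
    (rep : Option (Fin k × Fin k)) (x : Fin k → X) (y : Fin k → Bool) (d : DrawIdx R M k → H)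
    (f : X → Bool) :
    batchCost (estimateOf lam rep x y d) f ∈ Set.Icc 0 (M * (2 + 2 * lam)) := by
  rw [batchCost_estimateOf]
  exact estimatedLoss_mem_Icc hk hlam _ _ _ _ fun i b => by split_ifs <;> simp

variable (ν : Measure H) [IsProbabilityMeasure ν]

theorem integral_estimatedLoss (lam : ℝ)
    (rep : Option (Fin k × Fin k)) (x : Fin k → X) (y : Fin k → Bool) (w : Fin k → Bool → ℝ) :
    ∫ d, estimatedLoss lam rep x y d w ∂(Measure.pi fun _ : DrawIdx R M k => ν)
      = ∑ i, ∑ b, w i b * roundCost lam rep y i b * (1 - (1 - ν.real {h | h.1 (x i) = b}) ^ M) := by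
  unfold estimatedLoss
  rw [integral_finsetSum _ fun _ _ => Integrable.of_finite]
  refine Finset.sum_congr rfl fun i _ => ?_
  rw [integral_finsetSum _ fun _ _ => Integrable.of_finite]
  refine Finset.sum_congr rfl fun b _ => ?_
  rw [integral_const_mul, integral_resampleCount]

theorem sum_mul_sum_bool (w : H → ℝ) (x : Fin k → X) (c : Fin k → Bool → ℝ) :
    ∑ h, w h * ∑ i, ∑ b, (if h.1 (x i) = b then 1 else 0) * c i b
      = ∑ i, ∑ b, (∑ h, w h * if h.1 (x i) = b then 1 else 0) * c i b := by
  simp_rw [Finset.mul_sum, Finset.sum_mul]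
  rw [Finset.sum_comm]
  refine Finset.sum_congr rfl fun i _ => ?_
  rw [Finset.sum_comm]
  simp_rw [mul_assoc]

theorem sum_real_singleton_mul_ite (x : X) (b : Bool) :
    ∑ h : H, ν.real {h} * (if h.1 x = b then 1 else 0) = ν.real {h | h.1 x = b} := by
  classical
  simp only [mul_ite, mul_one, mul_zero]
  rw [← Finset.sum_filter, sum_measureReal_singleton]
  simp

theorem roundLoss_eq (lam : ℝ) (rep : Option (Fin k × Fin k)) (x : Fin k → X) (y : Fin k → Bool)
    (f : X → Bool) : roundLoss lam rep x y f
      = ∑ i, ∑ b, (if f (x i) = b then 1 else 0) * roundCost lam rep y i b := by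
  simp [roundLoss]

/-- Under the policy's own weights, the bias caused by the cap is p(1 - p)^M. This is small
uniformly in `p`: p·e^(-pM) is maximal at p = 1/M. No exploration is therefore needed. -/
theorem mul_one_sub_pow_le {p : ℝ} (hp : p ∈ Set.Icc (0 : ℝ) 1) {M : ℕ} (hM : 0 < M) :
    p * (1 - p) ^ M ≤ 1 / (Real.exp 1 * M) := by
  have hM' : (0 : ℝ) < M := by exact_mod_cast hM
  have h1 : (1 - p) ^ M ≤ Real.exp (-p * M) := by
    rw [mul_comm, Real.exp_nat_mul]
    have := Real.add_one_le_exp (-p)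
    exact pow_le_pow_left₀ (by linarith [hp.2]) (by linarith) M
  have h2 := Real.add_one_le_exp (p * M - 1)
  rw [le_div_iff₀ (by positivity)]
  calc p * (1 - p) ^ M * (Real.exp 1 * M) ≤ p * Real.exp (-p * M) * (Real.exp 1 * M) := by
        have := hp.1
        gcongr
    _ = (p * M - 1 + 1) * (Real.exp (-p * M) * Real.exp 1) := by ring
    _ ≤ Real.exp (p * M - 1) * (Real.exp (-p * M) * Real.exp 1) := by gcongr
    _ = 1 := by rw [← Real.exp_add, ← Real.exp_add]; simp

/-- Exponential moment of the gap between true and estimated regret, for a fixed report. -/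
theorem lintegral_exp_regret_gap_le (hk : 0 < k) (hM : 0 < M) {lam : ℝ} (hlam : 0 ≤ lam)
    (rep : Option (Fin k × Fin k)) (x : Fin k → X) (y : Fin k → Bool) (f : H) {β θ : ℝ}
    (hβ : β ∈ Set.Icc (0 : ℝ) 1) (hθ : 0 ≤ θ) (hθ1 : θ * ((1 + M) * (2 + 2 * lam)) ≤ 1) :
    ∫⁻ d, ENNReal.ofReal (Real.exp (θ * (∑ h : H, ν.real {h} * roundLoss lam rep x y h
        - (1 - β) * ∑ h : H, ν.real {h} * batchCost (estimateOf lam rep x y d) h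
        + batchCost (estimateOf lam rep x y d) f - roundLoss lam rep x y f)))
        ∂(Measure.pi fun _ : DrawIdx R M k => ν)
      ≤ ENNReal.ofReal (Real.exp (θ * (β * (2 + 2 * lam) + 2 * (2 + 2 * lam) / (Real.exp 1 * M)
          + 9 * θ * M * (2 + 2 * lam) ^ 2))) := by
  have hp : ∀ i b, ν.real {h : H | h.1 (x i) = b} ∈ Set.Icc (0 : ℝ) 1 := fun i b =>
    ⟨measureReal_nonneg, measureReal_le_one⟩
  have hpM : ∀ i b, (1 - ν.real {h : H | h.1 (x i) = b}) ^ M ∈ Set.Icc (0 : ℝ) 1 := fun i b =>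
    ⟨pow_nonneg (by linarith [(hp i b).2]) _,
      pow_le_one₀ (by linarith [(hp i b).2]) (by linarith [(hp i b).1])⟩
  have hc0 := roundCost_nonneg hlam rep y
  obtain ⟨c, hc, hcs⟩ := exists_roundCost_bound hk hlam rep y
  have hM' : (1 : ℝ) ≤ M := by exact_mod_cast hM
  have hloss : ∀ f : X → Bool, roundLoss lam rep x y f ∈ Set.Icc 0 (2 + 2 * lam) := fun f =>
    ⟨Finset.sum_nonneg fun i _ => hc0 _ _,
      (Finset.sum_le_sum fun i _ => hc _ _).trans hcs⟩
  have ha : ∑ h : H, ν.real {h} * roundLoss lam rep x y h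
      = ∑ i, ∑ b, ν.real {h : H | h.1 (x i) = b} * roundCost lam rep y i b := by
    simp_rw [roundLoss_eq, sum_mul_sum_bool, sum_real_singleton_mul_ite]
  have hA : ∀ d : DrawIdx R M k → H,
      ∑ h : H, ν.real {h} * batchCost (estimateOf lam rep x y d) h
      = estimatedLoss lam rep x y d fun i b => ν.real {h : H | h.1 (x i) = b} := fun d => by
    simp_rw [batchCost_estimateOf, estimatedLoss, mul_assoc, sum_mul_sum_bool,
      sum_real_singleton_mul_ite]
  have hsum1 : ∑ h : H, ν.real {h} = 1 := by
    rw [sum_measureReal_singleton]; simp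
  simp_rw [hA, batchCost_estimateOf]
  refine integral_exp_le_of_bounded (Measure.pi fun _ : DrawIdx R M k => ν) (.of_discrete)
    (.of_discrete) hM' (fun d => estimatedLoss_mem_Icc hk hlam _ _ _ _ hp)
    (fun d => estimatedLoss_mem_Icc hk hlam _ _ _ _ fun i b => by split_ifs <;> simp)
    ⟨?_, ?_⟩ (hloss f) ?_ ?_ ?_ (by positivity) hβ hθ hθ1
  · exact Finset.sum_nonneg fun h _ => mul_nonneg measureReal_nonneg (hloss h).1
  · calc _ ≤ ∑ h : H, ν.real {h} * (2 + 2 * lam) :=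
        Finset.sum_le_sum fun h _ => mul_le_mul_of_nonneg_left (hloss h).2 measureReal_nonneg
      _ = _ := by rw [← Finset.sum_mul, hsum1, one_mul]
  · rw [integral_estimatedLoss, ha]
    refine Finset.sum_le_sum fun i _ => Finset.sum_le_sum fun b _ => ?_
    refine mul_le_of_le_one_right (mul_nonneg (hp i b).1 (hc0 _ _)) ?_
    linarith [(hpM i b).1]
  -- The bias on the policy's side: both predictions of individual `i` contribute at most `c
  -- i`/(eM), whence the factor 2.
  · rw [integral_estimatedLoss, ha, sub_le_comm, ← Finset.sum_sub_distrib]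
    calc _ ≤ ∑ i, 2 * c i / (Real.exp 1 * M) := ?_
      _ ≤ _ := by
        rw [← Finset.sum_div, ← Finset.mul_sum]
        gcongr
    refine Finset.sum_le_sum fun i _ => ?_
    rw [← Finset.sum_sub_distrib]
    calc _ ≤ ∑ _b : Bool, c i / (Real.exp 1 * M) := ?_
      _ = _ := by simp; ring
    refine Finset.sum_le_sum fun b _ => ?_
    have h1 := mul_one_sub_pow_le (hp i b) hM
    calc _ = roundCost lam rep y i b * (ν.real {h : H | h.1 (x i) = b} *
          (1 - ν.real {h : H | h.1 (x i) = b}) ^ M) := by ring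
      _ ≤ c i * (1 / (Real.exp 1 * M)) := by
        refine mul_le_mul (hc i b) h1 (mul_nonneg (hp i b).1 (hpM i b).1) ((hc0 i b).trans (hc i b))
      _ = _ := by ring
  -- The cost of the comparator is underestimated in mean, which is the harmless direction, so its
  -- small probabilities do not matter.
  · rw [integral_estimatedLoss, roundLoss_eq]
    refine Finset.sum_le_sum fun i _ => Finset.sum_le_sum fun b _ => ?_
    refine mul_le_of_le_one_right (mul_nonneg (by split_ifs <;> simp) (hc0 _ _)) ?_
    linarith [(hpM i b).1]

end Costs

end FairOnline

/-! ### A round as a function of its draws; the range of the multiplier -/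

namespace FairOnline

variable {X : Type u} {H : Finset (X → Bool)}

namespace OracleProg

variable {A B C : Type u}

theorem eval_askAll (o : A → B) (n : ℕ) (q : Fin n → A) (c : (Fin n → B) → OracleProg A B C) :
    (askAll n q c).eval o = (c fun i => o (q i)).eval o := by
  induction n with
  | zero => simp only [askAll]; congr 2; exact Subsingleton.elim _ _
  | succ n ih =>
    rw [askAll, eval, ih]
    congr 2
    funext i
    refine Fin.cases ?_ (fun i => ?_) i <;> simp [Fin.tail]

theorem calls_askAll (o : A → B) (n : ℕ) (q : Fin n → A) (c : (Fin n → B) → OracleProg A B C) :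
    (askAll n q c).calls o = (c fun i => o (q i)).calls o + n := by
  induction n with
  | zero =>
    simp only [askAll, add_zero]; congr 2; exact Subsingleton.elim _ _
  | succ n ih =>
    rw [askAll, calls, ih, add_assoc]
    congr 3
    funext i
    refine Fin.cases ?_ (fun i => ?_) i <;> simp [Fin.tail]

end OracleProg

section Rounds

variable {k : ℕ} (erm : Batch X → H) (Q : Finset X) (P : Params) (adv : Adversary H P.R P.M k)

/-- The outcome of a round as a function of the draws. -/
noncomputable def outcomeOf (lam : ℝ) (ρ : Round X k) (d : DrawIdx P.R P.M k → H) :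
    Outcome H P.R P.M k where
  elicited := elicitedOf d
  report := ρ.scheme.report (empirical (elicitedOf d)) ρ.x (P.α - P.ε / 2)
  played := playedOf d
  resampled := resampledOf d
  estimate := estimateOf lam (ρ.scheme.report (empirical (elicitedOf d)) ρ.x (P.α - P.ε / 2))
    ρ.x ρ.y d

/-- The draws of a round as a function of the noise. -/
def drawsOf {Q : Finset X} (hist : Batch X) (z : DrawIdx P.R P.M k → Noise Q k) :
    DrawIdx P.R P.M k → H :=
  fun j => erm (ftplQuery hist (z j))

/-- The past after one more round with given draws. -/
noncomputable def extend (past : List (Outcome H P.R P.M k)) (d : DrawIdx P.R P.M k → H) :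
    List (Outcome H P.R P.M k) :=
  outcomeOf P (stateAfter erm Q P adv past).lam (adv past) d :: past

theorem nextRound_eval (past : List (Outcome H P.R P.M k)) (z : DrawIdx P.R P.M k → Noise Q k) :
    (nextRound erm Q P adv past z).eval erm = outcomeOf P (stateAfter erm Q P adv past).lam (adv past)
      (drawsOf erm P (stateAfter erm Q P adv past).hist z) := by
  rw [nextRound, roundProg, OracleProg.eval_askAll, OracleProg.eval, OracleProg.eval_askAll,
    OracleProg.eval]
  rfl

theorem nextRound_calls (past : List (Outcome H P.R P.M k)) (z : DrawIdx P.R P.M k → Noise Q k) :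
    (nextRound erm Q P adv past z).calls erm = P.R + 1 + k * P.M := by
  rw [nextRound, roundProg, OracleProg.calls_askAll, OracleProg.calls, OracleProg.calls_askAll,
    OracleProg.calls]
  ring

theorem run_eq_adaptiveRun {T : ℕ} (z : Tape Q P k T) (t : ℕ) :
    run erm P adv z t = adaptiveRun (fun past ζ =>
      extend erm Q P adv past (drawsOf erm P (stateAfter erm Q P adv past).hist ζ)) [] z t := by
  induction t with
  | zero => rfl
  | succ t ih =>
    rw [run, adaptiveRun, ← ih]
    simp only [nextRound_eval]
    rfl

end Rounds

section Multiplier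

theorem mix_mem_Icc {π : H → ℝ} (hπ : π ∈ stdSimplex ℝ H) (x : X) : mix π x ∈ Set.Icc (0 : ℝ) 1 := by
  constructor
  · exact Finset.sum_nonneg fun h _ => mul_nonneg (hπ.1 h) (by split_ifs <;> norm_num)
  · rw [← hπ.2]
    refine Finset.sum_le_sum fun h _ => mul_le_of_le_one_right (hπ.1 h) (by split_ifs <;> norm_num)

theorem empirical_mem_Icc {R : ℕ} (g : Fin R → H) (x : X) : empirical g x ∈ Set.Icc (0 : ℝ) 1 := by
  have h0 : (0 : ℝ) ≤ ∑ r, if (g r).1 x = true then (1 : ℝ) else 0 :=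
    Finset.sum_nonneg fun r _ => by split_ifs <;> norm_num
  have h1 : (∑ r, if (g r).1 x = true then (1 : ℝ) else 0) ≤ R := by
    calc _ ≤ ∑ _r : Fin R, (1 : ℝ) := Finset.sum_le_sum fun r _ => by split_ifs <;> norm_num
      _ = R := by simp
  exact ⟨div_nonneg h0 R.cast_nonneg, div_le_one_of_le₀ h1 R.cast_nonneg⟩

theorem abs_unfairProxy_le {k : ℕ} (x : Fin k → X) (rep : Option (Fin k × Fin k)) {p p' : X → ℝ}
    (hp : ∀ x, p x ∈ Set.Icc (0 : ℝ) 1) (hp' : ∀ x, p' x ∈ Set.Icc (0 : ℝ) 1) {β : ℝ}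
    (hβ : β ∈ Set.Icc (0 : ℝ) (1 / 2)) : |unfairProxy x rep p p' β| ≤ 5 / 2 := by
  unfold unfairProxy
  cases rep with
  | none => norm_num
  | some lr =>
    have h1 := hp (x lr.1)
    have h2 := hp (x lr.2)
    have h3 := hp' (x lr.1)
    have h4 := hp' (x lr.2)
    simp only [Set.mem_Icc] at *
    rw [abs_le]
    constructor <;> linarith

/-- Before projection the update is (1 - μ²)λ + μ²(U/μ), a convex combination of λ and U/μ, and |U|
≤ 5/2. This sure bound lets θ be a constant. -/
theorem lam_mem_Icc {k : ℕ} (erm : Batch X → H) (Q : Finset X) (P : Params)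
    (adv : Adversary H P.R P.M k) (hπ : ∀ hist, ftplPolicy erm Q k P.ω hist ∈ stdSimplex ℝ H)
    (hε : P.ε ∈ Set.Icc (0 : ℝ) 1) (hμ : 0 < P.μ) (hμ1 : P.μ ≤ 1)
    (past : List (Outcome H P.R P.M k)) :
    (stateAfter erm Q P adv past).lam ∈ Set.Icc 0 (5 / 2 / P.μ) := by
  induction past with
  | nil => exact ⟨le_rfl, by simp only [stateAfter]; positivity⟩
  | cons o past ih =>
    refine ⟨le_max_left _ _, max_le (by positivity) ?_⟩
    have hU := abs_unfairProxy_le (adv past).x o.report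
      (mix_mem_Icc (hπ (stateAfter erm Q P adv past).hist))
      (empirical_mem_Icc o.elicited) (β := P.ε / 2) ⟨by linarith [hε.1], by linarith [hε.2]⟩
    rw [abs_le] at hU
    obtain ⟨h0, h1⟩ := ih
    rw [le_div_iff₀ hμ] at h1 ⊢
    set U := unfairProxy (adv past).x o.report (mix (ftplPolicy erm Q k P.ω (stateAfter erm Q P adv past).hist))
      (empirical o.elicited) (P.ε / 2)
    set l := (stateAfter erm Q P adv past).lam
    have h2 : P.μ ^ 2 * U ≤ P.μ ^ 2 * (5 / 2) := by gcongr; exact hU.2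
    have h3 : (1 - P.μ ^ 2) * (l * P.μ) ≤ (1 - P.μ ^ 2) * (5 / 2) :=
      mul_le_mul_of_nonneg_left h1 (by nlinarith)
    nlinarith

end Multiplier

/-- The numerical conditions on the parameters, for `s` separating points, that make the
analysis work: `θ` is the scale at which the deviations are controlled. -/
structure Params.Admissible (P : Params) (k T s : ℕ) (δ θ : ℝ) : Prop where
  k_pos : 0 < k
  T_pos : 0 < T
  δ_pos : 0 < δ
  θ_pos : 0 < θ
  α_pos : 0 < P.α
  α_le : P.α ≤ 1
  ε_eq : P.ε = P.α
  μ_pos : 0 < P.μ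
  μ_le : P.μ ≤ 1
  ω_pos : 0 < P.ω
  R_pos : 0 < P.R
  M_pos : 0 < P.M
  stable : ∀ lam, 0 ≤ lam → lam ≤ 5 / 2 / P.μ → P.ω * (s * (P.M * (2 + 2 * lam))) ≤ 1
  scale : ∀ lam, 0 ≤ lam → lam ≤ 5 / 2 / P.μ → θ * ((1 + P.M) * (2 + 2 * lam)) ≤ 1
  drift : ∀ lam, 0 ≤ lam → lam ≤ 5 / 2 / P.μ →
    P.ω * (s * (P.M * (2 + 2 * lam))) * (2 + 2 * lam) + 2 * (2 + 2 * lam) / (Real.exp 1 * P.M)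
      + 9 * θ * P.M * (2 + 2 * lam) ^ 2 ≤ P.μ * (1 + lam ^ 2 / 2)
  elicit : k * (2 * Real.exp (-(2 * P.R * (P.α / 8) ^ 2))) ≤ δ / (2 * T)

/-! ### The exponential supermartingale and the failure probability -/

section Supermartingale

variable {k : ℕ} (erm : Batch X → H) (Q : Finset X) (P : Params) (adv : Adversary H P.R P.M k)

/-- The gap between true and estimated regret against `f` in the round with outcome `o`. -/
noncomputable def regretGap (past : List (Outcome H P.R P.M k)) (o : Outcome H P.R P.M k) (f : H) :
    ℝ :=
  let st := stateAfter erm Q P adv past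
  let π := ftplPolicy erm Q k P.ω st.hist
  ∑ h : H, π h * roundLoss st.lam o.report (adv past).x (adv past).y h
    - (1 - P.ω * (Q.card * (P.M * (2 + 2 * st.lam)))) * ∑ h : H, π h * batchCost o.estimate h
    + batchCost o.estimate f - roundLoss st.lam o.report (adv past).x (adv past).y f

/-- The compensated logarithm of the exponential supermartingale. -/
noncomputable def gapSum (θ : ℝ) (f : H) : List (Outcome H P.R P.M k) → ℝ
  | [] => 0
  | o :: past => gapSum θ f past + θ * (regretGap erm Q P adv past o f
      - P.μ * (1 + (stateAfter erm Q P adv past).lam ^ 2 / 2))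

/-- The elicited hypotheses misrepresent the deployed policy on some individual. -/
def Misrepresented (past : List (Outcome H P.R P.M k)) (o : Outcome H P.R P.M k) : Prop :=
  ∃ i, P.α / 8 ≤ |mix (ftplPolicy erm Q k P.ω (stateAfter erm Q P adv past).hist) ((adv past).x i)
    - empirical o.elicited ((adv past).x i)|

open Classical in
/-- The number of rounds with a misrepresented policy. -/
noncomputable def badRounds : List (Outcome H P.R P.M k) → ENNReal
  | [] => 0
  | o :: past => badRounds past + if Misrepresented erm Q P adv past o then 1 else 0

/-- Bounds the indicator of a failure. -/
noncomputable def failureBound (δ θ : ℝ) (past : List (Outcome H P.R P.M k)) : ENNReal :=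
  ENNReal.ofReal (δ / (2 * H.card)) * ∑ f : H, ENNReal.ofReal (Real.exp (gapSum erm Q P adv θ f past))
    + badRounds erm Q P adv past

variable {erm Q P}

variable {T : ℕ} {δ θ : ℝ} (hP : P.Admissible k T Q.card δ θ) (hsep : IsSeparating H Q)
  (herm : IsERM erm)
include hP hsep herm

theorem aemeasurable_drawsOf (hist : Batch X) :
    AEMeasurable (drawsOf (k := k) (Q := Q) erm P hist) (Measure.pi fun _ => noiseLaw Q k P.ω) := by
  have := isProbabilityMeasure_noiseLaw (Q := Q) (k := k) hP.ω_pos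
  exact aemeasurable_pi_lambda _ fun j =>
    (aemeasurable_ftpl hP.ω_pos hP.k_pos hsep herm hist).comp_quasiMeasurePreserving
      (Measure.quasiMeasurePreserving_eval _ j)

theorem lintegral_drawsOf (hist : Batch X) (G : (DrawIdx P.R P.M k → H) → ENNReal) :
    ∫⁻ z, G (drawsOf (Q := Q) erm P hist z) ∂(Measure.pi fun _ => noiseLaw Q k P.ω)
      = ∫⁻ d, G d ∂(Measure.pi fun _ => drawLaw erm Q k P.ω hist) := by
  have := isProbabilityMeasure_noiseLaw (Q := Q) (k := k) hP.ω_pos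
  have hp := isProbabilityMeasure_drawLaw hP.ω_pos hP.k_pos hsep herm hist
  have h := Measure.pi_map_pi (μ := fun _ : DrawIdx P.R P.M k => noiseLaw Q k P.ω)
    (f := fun _ z => erm (ftplQuery hist z)) (hμ := fun _ => by
      have := hp; unfold drawLaw at this; infer_instance)
    (fun _ => aemeasurable_ftpl hP.ω_pos hP.k_pos hsep herm hist)
  unfold drawLaw
  rw [← h]
  exact (lintegral_map' (Measurable.of_discrete).aemeasurable
    (aemeasurable_drawsOf hP hsep herm hist)).symm

/-- The report is adversarial but depends only on the elicitation draws. Once it is frozen, the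
other draws obey the exponential moment bound for a fixed report, and the compensator absorbs the
resulting drift by `hP.drift`. -/
theorem lintegral_exp_gapSum_le (past : List (Outcome H P.R P.M k)) (f : H) :
    ∫⁻ d, ENNReal.ofReal (Real.exp (gapSum erm Q P adv θ f (extend erm Q P adv past d)))
        ∂(Measure.pi fun _ => drawLaw erm Q k P.ω (stateAfter erm Q P adv past).hist)
      ≤ ENNReal.ofReal (Real.exp (gapSum erm Q P adv θ f past)) := by
  classical
  set st := stateAfter erm Q P adv past with hst
  have hp := isProbabilityMeasure_drawLaw hP.ω_pos hP.k_pos hsep herm st.hist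
  obtain ⟨hl0, hl1⟩ := lam_mem_Icc erm Q P adv
    (ftplPolicy_mem_stdSimplex hP.ω_pos hP.k_pos hsep herm)
    ⟨by rw [hP.ε_eq]; exact hP.α_pos.le, by rw [hP.ε_eq]; exact hP.α_le⟩ hP.μ_pos hP.μ_le past
  rw [← hst] at hl0 hl1
  let rep : (DrawIdx P.R P.M k → H) → Option (Fin k × Fin k) := fun d =>
    (adv past).scheme.report (empirical (elicitedOf d)) (adv past).x (P.α - P.ε / 2)
  -- The first argument acts only through the report, the second only through the played and
  -- resampled hypotheses.
  let F : (DrawIdx P.R P.M k → H) → (DrawIdx P.R P.M k → H) → ENNReal := fun d d' =>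
    ENNReal.ofReal (Real.exp (θ * (∑ h : H, (drawLaw erm Q k P.ω st.hist).real {h} *
        roundLoss st.lam (rep d) (adv past).x (adv past).y h
      - (1 - P.ω * (Q.card * (P.M * (2 + 2 * st.lam)))) *
        ∑ h : H, (drawLaw erm Q k P.ω st.hist).real {h} *
        batchCost (estimateOf st.lam (rep d) (adv past).x (adv past).y d') h
      + batchCost (estimateOf st.lam (rep d) (adv past).x (adv past).y d') f
      - roundLoss st.lam (rep d) (adv past).x (adv past).y f)))
  have hF : ∫⁻ d, F d d ∂(Measure.pi fun _ => drawLaw erm Q k P.ω st.hist)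
      ≤ ENNReal.ofReal (Real.exp (θ * (P.ω * (Q.card * (P.M * (2 + 2 * st.lam))) * (2 + 2 * st.lam)
        + 2 * (2 + 2 * st.lam) / (Real.exp 1 * P.M)
          + 9 * θ * P.M * (2 + 2 * st.lam) ^ 2))) := by
    refine lintegral_le_of_splice _ (fun j => ∃ r, j = .inl (.inl r)) F
      (fun d d' => ?_) fun d => ?_
    · set d'' : DrawIdx P.R P.M k → H := fun j => if ∃ r, j = .inl (.inl r) then d j else d' j
        with hd''
      have e1 : elicitedOf d'' = elicitedOf d := by funext r; simp [elicitedOf, hd'']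
      have e2 : playedOf d'' = playedOf d' := by simp [playedOf, hd'']
      have e3 : resampledOf d'' = resampledOf d' := by funext i n; simp [resampledOf, hd'']
      simp only [F, rep, estimateOf, e1, e2, e3]
    · exact lintegral_exp_regret_gap_le _ hP.k_pos hP.M_pos hl0 _ _ _ _
        ⟨by have := hP.ω_pos; positivity, hP.stable _ hl0 hl1⟩ hP.θ_pos.le (hP.scale _ hl0 hl1)
  have hG : ∀ d, ENNReal.ofReal (Real.exp (gapSum erm Q P adv θ f (extend erm Q P adv past d)))
      = ENNReal.ofReal (Real.exp (gapSum erm Q P adv θ f past - θ * (P.μ * (1 + st.lam ^ 2 / 2))))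
        * F d d := fun d => by
    simp only [F, drawLaw_real_singleton hP.ω_pos hP.k_pos hsep herm]
    rw [← ENNReal.ofReal_mul (Real.exp_pos _).le, ← Real.exp_add, extend, gapSum, regretGap]
    congr 2
    simp only [outcomeOf, ← hst, rep]
    ring
  simp_rw [hG]
  rw [lintegral_const_mul' _ _ ENNReal.ofReal_ne_top]
  refine (mul_le_mul_right hF _).trans ?_
  rw [← ENNReal.ofReal_mul (Real.exp_pos _).le, ← Real.exp_add]
  refine ENNReal.ofReal_le_ofReal (Real.exp_le_exp.2 ?_)
  have := mul_le_mul_of_nonneg_left (hP.drift _ hl0 hl1) hP.θ_pos.le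
  linarith

theorem measure_misrepresented_le (past : List (Outcome H P.R P.M k)) :
    (Measure.pi fun _ => drawLaw erm Q k P.ω (stateAfter erm Q P adv past).hist)
      {d | Misrepresented erm Q P adv past
        (outcomeOf P (stateAfter erm Q P adv past).lam (adv past) d)} ≤ ENNReal.ofReal (δ / (2 * T)) := by
  set st := stateAfter erm Q P adv past with hst
  have hp := isProbabilityMeasure_drawLaw hP.ω_pos hP.k_pos hsep herm st.hist
  have h1 : {d | Misrepresented erm Q P adv past (outcomeOf P st.lam (adv past) d)}
      = ⋃ i, {d | P.α / 8 ≤ |mix (ftplPolicy erm Q k P.ω st.hist) ((adv past).x i)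
        - empirical (elicitedOf d) ((adv past).x i)|} := by
    ext d
    simp only [Misrepresented, Set.mem_ofPred_eq, Set.mem_iUnion, ← hst, outcomeOf]
  have h2 : ∀ i, (Measure.pi fun _ => drawLaw erm Q k P.ω st.hist).real
      {d : DrawIdx P.R P.M k → H | P.α / 8 ≤ |mix (ftplPolicy erm Q k P.ω st.hist) ((adv past).x i)
        - empirical (elicitedOf d) ((adv past).x i)|} ≤ 2 * Real.exp (-(2 * P.R * (P.α / 8) ^ 2)) := by
    intro i
    have := hoeffding_pi (ι := DrawIdx P.R P.M k) (drawLaw erm Q k P.ω st.hist)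
      (f := fun h => if h.1 ((adv past).x i) = true then 1 else 0)
      (fun h => by split_ifs <;> simp) hP.R_pos (e := fun r => .inl (.inl r))
      (fun r r' h => by simpa using h) (τ := P.α / 8) (by have := hP.α_pos; positivity)
    rw [integral_drawLaw hP.ω_pos hP.k_pos hsep herm] at this
    exact this
  rw [h1, ← ofReal_measureReal]
  refine ENNReal.ofReal_le_ofReal ?_
  refine (measureReal_iUnion_fintype_le _).trans ((Finset.sum_le_sum fun i _ => h2 i).trans ?_)
  simpa using hP.elicit

/-- The exponentials do not grow in mean, so the increment is the probability of a misrepresented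
round. -/
theorem lintegral_failureBound_le (past : List (Outcome H P.R P.M k)) :
    ∫⁻ z, failureBound erm Q P adv δ θ (extend erm Q P adv past
        (drawsOf (Q := Q) erm P (stateAfter erm Q P adv past).hist z))
        ∂(Measure.pi fun _ => noiseLaw Q k P.ω)
      ≤ failureBound erm Q P adv δ θ past + ENNReal.ofReal (δ / (2 * T)) := by
  classical
  have hp := isProbabilityMeasure_drawLaw hP.ω_pos hP.k_pos hsep herm
    (stateAfter erm Q P adv past).hist
  rw [lintegral_drawsOf hP hsep herm _
    fun d => failureBound erm Q P adv δ θ (extend erm Q P adv past d)]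
  unfold failureBound
  rw [lintegral_add_left .of_discrete, lintegral_const_mul' _ _ ENNReal.ofReal_ne_top,
    lintegral_finsetSum _ fun _ _ => .of_discrete, add_assoc]
  refine add_le_add (mul_le_mul_right (Finset.sum_le_sum fun f _ =>
    lintegral_exp_gapSum_le adv hP hsep herm past f) _) ?_
  simp only [extend, badRounds]
  rw [lintegral_add_left .of_discrete, lintegral_const, measure_univ, mul_one]
  gcongr
  have hind : ∀ d, (if Misrepresented erm Q P adv past
      (outcomeOf P (stateAfter erm Q P adv past).lam (adv past) d) then (1 : ENNReal) else 0)
      = Set.indicator {d | Misrepresented erm Q P adv past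
        (outcomeOf P (stateAfter erm Q P adv past).lam (adv past) d)} 1 d := fun d => by
    simp [Set.indicator_apply]
  simp_rw [hind]
  rw [lintegral_indicator_one (Set.Finite.measurableSet (Set.toFinite _))]
  exact measure_misrepresented_le adv hP hsep herm past

/-- Markov's inequality at level 1: the initial value is δ/2 and T rounds add at most T·δ/(2T) =
δ/2. -/
theorem failureBound_measure_le :
    tapeLaw Q P k T {z | 1 ≤ failureBound erm Q P adv δ θ (run erm P adv z T)}
      ≤ ENNReal.ofReal δ := by
  have := isProbabilityMeasure_noiseLaw (Q := Q) (k := k) hP.ω_pos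
  obtain ⟨h1, h2⟩ := lintegral_adaptiveRun_le (Measure.pi fun _ => noiseLaw Q k P.ω)
    (extend erm Q P adv) (fun past z => drawsOf (Q := Q) erm P (stateAfter erm Q P adv past).hist z)
    (fun past => aemeasurable_drawsOf hP hsep herm _) (failureBound erm Q P adv δ θ) _
    (lintegral_failureBound_le adv hP hsep herm) T []
  have hH : 0 < (H.card : ℝ) := by exact_mod_cast Finset.card_pos.2 ⟨_, (erm 0).2⟩
  have hT : (0 : ℝ) < T := by exact_mod_cast hP.T_pos
  have h3 := mul_meas_ge_le_lintegral₀ h1 1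
  simp_rw [← run_eq_adaptiveRun] at h2 h3
  rw [one_mul] at h3
  refine h3.trans (h2.trans (le_of_eq ?_))
  simp only [failureBound, gapSum, badRounds, Real.exp_zero, ENNReal.ofReal_one]
  simp only [Finset.sum_const, Finset.card_univ, Fintype.card_coe, nsmul_eq_mul, mul_one, add_zero]
  rw [← ENNReal.ofReal_natCast, ← ENNReal.ofReal_natCast,
    ← ENNReal.ofReal_mul (by have := hP.δ_pos; positivity), ← ENNReal.ofReal_mul hT.le,
    ← ENNReal.ofReal_add (by have := hP.δ_pos; positivity) (by have := hP.δ_pos; positivity)]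
  congr 1
  field_simp
  norm_num

end Supermartingale

end FairOnline

/-! ### Monotone auditing schemes and the Lagrangian loss -/

namespace FairOnline

variable {X : Type u} {H : Finset (X → Bool)}

section Auditing

variable {k : ℕ}

theorem Scheme.violations_of_report {S : Scheme X k} {p : X → ℝ} {x : Fin k → X} {a : ℝ}
    {lr : Fin k × Fin k} (h : S.report p x a = some lr) : S.violations p x a lr.1 lr.2 = true := by
  unfold Scheme.report at h
  split_ifs at h with hex
  obtain rfl := Option.some.inj h
  exact S.pick_spec p a _ hex

theorem Scheme.report_eq_none_iff {S : Scheme X k} {p : X → ℝ} {x : Fin k → X} {a : ℝ} :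
    S.report p x a = none ↔ ∀ l r, S.violations p x a l r = false := by
  unfold Scheme.report
  split_ifs with hex
  · simp only [false_iff, not_forall, Bool.not_eq_false]
    exact hex
  · push Not at hex
    simpa using hex

theorem Round.unfair_eq_zero_iff {ρ : Round X k} {p : X → ℝ} {a : ℝ} :
    ρ.unfair p a = 0 ↔ ρ.scheme.report p ρ.x a = none := by
  unfold Round.unfair
  cases ρ.scheme.report p ρ.x a <;> simp

theorem Round.unfair_mem_Icc (ρ : Round X k) (p : X → ℝ) (a : ℝ) :
    ρ.unfair p a ∈ Set.Icc (0 : ℝ) 1 := by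
  unfold Round.unfair
  cases ρ.scheme.report p ρ.x a <;> simp

/-- A violation that appears when passing from one predictor to another is due to an auditor who
starts to object. -/
theorem Scheme.exists_new_objection {S : Scheme X k} (hS : S.agg.IsMonotone) {p p' : X → ℝ}
    {x : Fin k → X} {a a' : ℝ} {l r : Fin k} (h : S.violations p x a l r = true)
    (h' : S.violations p' x a' l r = false) :
    ∃ j, p (x l) - p (x r) > (S.panel j).dist (x l) (x r) + a ∧
      p' (x l) - p' (x r) ≤ (S.panel j).dist (x l) (x r) + a' := by
  obtain ⟨f, hf, hagg⟩ := hS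
  by_contra hcon
  push Not at hcon
  simp only [Scheme.violations, hagg] at h h'
  have := hf (a := fun j => (S.panel j).objections p x a l r)
    (b := fun j => (S.panel j).objections p' x a' l r) fun j => by
      simp only [Auditor.objections]
      intro hj
      exact decide_eq_true (hcon j (of_decide_eq_true hj))
  rw [h, h'] at this
  exact absurd (this rfl) (by simp)

/-- No auditor objects to vanishing differences at a nonnegative sensitivity. This makes the
constant classifier a fair comparator. -/
theorem Scheme.report_const {S : Scheme X k} (hS : S.agg.NoSpontaneous) (c : ℝ) (x : Fin k → X)
    {a : ℝ} (ha : 0 ≤ a) : S.report (fun _ => c) x a = none := by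
  rw [Scheme.report_eq_none_iff]
  have : (fun j => (S.panel j).objections (fun _ => c) x a) = fun _ _ _ => false := by
    funext j l r
    have := ((S.panel j).dist_mem (x l) (x r)).1
    simp only [Auditor.objections, sub_self, decide_eq_false_iff_not, not_lt, gt_iff_lt]
    linarith
  intro l r
  rw [Scheme.violations, this, hS]

end Auditing

section Loss

variable {k : ℕ}

theorem observedCost_label (b y : Bool) :
    (match oneSided (k := 1) (fun _ => y) (fun _ => b) 0 with
      | some y => if y = true then (0 : ℝ) else 2
      | none => 1) = (if b ≠ y then 1 else 0) + if y = true then 0 else 1 := by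
  cases b <;> cases y <;> (simp [oneSided]; try norm_num)

theorem roundCost_eq (lam : ℝ) (rep : Option (Fin k × Fin k)) (y : Fin k → Bool) (i : Fin k)
    (b : Bool) : roundCost lam rep y i b = ((if b ≠ y i then 1 else 0) + if y i = true then 0 else 1) / k
      + lam * (match rep with
    | some lr => (if i = lr.1 ∧ b = true then 1 else 0) + (if i = lr.2 ∧ b = false then 1 else 0)
    | none => 0) := by
  rw [← observedCost_label]
  rfl

/-- The round loss of a randomized classifier is its error plus the weighted unfairness proxy, up
to a constant. -/
theorem exists_sum_mul_roundLoss_eq (lam : ℝ) (rep : Option (Fin k × Fin k)) (x : Fin k → X)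
    (y : Fin k → Bool) (p' : X → ℝ) (β : ℝ) :
    ∃ K : ℝ, ∀ w ∈ stdSimplex ℝ H, ∑ h, w h * roundLoss lam rep x y h
      = error w x y / k + lam * unfairProxy x rep (mix w) p' β + K := by
  have hsplit : ∀ h : H, roundLoss lam rep x y h
      = (∑ i, (if h.1 (x i) ≠ y i then (1 : ℝ) else 0)) / k
        + (∑ i, if y i = true then (0 : ℝ) else 1) / k
        + lam * ∑ i, (match rep with
    | some lr => (if i = lr.1 ∧ h.1 (x i) = true then 1 else 0) +
        (if i = lr.2 ∧ h.1 (x i) = false then 1 else 0)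
    | none => 0 : ℝ) := fun h => by
    simp only [roundLoss, roundCost_eq]
    rw [Finset.sum_add_distrib, ← Finset.mul_sum, ← Finset.sum_div, Finset.sum_add_distrib, add_div]
    cases rep <;> rfl
  have herr : ∀ w : H → ℝ, ∑ h, w h * ((∑ i, (if h.1 (x i) ≠ y i then (1:ℝ) else 0)) / k)
      = error w x y / k := fun w => by
    rw [error, Finset.sum_div]
    exact Finset.sum_congr rfl fun h _ => by ring
  cases rep with
  | none =>
    refine ⟨(∑ i, if y i = true then (0 : ℝ) else 1) / k, fun w hw => ?_⟩
    simp only [hsplit, mul_add, Finset.sum_add_distrib, herr, ← Finset.sum_mul, hw.2, unfairProxy]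
    simp
  | some lr =>
    -- Charging a positive prediction at `lr.1` and a negative one at `lr.2` encodes the signed
    -- difference with nonnegative costs, at the price of the constant 1.
    have hpair : ∀ h : H, ∑ i, ((if i = lr.1 ∧ h.1 (x i) = true then 1 else 0) +
        (if i = lr.2 ∧ h.1 (x i) = false then 1 else 0) : ℝ)
        = (if h.1 (x lr.1) = true then 1 else 0) - (if h.1 (x lr.2) = true then 1 else 0) + 1 := by
      intro h
      rw [Finset.sum_add_distrib, Finset.sum_eq_single lr.1 (fun i _ hi => by simp [hi]) (by simp),
        Finset.sum_eq_single lr.2 (fun i _ hi => by simp [hi]) (by simp)]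
      cases h.1 (x lr.1) <;> cases h.1 (x lr.2) <;> simp
    refine ⟨(∑ i, if y i = true then (0 : ℝ) else 1) / k
      + lam * (1 + (p' (x lr.1) - p' (x lr.2)) - β), fun w hw => ?_⟩
    have hm : ∑ h, w h * (lam * ((if h.1 (x lr.1) = true then 1 else 0)
        - (if h.1 (x lr.2) = true then 1 else 0) + 1))
        = lam * (mix w (x lr.1) - mix w (x lr.2) + 1) := by
      have e : mix w (x lr.1) - mix w (x lr.2) + 1
          = mix w (x lr.1) - mix w (x lr.2) + ∑ h, w h := by rw [hw.2]
      rw [e, mix, mix, ← Finset.sum_sub_distrib, ← Finset.sum_add_distrib, Finset.mul_sum]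
      exact Finset.sum_congr rfl fun h _ => by ring
    simp only [hsplit, hpair]
    simp only [mul_add (w _), Finset.sum_add_distrib, herr, ← Finset.sum_mul, hw.2, hm, unfairProxy]
    ring

end Loss

/-! ### Regret and unfairness on the good event -/

section Rounds

variable {k T : ℕ} {erm : Batch X → H} {Q : Finset X} {P : Params}
  (adv : Adversary H P.R P.M k) (z : Tape Q P k T)

/-- The outcome of round `t`. -/
noncomputable def outcomeAt (t : Fin T) : Outcome H P.R P.M k :=
  outcomeOf P (stateAfter erm Q P adv (run erm P adv z t)).lam (adv (run erm P adv z t))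
    (drawsOf erm P (stateAfter erm Q P adv (run erm P adv z t)).hist (z t))

/-- The multiplier in round `t`. -/
noncomputable def lamAt (erm : Batch X → H) (t : ℕ) : ℝ :=
  (stateAfter erm Q P adv (run erm P adv z t)).lam

/-- The unfairness proxy loss of a predictor in round `t`. -/
noncomputable def proxyAt (erm : Batch X → H) (t : Fin T) (p : X → ℝ) : ℝ :=
  unfairProxy (roundAt erm P adv z t).x (outcomeAt (erm := erm) adv z t).report p
    (empirical (outcomeAt (erm := erm) adv z t).elicited) (P.ε / 2)

theorem run_succ (t : Fin T) :
    run erm P adv z (t + 1) = outcomeAt (erm := erm) adv z t :: run erm P adv z t := by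
  rw [run]
  simp only [t.2, dif_pos, nextRound_eval]
  rfl

theorem sum_le_sub_of_forall_le {T : ℕ} (a : ℕ → ℝ) (c : Fin T → ℝ)
    (h : ∀ t : Fin T, c t ≤ a (t + 1) - a t) : ∑ t, c t ≤ a T - a 0 := by
  refine (Finset.sum_le_sum fun t _ => h t).trans (le_of_eq ?_)
  rw [Fin.sum_univ_eq_sum_range fun t => a (t + 1) - a t, Finset.sum_range_sub]

theorem lamAt_succ (t : Fin T) : lamAt adv z erm (t + 1) = max 0 (lamAt adv z erm t + P.μ *
    (proxyAt adv z erm t (mix (policyAt erm P adv z t)) - P.μ * lamAt adv z erm t)) := by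
  rw [lamAt, run_succ]
  rfl

variable {δ θ : ℝ} (hP : P.Admissible k T Q.card δ θ) (hsep : IsSeparating H Q)
  (herm : IsERM erm)
include hP hsep herm

theorem policyAt_mem_stdSimplex (t : Fin T) : policyAt erm P adv z t ∈ stdSimplex ℝ H :=
  ftplPolicy_mem_stdSimplex hP.ω_pos hP.k_pos hsep herm _

theorem lamAt_mem_Icc (t : ℕ) : lamAt adv z erm t ∈ Set.Icc 0 (5 / 2 / P.μ) :=
  lam_mem_Icc erm Q P adv (ftplPolicy_mem_stdSimplex hP.ω_pos hP.k_pos hsep herm)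
    ⟨by rw [hP.ε_eq]; exact hP.α_pos.le, by rw [hP.ε_eq]; exact hP.α_le⟩ hP.μ_pos hP.μ_le _

/-- Regret of online gradient descent on the regularized Lagrangian. -/
theorem sum_sub_lam_mul_proxy_le {lam : ℝ} (hlam : 0 ≤ lam) :
    ∑ t : Fin T, (lam - lamAt adv z erm t) * proxyAt adv z erm t (mix (policyAt erm P adv z t))
      ≤ lam ^ 2 / (2 * P.μ) + T * (P.μ * (25 / 2 + lam ^ 2 / 2))
        - ∑ t : Fin T, P.μ * (lamAt adv z erm t ^ 2 / 2) := by
  have hμ := hP.μ_pos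
  -- The potential is minus the squared distance to `lam`, over 2μ.
  have key := sum_le_sub_of_forall_le (fun t => -(lamAt adv z erm t - lam) ^ 2 / (2 * P.μ))
    (fun t : Fin T => (lam - lamAt adv z erm t) * proxyAt adv z erm t (mix (policyAt erm P adv z t))
      - P.μ * (25 / 2 + lam ^ 2 / 2) + P.μ * (lamAt adv z erm t ^ 2 / 2)) fun t => ?_
  · rw [Finset.sum_add_distrib, Finset.sum_sub_distrib, Finset.sum_const, Finset.card_univ,
      Fintype.card_fin, nsmul_eq_mul] at key
    have h0 : lamAt adv z erm 0 = 0 := rfl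
    have h1 : -(lamAt adv z erm T - lam) ^ 2 / (2 * P.μ) ≤ 0 :=
      div_nonpos_of_nonpos_of_nonneg (by nlinarith [sq_nonneg (lamAt adv z erm T - lam)])
        (by positivity)
    have h2 : -(lamAt adv z erm 0 - lam) ^ 2 / (2 * P.μ) = -(lam ^ 2 / (2 * P.μ)) := by
      rw [h0]; ring
    simp only [h2] at key
    linarith
  · have hU := abs_unfairProxy_le (roundAt erm P adv z t).x (outcomeAt (erm := erm) adv z t).report
      (mix_mem_Icc (policyAt_mem_stdSimplex adv z hP hsep herm t))
      (empirical_mem_Icc (outcomeAt (erm := erm) adv z t).elicited) (β := P.ε / 2)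
      ⟨by rw [hP.ε_eq]; have := hP.α_pos; positivity, by rw [hP.ε_eq]; linarith [hP.α_le]⟩
    change |proxyAt adv z erm t (mix (policyAt erm P adv z t))| ≤ _ at hU
    obtain ⟨hl0, hl1⟩ := lamAt_mem_Icc adv z hP hsep herm t
    rw [lamAt_succ]
    set U := proxyAt adv z erm t (mix (policyAt erm P adv z t))
    set l := lamAt adv z erm t
    rw [le_div_iff₀ hμ] at hl1
    rw [abs_le] at hU
    -- Projection to the half-line does not increase the distance to its point `lam`.
    have hproj : (max 0 (l + P.μ * (U - P.μ * l)) - lam) ^ 2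
        ≤ (l + P.μ * (U - P.μ * l) - lam) ^ 2 := by
      rcases le_total 0 (l + P.μ * (U - P.μ * l)) with h | h
      · rw [max_eq_right h]
      · rw [max_eq_left h]; nlinarith
    -- Both |U| and μl are at most 5/2; hence the 25/2 in the bound.
    have hg : (U - P.μ * l) ^ 2 ≤ 5 ^ 2 :=
      sq_le_sq' (by nlinarith) (by nlinarith [mul_nonneg hμ.le hl0])
    have h1 : ((l - lam) ^ 2 - (l + P.μ * (U - P.μ * l) - lam) ^ 2) / (2 * P.μ)
        ≤ -(max 0 (l + P.μ * (U - P.μ * l)) - lam) ^ 2 / (2 * P.μ) - -(l - lam) ^ 2 / (2 * P.μ) := by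
      rw [← sub_div]
      exact div_le_div_of_nonneg_right (by linarith) (by positivity)
    refine le_trans ?_ h1
    have h2 : ((l - lam) ^ 2 - (l + P.μ * (U - P.μ * l) - lam) ^ 2) / (2 * P.μ)
        = (lam - l) * U - P.μ * (l * (lam - l)) - P.μ * ((U - P.μ * l) ^ 2 / 2) := by
      field_simp
      ring
    rw [h2]
    have h3 := mul_le_mul_of_nonneg_left hg hμ.le
    -- The strongly concave regularizer gives l(lam - l) ≤ lam²/2 - l²/2. The term -μl²/2 is kept in
    -- order to cancel the compensator of the supermartingale.
    have h4 := mul_nonneg hμ.le (sq_nonneg (lam - l))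
    nlinarith

/-- The regret of the deployed policies for the Lagrangian losses, when nothing failed. -/
theorem sum_roundLoss_sub_le (hgood : failureBound erm Q P adv δ θ (run erm P adv z T) < 1)
    (hQ : 0 < Q.card) {θ' : ℝ} (hθ' : 0 < θ')
    (hθ2 : θ' ^ 2 = P.ω ^ 2 / (4 * (Q.card * k : ℕ))) (f : H) :
    ∑ t : Fin T, (∑ h, policyAt erm P adv z t h * roundLoss (lamAt adv z erm t)
        (outcomeAt (erm := erm) adv z t).report (roundAt erm P adv z t).x (roundAt erm P adv z t).y h
      - roundLoss (lamAt adv z erm t)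
        (outcomeAt (erm := erm) adv z t).report (roundAt erm P adv z t).x (roundAt erm P adv z t).y f)
      ≤ Real.log (2 * H.card / δ) / θ + (Real.log H.card + 2) / θ'
        + ∑ t : Fin T, P.μ * (1 + lamAt adv z erm t ^ 2 / 2) := by
  have hθ := hP.θ_pos
  have hδ := hP.δ_pos
  have hH : 0 < (H.card : ℝ) := by exact_mod_cast Finset.card_pos.2 ⟨_, (erm 0).2⟩
  have hn : 0 < Q.card * k := Nat.mul_pos hQ hP.k_pos
  let hist : ℕ → Batch X := fun t => (stateAfter erm Q P adv (run erm P adv z t)).hist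
  -- This telescopes the potential of FTPL relative to `f` together with the gap process. Their
  -- increments add up to at least the true regret of the round minus the compensator.
  have key := sum_le_sub_of_forall_le (fun t => ftplPotential erm Q k P.ω (hist t)
      - batchCost (hist t) f + gapSum erm Q P adv θ f (run erm P adv z t) / θ)
    (fun t : Fin T => (∑ h, policyAt erm P adv z t h * roundLoss (lamAt adv z erm t)
        (outcomeAt (erm := erm) adv z t).report (roundAt erm P adv z t).x (roundAt erm P adv z t).y h
      - roundLoss (lamAt adv z erm t)
        (outcomeAt (erm := erm) adv z t).report (roundAt erm P adv z t).x (roundAt erm P adv z t).y f)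
      - P.μ * (1 + lamAt adv z erm t ^ 2 / 2)) fun t => ?_
  · rw [Finset.sum_sub_distrib] at key
    have h0 : hist 0 = 0 := rfl
    have h1 := ftplPotential_le hP.ω_pos herm hn (hist T) f hθ' hθ2
    have h2 := le_ftplPotential_zero hP.ω_pos hn hθ' hθ2 herm
    have h3 : gapSum erm Q P adv θ f (run erm P adv z T) / θ ≤ Real.log (2 * H.card / δ) / θ := by
      refine div_le_div_of_nonneg_right ?_ hθ.le
      -- Each summand of `failureBound` is below 1, so the bound holds for all comparators at once
      -- and the union over `H` costs only log |H|.
      have h4 : ENNReal.ofReal (δ / (2 * H.card)) *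
          ENNReal.ofReal (Real.exp (gapSum erm Q P adv θ f (run erm P adv z T))) < 1 := by
        refine lt_of_le_of_lt ?_ hgood
        refine le_trans ?_ le_self_add
        refine mul_le_mul_right ?_ _
        exact Finset.single_le_sum (f := fun f : H => ENNReal.ofReal
          (Real.exp (gapSum erm Q P adv θ f (run erm P adv z T)))) (fun _ _ => zero_le)
          (Finset.mem_univ f)
      rw [← ENNReal.ofReal_mul (by positivity), ENNReal.ofReal_lt_one] at h4
      rw [← Real.log_exp (gapSum erm Q P adv θ f (run erm P adv z T))]
      refine Real.log_le_log (Real.exp_pos _) ?_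
      rw [le_div_iff₀ hδ]
      rw [div_mul_eq_mul_div, div_lt_one (by positivity)] at h4
      linarith
    have h5 : gapSum erm Q P adv θ f (run erm P adv z 0) / θ = 0 := by
      rw [run, gapSum, zero_div]
    simp only [h0, h5, batchCost_zero] at key
    have h6 : (Real.log H.card + 2) / θ' = 1 / θ' + (Real.log H.card + 1) / θ' := by ring
    rw [h6]
    linarith
  · obtain ⟨hl0, -⟩ := lamAt_mem_Icc adv z hP hsep herm t
    have hhist : hist (t + 1) = hist t + (outcomeAt (erm := erm) adv z t).estimate := by
      simp only [hist, run_succ]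
      rfl
    have hgap : gapSum erm Q P adv θ f (run erm P adv z (t + 1)) / θ
        = gapSum erm Q P adv θ f (run erm P adv z t) / θ
          + (regretGap erm Q P adv (run erm P adv z t) (outcomeAt (erm := erm) adv z t) f
            - P.μ * (1 + lamAt adv z erm t ^ 2 / 2)) := by
      rw [run_succ, gapSum, add_div, mul_div_cancel_left₀ _ hθ.ne']
      rfl
    have hstab := one_sub_mul_sum_le_potential hP.ω_pos hP.k_pos hsep herm (hist t)
      (outcomeAt (erm := erm) adv z t).estimate (B := P.M * (2 + 2 * lamAt adv z erm t))
      fun h => batchCost_estimateOf_mem_Icc hP.k_pos hl0 _ _ _ _ _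
    rw [hgap, hhist, batchCost_add]
    have hreg : regretGap erm Q P adv (run erm P adv z t) (outcomeAt (erm := erm) adv z t) f
      = ∑ h, policyAt erm P adv z t h * roundLoss (lamAt adv z erm t)
        (outcomeAt (erm := erm) adv z t).report (roundAt erm P adv z t).x (roundAt erm P adv z t).y h
      - (1 - P.ω * (Q.card * (P.M * (2 + 2 * lamAt adv z erm t)))) *
        ∑ h : H, ftplPolicy erm Q k P.ω (hist t) h *
          batchCost (outcomeAt (erm := erm) adv z t).estimate h
      + batchCost (outcomeAt (erm := erm) adv z t).estimate f - roundLoss (lamAt adv z erm t)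
        (outcomeAt (erm := erm) adv z t).report (roundAt erm P adv z t).x (roundAt erm P adv z t).y f :=
      rfl
    rw [hreg]
    linarith

omit hP hsep herm in
-- The number of bad rounds never decreases, so a single one would already force `failureBound` to
-- be at least 1.
theorem abs_mix_sub_empirical_lt
    (hgood : failureBound erm Q P adv δ θ (run erm P adv z T) < 1) (t : Fin T) (i : Fin k) :
    |mix (policyAt erm P adv z t) ((roundAt erm P adv z t).x i)
      - empirical (outcomeAt (erm := erm) adv z t).elicited ((roundAt erm P adv z t).x i)|
      < P.α / 8 := by
  classical
  by_contra hcon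
  have hmis : Misrepresented erm Q P adv (run erm P adv z t) (outcomeAt (erm := erm) adv z t) :=
    ⟨i, not_lt.1 hcon⟩
  have hmono : ∀ n : ℕ, (t : ℕ) + 1 + n ≤ T → 1 ≤ badRounds erm Q P adv (run erm P adv z (t + 1 + n)) := by
    intro n
    induction n with
    | zero =>
      intro _
      rw [add_zero, run_succ, badRounds, if_pos hmis]
      exact le_add_self
    | succ n ih =>
      intro hn
      rw [show (t : ℕ) + 1 + (n + 1) = ((⟨t + 1 + n, by omega⟩ : Fin T) : ℕ) + 1 from rfl, run_succ,
        badRounds]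
      exact (ih (by omega)).trans le_self_add
  have h1 := hmono (T - (t + 1)) (by have := t.2; omega)
  rw [show (t : ℕ) + 1 + (T - (t + 1)) = T by have := t.2; omega] at h1
  exact absurd (h1.trans le_add_self) (not_le.2 hgood)

omit hsep herm in
-- Differences over pairs are represented up to α/4. If a pair is reported, the proxy is at least
-- -α/4 + ε/2 = α/4, whether or not the deployed policy violates that pair. If none is, an
-- α-violation would need an auditor whose gap drops by more than α/2 between the deployed and the
-- elicited policy.
theorem unfair_mul_le_proxyAt (hmon : ∀ past, (adv past).scheme.agg.IsMonotone)
    (hgood : failureBound erm Q P adv δ θ (run erm P adv z T) < 1) (t : Fin T) :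
    P.α / 4 * (roundAt erm P adv z t).unfair (mix (policyAt erm P adv z t)) P.α
      ≤ proxyAt adv z erm t (mix (policyAt erm P adv z t)) := by
  have hα := hP.α_pos
  have hclose := abs_mix_sub_empirical_lt adv z hgood t
  have hdiff : ∀ l r, |(mix (policyAt erm P adv z t) ((roundAt erm P adv z t).x l)
      - mix (policyAt erm P adv z t) ((roundAt erm P adv z t).x r))
      - (empirical (outcomeAt (erm := erm) adv z t).elicited ((roundAt erm P adv z t).x l)
      - empirical (outcomeAt (erm := erm) adv z t).elicited ((roundAt erm P adv z t).x r))|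
      ≤ P.α / 4 := fun l r => by
    have h1 := abs_lt.1 (hclose l)
    have h2 := abs_lt.1 (hclose r)
    rw [abs_le]
    constructor <;> linarith [h1.1, h1.2, h2.1, h2.2]
  cases hrep : (outcomeAt (erm := erm) adv z t).report with
  | some lr =>
    simp only [proxyAt, hrep, unfairProxy]
    have h1 := (abs_le.1 (hdiff lr.1 lr.2)).1
    have h2 := ((roundAt erm P adv z t).unfair_mem_Icc (mix (policyAt erm P adv z t)) P.α).2
    rw [hP.ε_eq]
    nlinarith
  | none =>
    have h0 : (roundAt erm P adv z t).unfair (mix (policyAt erm P adv z t)) P.α = 0 := by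
      rw [Round.unfair_eq_zero_iff, Scheme.report_eq_none_iff]
      intro l r
      by_contra hv
      rw [Bool.not_eq_false] at hv
      have h2 := Scheme.report_eq_none_iff.1
        (show (roundAt erm P adv z t).scheme.report (empirical (outcomeAt (erm := erm) adv z t).elicited)
          (roundAt erm P adv z t).x (P.α - P.ε / 2) = none from hrep) l r
      obtain ⟨j, hj1, hj2⟩ := Scheme.exists_new_objection (hmon _) hv h2
      have h3 := (abs_le.1 (hdiff l r)).2
      rw [hP.ε_eq] at hj2
      linarith
    simp only [proxyAt, hrep, unfairProxy, h0, mul_zero]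
    exact le_rfl

omit hsep herm in
-- On the reported pair some auditor j objects to the elicited policy at sensitivity α/2 but not to
-- π at 0. The gap of the former exceeds d_j + α/2 and that of the latter is at most d_j, so adding
-- ε/2 = α/2 leaves the proxy negative. Accuracy of the elicited policy is not needed here.
theorem proxyAt_nonpos_of_fair (hmon : ∀ past, (adv past).scheme.agg.IsMonotone) (t : Fin T)
    {π : H → ℝ} (hπ : (roundAt erm P adv z t).unfair (mix π) 0 = 0) :
    proxyAt adv z erm t (mix π) ≤ 0 := by
  cases hrep : (outcomeAt (erm := erm) adv z t).report with
  | none => simp [proxyAt, hrep, unfairProxy]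
  | some lr =>
    have h1 := Scheme.violations_of_report
      (show (roundAt erm P adv z t).scheme.report (empirical (outcomeAt (erm := erm) adv z t).elicited)
        (roundAt erm P adv z t).x (P.α - P.ε / 2) = some lr from hrep)
    rw [Round.unfair_eq_zero_iff, Scheme.report_eq_none_iff] at hπ
    obtain ⟨j, hj1, hj2⟩ := Scheme.exists_new_objection (hmon _) h1 (hπ lr.1 lr.2)
    simp only [proxyAt, hrep, unfairProxy]
    rw [hP.ε_eq] at hj1 ⊢
    linarith

/-- The trade-off between regret and unfairness. -/
theorem sum_error_add_lam_mul_le (hmon : ∀ past, (adv past).scheme.agg.IsMonotone)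
    (hgood : failureBound erm Q P adv δ θ (run erm P adv z T) < 1)
    (hQ : 0 < Q.card) {θ' : ℝ} (hθ' : 0 < θ')
    (hθ2 : θ' ^ 2 = P.ω ^ 2 / (4 * (Q.card * k : ℕ))) {lam : ℝ} (hlam : 0 ≤ lam)
    {π : H → ℝ} (hπ : π ∈ fairPolicies erm P adv z 0) :
    (∑ t : Fin T, error (policyAt erm P adv z t) (roundAt erm P adv z t).x (roundAt erm P adv z t).y
        - ∑ t : Fin T, error π (roundAt erm P adv z t).x (roundAt erm P adv z t).y) / k
      + lam * (P.α / 4 * violationCount erm P adv z P.α)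
      ≤ Real.log (2 * H.card / δ) / θ + (Real.log H.card + 2) / θ'
        + lam ^ 2 / (2 * P.μ) + T * (P.μ * (27 / 2 + lam ^ 2 / 2)) := by
  obtain ⟨hπs, hfair⟩ := hπ
  set B := Real.log (2 * H.card / δ) / θ + (Real.log H.card + 2) / θ' with hB
  set U : Fin T → ℝ := fun t => proxyAt adv z erm t (mix (policyAt erm P adv z t)) with hU
  have hreg : ∑ t : Fin T, (∑ h, policyAt erm P adv z t h * roundLoss (lamAt adv z erm t)
        (outcomeAt (erm := erm) adv z t).report (roundAt erm P adv z t).x (roundAt erm P adv z t).y h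
      - ∑ f, π f * roundLoss (lamAt adv z erm t)
        (outcomeAt (erm := erm) adv z t).report (roundAt erm P adv z t).x (roundAt erm P adv z t).y f)
      ≤ B + ∑ t : Fin T, P.μ * (1 + lamAt adv z erm t ^ 2 / 2) := by
    -- The losses are linear in the policy, so averaging the bounds for pure comparators with
    -- weights π gives the one for π.
    have h1 := Finset.sum_le_sum fun f (_ : f ∈ (Finset.univ : Finset H)) => mul_le_mul_of_nonneg_left
      (sum_roundLoss_sub_le adv z hP hsep herm hgood hQ hθ' hθ2 f) (hπs.1 f)
    rw [← Finset.sum_mul, hπs.2, one_mul] at h1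
    refine le_trans (le_of_eq ?_) h1
    simp_rw [Finset.mul_sum]
    rw [Finset.sum_comm]
    refine Finset.sum_congr rfl fun t _ => ?_
    simp_rw [mul_sub]
    rw [Finset.sum_sub_distrib, ← Finset.sum_mul, hπs.2, one_mul]
  have hround : ∀ t : Fin T, (error (policyAt erm P adv z t) (roundAt erm P adv z t).x
        (roundAt erm P adv z t).y - error π (roundAt erm P adv z t).x (roundAt erm P adv z t).y) / k
      + lamAt adv z erm t * U t
      ≤ ∑ h, policyAt erm P adv z t h * roundLoss (lamAt adv z erm t)
        (outcomeAt (erm := erm) adv z t).report (roundAt erm P adv z t).x (roundAt erm P adv z t).y h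
      - ∑ f, π f * roundLoss (lamAt adv z erm t)
        (outcomeAt (erm := erm) adv z t).report (roundAt erm P adv z t).x (roundAt erm P adv z t).y f := by
    intro t
    obtain ⟨K, hK⟩ := exists_sum_mul_roundLoss_eq (H := H) (lamAt adv z erm t)
      (outcomeAt (erm := erm) adv z t).report (roundAt erm P adv z t).x (roundAt erm P adv z t).y
      (empirical (outcomeAt (erm := erm) adv z t).elicited) (P.ε / 2)
    rw [hK _ (policyAt_mem_stdSimplex adv z hP hsep herm t), hK _ hπs]
    have h1 := mul_nonpos_of_nonneg_of_nonpos (lamAt_mem_Icc adv z hP hsep herm t).1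
      (proxyAt_nonpos_of_fair adv z hP hmon t (hfair t))
    simp only [proxyAt] at h1
    simp only [hU, proxyAt, sub_div]
    linarith
  have hsum := (Finset.sum_le_sum fun t (_ : t ∈ Finset.univ) => hround t).trans hreg
  rw [Finset.sum_add_distrib, ← Finset.sum_div, Finset.sum_sub_distrib] at hsum
  have hogd := sum_sub_lam_mul_proxy_le adv z hP hsep herm hlam
  change ∑ t : Fin T, (lam - lamAt adv z erm t) * U t ≤ _ at hogd
  simp_rw [sub_mul] at hogd
  rw [Finset.sum_sub_distrib, ← Finset.mul_sum] at hogd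
  have hviol : P.α / 4 * violationCount erm P adv z P.α ≤ ∑ t, U t := by
    rw [violationCount, Finset.mul_sum]
    exact Finset.sum_le_sum fun t _ => unfair_mul_le_proxyAt adv z hP hmon hgood t
  have hviol' := mul_le_mul_of_nonneg_left hviol hlam
  -- The λ² part cancels against gradient ascent; the rest raises 25/2 to 27/2.
  have hmu : ∑ t : Fin T, P.μ * (1 + lamAt adv z erm t ^ 2 / 2)
      = T * P.μ + ∑ t : Fin T, P.μ * (lamAt adv z erm t ^ 2 / 2) := by
    simp_rw [mul_add]
    rw [Finset.sum_add_distrib]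
    simp
  rw [hmu] at hsum
  linarith

end Rounds
end FairOnline

/-! ### Numerical constants and the chosen parameters -/

namespace FairOnline

section Numerics

variable {k T s : ℕ} {α δ : ℝ}

theorem exp_one_bounds : 2.7 ≤ Real.exp 1 ∧ Real.exp 1 ≤ 2.72 :=
  ⟨by linarith [Real.exp_one_gt_d9], by linarith [Real.exp_one_lt_d9]⟩

theorem stepSize_mem (hT : 1 ≤ T) : (T : ℝ) ^ (-(1 / 3) : ℝ) ∈ Set.Ioc (0 : ℝ) 1 := by
  have hT' : (1 : ℝ) ≤ T := by exact_mod_cast hT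
  exact ⟨by positivity, Real.rpow_le_one_of_one_le_of_nonpos hT' (by norm_num)⟩

theorem log_count_pos (hk : 1 ≤ k) (hT : 1 ≤ T) (hδ : 0 < δ) (hδ1 : δ ≤ 1) :
    Real.log 2 ≤ Real.log (2 * k * T / δ) := by
  refine Real.log_le_log two_pos ?_
  have hk' : (1 : ℝ) ≤ k := by exact_mod_cast hk
  have hT' : (1 : ℝ) ≤ T := by exact_mod_cast hT
  rw [le_div_iff₀ hδ]
  have : (1 : ℝ) ≤ k * T := one_le_mul_of_one_le_of_one_le hk' hT'
  nlinarith

theorem two_mul_exp_elicit_le (hk : 1 ≤ k) (hT : 1 ≤ T) (hα : 0 < α) (hδ : 0 < δ) (hδ1 : δ ≤ 1)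
    {R : ℝ} (hR : 64 * α ^ (-2 : ℤ) * Real.log (2 * k * T / δ) ≤ R) :
    k * (2 * Real.exp (-(2 * R * (α / 8) ^ 2))) ≤ δ / (2 * T) := by
  have hk' : (1 : ℝ) ≤ k := by exact_mod_cast hk
  have hT' : (1 : ℝ) ≤ T := by exact_mod_cast hT
  have h1 : 2 * Real.log (2 * k * T / δ) ≤ 2 * R * (α / 8) ^ 2 := by
    have e : 2 * Real.log (2 * k * T / δ)
        = 2 * (64 * α ^ (-2 : ℤ) * Real.log (2 * k * T / δ)) * (α / 8) ^ 2 := by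
      rw [zpow_neg]
      norm_cast
      field_simp
      norm_num
    rw [e]
    gcongr
  have h2 : Real.exp (-(2 * R * (α / 8) ^ 2)) ≤ (δ / (2 * k * T)) ^ 2 := by
    calc _ ≤ Real.exp (-(2 * Real.log (2 * k * T / δ))) := Real.exp_le_exp.2 (by linarith)
      _ = _ := by
        rw [← mul_neg, ← Real.log_inv, inv_div, ← Nat.cast_ofNat (R := ℝ) (n := 2), Real.exp_nat_mul,
          Real.exp_log (by positivity)]
  calc k * (2 * Real.exp (-(2 * R * (α / 8) ^ 2))) ≤ k * (2 * (δ / (2 * k * T)) ^ 2) := by gcongr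
    _ = δ / (2 * T) * (δ / (k * T)) := by field_simp
    _ ≤ δ / (2 * T) * 1 := by
      gcongr
      rw [div_le_one (by positivity)]
      have : (1 : ℝ) ≤ k * T := one_le_mul_of_one_le_of_one_le hk' hT'
      linarith
    _ = _ := mul_one _

theorem drift_le {κ μ M e l ωs θ : ℝ} (hκ : 1 ≤ κ) (hμ : 0 < μ) (hμ1 : μ ≤ 1)
    (he : 2.7 ≤ e ∧ e ≤ 2.72) (hM : 16 * κ / (μ * e) ≤ M) (hM1 : M ≤ 16 * κ / (μ * e) + 1)
    (hω : ωs = μ ^ 2 * e / (512 * κ ^ 4)) (hθ : θ = μ ^ 2 / (5040 * κ)) (hl : 0 ≤ l)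
    (hl1 : l ≤ 5 / 2 / μ) :
    ωs * (M * (2 + 2 * l)) ≤ 1 ∧ θ * ((1 + M) * (2 + 2 * l)) ≤ 1 ∧
      ωs * (M * (2 + 2 * l)) * (2 + 2 * l) + 2 * (2 + 2 * l) / (e * M)
        + 9 * θ * M * (2 + 2 * l) ^ 2 ≤ μ * (1 + l ^ 2 / 2) := by
  obtain ⟨he1, he2⟩ := he
  have he0 : 0 < e := by linarith
  have hκ0 : 0 < κ := by linarith
  have hM0 : 0 < M := lt_of_lt_of_le (by positivity) hM
  -- 16/e ≤ 6, and rounding up adds at most μ ≤ 1 ≤ κ.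
  have hμM : μ * M ≤ 7 * κ := by
    have h1 : μ * M ≤ μ * (16 * κ / (μ * e) + 1) := by gcongr
    have h2 : μ * (16 * κ / (μ * e) + 1) = 16 / e * κ + μ := by field_simp
    have h3 : 16 / e ≤ 6 := by rw [div_le_iff₀ he0]; linarith
    nlinarith
  have hMge : 1 ≤ M := by
    refine le_trans ?_ hM
    rw [le_div_iff₀ (by positivity)]
    nlinarith
  have heM : 16 * κ / μ ≤ e * M := by
    have : e * (16 * κ / (μ * e)) = 16 * κ / μ := by field_simp
    rw [← this]; gcongr
  have hμS : μ * (2 + 2 * l) ≤ 7 := by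
    rw [le_div_iff₀ hμ] at hl1
    linarith
  set S := 2 + 2 * l with hS
  have hS0 : 0 ≤ S := by positivity
  have h4 : κ ≤ κ ^ 4 := le_self_pow₀ hκ (by norm_num)
  have hωM : ωs * (M * S) ≤ 19.1 / 512 * (μ * S) := by
    have e1 : ωs * (M * S) = (e * (μ * M)) / (512 * κ ^ 4) * (μ * S) := by rw [hω]; field_simp
    have e2 : e * (μ * M) ≤ 2.72 * (7 * κ) := by gcongr
    rw [e1]
    refine mul_le_mul_of_nonneg_right ?_ (by positivity)
    rw [div_le_div_iff₀ (by positivity) (by norm_num)]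
    linarith
  have hθM : θ * M ≤ μ / 720 := by
    have e1 : θ * M = μ * (μ * M) / (5040 * κ) := by rw [hθ]; ring
    rw [e1, div_le_div_iff₀ (by positivity) (by norm_num)]
    nlinarith
  have hθ0 : 0 ≤ θ := by rw [hθ]; positivity
  refine ⟨by linarith, ?_, ?_⟩
  · calc θ * ((1 + M) * S) ≤ θ * ((M + M) * S) := by gcongr
      _ = 2 * (θ * M) * S := by ring
      _ ≤ 2 * (μ / 720) * S := by gcongr
      _ ≤ 1 := by linarith
  · have t1 : ωs * (M * S) * S ≤ 19.1 / 512 * (μ * S) * S := by gcongr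
    have t2 : 2 * S / (e * M) ≤ μ * S / 8 := by
      calc 2 * S / (e * M) ≤ 2 * S / (16 * κ / μ) := by gcongr
        _ = μ * S / (8 * κ) := by field_simp; ring
        _ ≤ μ * S / 8 := by gcongr; linarith
    have t3 : 9 * θ * M * S ^ 2 ≤ μ / 80 * S ^ 2 := by
      have : 9 * θ * M ≤ μ / 80 := by linarith
      gcongr
    have t4 : (19.1 / 512 + 1 / 80) * S ^ 2 + S / 8 ≤ 1 + l ^ 2 / 2 := by
      -- The three coefficients come from stability, second moment and bias. The constants 512, 5040
      -- and 16 in ω, θ and M keep them small enough for the quadratic in `l` to stay below 1 +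
      -- l²/2.
      rw [hS]; nlinarith [sq_nonneg (l - 1)]
    have t5 := mul_le_mul_of_nonneg_left t4 hμ.le
    linarith

end Numerics

section Chosen

variable {k T s : ℕ} {α δ : ℝ}

theorem chosenParams_admissible (hk : 1 ≤ k) (hT : 1 ≤ T) (hs : 1 ≤ s) (hα : 0 < α) (hα1 : α ≤ 1)
    (hδ : 0 < δ) (hδ1 : δ ≤ 1) :
    (chosenParams k T s α δ).Admissible k T s δ (((T : ℝ) ^ (-(1 / 3) : ℝ)) ^ 2 / (5040 * k)) := by
  have hk' : (1 : ℝ) ≤ k := by exact_mod_cast hk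
  have hs' : (1 : ℝ) ≤ s := by exact_mod_cast hs
  obtain ⟨hμ0, hμ1⟩ := stepSize_mem hT
  have hlog := log_count_pos hk hT hδ hδ1
  have hlog2 : 0 < Real.log 2 := Real.log_pos one_lt_two
  have hM : 0 < 16 * k / ((T : ℝ) ^ (-(1 / 3) : ℝ) * Real.exp 1) := by positivity
  have hd := fun l (hl : 0 ≤ l) hl1 => drift_le (M := (chosenParams k T s α δ).M)
    (ωs := (chosenParams k T s α δ).ω * s) hk' hμ0 hμ1 exp_one_bounds (Nat.le_ceil _)
    (Nat.ceil_lt_add_one hM.le).le (by simp only [chosenParams]; field_simp) rfl hl hl1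
  exact
  { k_pos := hk
    T_pos := hT
    δ_pos := hδ
    θ_pos := by positivity
    α_pos := hα
    α_le := hα1
    ε_eq := rfl
    μ_pos := hμ0
    μ_le := hμ1
    ω_pos := by simp only [chosenParams]; positivity
    R_pos := Nat.ceil_pos.2 (mul_pos (by positivity) (hlog2.trans_le hlog))
    M_pos := Nat.ceil_pos.2 hM
    stable := fun l hl hl1 => by rw [← mul_assoc]; exact (hd l hl hl1).1
    scale := fun l hl hl1 => (hd l hl hl1).2.1
    drift := fun l hl hl1 => by rw [← mul_assoc (Params.ω _)]; exact (hd l hl hl1).2.2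
    elicit := two_mul_exp_elicit_le hk hT hα hδ hδ1 (Nat.le_ceil _) }

theorem chosenParams_calls_le (hk : 1 ≤ k) (hT : 1 ≤ T) (hα : 0 < α)
    (hδ : 0 < δ) (hδ1 : δ ≤ 1) :
    (((chosenParams k T s α δ).R + 1 + k * (chosenParams k T s α δ).M : ℕ) : ℝ)
      ≤ 100000 * (α ^ (-2 : ℤ) * Real.log (2 * k * T / δ) + (k : ℝ) ^ 2 * (T : ℝ) ^ (1 / 3 : ℝ)) := by
  have hk' : (1 : ℝ) ≤ k := by exact_mod_cast hk
  have hT' : (1 : ℝ) ≤ T := by exact_mod_cast hT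
  have hlog := log_count_pos hk hT hδ hδ1
  have hlog2 : 0 < Real.log 2 := Real.log_pos one_lt_two
  have hτ : (1 : ℝ) ≤ (T : ℝ) ^ (1 / 3 : ℝ) := Real.one_le_rpow hT' (by norm_num)
  have hμ : (T : ℝ) ^ (-(1 / 3) : ℝ) = ((T : ℝ) ^ (1 / 3 : ℝ))⁻¹ := Real.rpow_neg (by positivity) _
  obtain ⟨he1, he2⟩ := exp_one_bounds
  set τ := (T : ℝ) ^ (1 / 3 : ℝ)
  have hA : 0 ≤ α ^ (-2 : ℤ) * Real.log (2 * k * T / δ) :=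
    mul_nonneg (by positivity) (hlog2.trans_le hlog).le
  have hR : ((chosenParams k T s α δ).R : ℝ) ≤ 64 * (α ^ (-2 : ℤ) * Real.log (2 * k * T / δ)) + 1 := by
    have := (Nat.ceil_lt_add_one (a := 64 * α ^ (-2 : ℤ) * Real.log (2 * k * T / δ))
      (by linarith)).le
    rw [← mul_assoc]
    exact this
  have hM : ((chosenParams k T s α δ).M : ℝ) ≤ 6 * (k * τ) + 1 := by
    have h1 := (Nat.ceil_lt_add_one (a := 16 * k / ((T : ℝ) ^ (-(1 / 3) : ℝ) * Real.exp 1))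
      (by positivity)).le
    refine le_trans h1 ?_
    rw [hμ]
    have : 16 * k / (τ⁻¹ * Real.exp 1) = 16 / Real.exp 1 * (k * τ) := by field_simp
    rw [this]
    have : 16 / Real.exp 1 ≤ 6 := by rw [div_le_iff₀ (by positivity)]; linarith
    gcongr
  push_cast
  have hkM : k * ((chosenParams k T s α δ).M : ℝ) ≤ k * (6 * (k * τ) + 1) := by gcongr
  have h1 : (k : ℝ) ≤ k ^ 2 := le_self_pow₀ hk' two_ne_zero
  have h2 : (k : ℝ) ^ 2 ≤ k ^ 2 * τ := le_mul_of_one_le_right (by positivity) hτ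
  nlinarith

/-- The final estimates, with all exponents made integral. -/
theorem final_bounds {κ σ τ α a b e D V : ℝ} (hκ : 1 ≤ κ) (hσ : 1 ≤ σ) (hτ : 1 ≤ τ) (hα : 0 < α)
    (ha : Real.log 2 ≤ a) (hb : Real.log 2 ≤ b) (he : 2.7 ≤ e) (hD : -(κ ^ 2 * τ ^ 6) ≤ D)
    (h : ∀ l : ℝ, 0 ≤ l → D / κ ^ 2 + l * (α / 4 * V) ≤
      (a + b) * (5040 * κ ^ 2 * τ ^ 4) + (a + 2) * (1024 * (σ ^ 3 * κ ^ 9) * τ ^ 4 / e)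
        + l ^ 2 * τ ^ 2 / 2 + τ ^ 4 * (27 / 2 + l ^ 2 / 2)) :
    D ≤ 100000 * σ ^ 3 * κ ^ 11 * τ ^ 4 * a * b ∧ V ≤ 100000 * α⁻¹ * σ ^ 3 * κ ^ 9 * τ ^ 5 * a * b := by
  have hl2 : 0.69 ≤ Real.log 2 := by linarith [Real.log_two_gt_d9]
  have ha0 : 0.69 ≤ a := hl2.trans ha
  have hb0 : 0.69 ≤ b := hl2.trans hb
  set L := a * b with hL
  have hab : a + b ≤ 3 * L := by nlinarith
  have ha2 : a + 2 ≤ 6 * L := by nlinarith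
  have h1L : 1 ≤ 3 * L := by nlinarith
  set W := σ ^ 3 * κ ^ 9 with hW
  have hσ3 : 1 ≤ σ ^ 3 := one_le_pow₀ hσ
  have hW1 : κ ^ 2 ≤ W := by
    calc κ ^ 2 ≤ κ ^ 9 := pow_le_pow_right₀ hκ (by norm_num)
      _ ≤ W := le_mul_of_one_le_left (by positivity) hσ3
  have hκ2 : 1 ≤ κ ^ 2 := one_le_pow₀ hκ
  have hWone : 1 ≤ W := hκ2.trans hW1
  have hL0 : 0 ≤ L := by linarith
  have hτ0 : 0 < τ := by linarith
  have hbase : (a + b) * (5040 * κ ^ 2 * τ ^ 4) + (a + 2) * (1024 * W * τ ^ 4 / e)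
      + τ ^ 4 * (27 / 2) ≤ 18000 * (W * L * τ ^ 4) := by
    have t1 : (a + b) * (5040 * κ ^ 2 * τ ^ 4) ≤ 3 * L * (5040 * W * τ ^ 4) := by gcongr
    have t2 : (a + 2) * (1024 * W * τ ^ 4 / e) ≤ 6 * L * (1024 * W * τ ^ 4 / 2.7) := by gcongr
    have t3 : 1 ≤ 3 * (W * L) := by nlinarith
    have t4 : τ ^ 4 * 1 ≤ τ ^ 4 * (3 * (W * L)) := by gcongr
    have t5 : 0 ≤ W * L * τ ^ 4 := by positivity
    have t6 : 3 * L * (5040 * W * τ ^ 4) = 15120 * (W * L * τ ^ 4) := by ring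
    have t7 : 6 * L * (1024 * W * τ ^ 4 / 2.7) = 6144 / 2.7 * (W * L * τ ^ 4) := by ring
    have t8 : τ ^ 4 * (3 * (W * L)) = 3 * (W * L * τ ^ 4) := by ring
    rw [t6] at t1
    rw [t7] at t2
    rw [t8] at t4
    linarith
  constructor
  · have h0 := h 0 le_rfl
    have h1 : D / κ ^ 2 ≤ 18000 * (W * L * τ ^ 4) := by linarith
    rw [div_le_iff₀ (by positivity)] at h1
    have h2 : 100000 * σ ^ 3 * κ ^ 11 * τ ^ 4 * a * b = 100000 * (W * L * τ ^ 4) * κ ^ 2 := by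
      rw [hW, hL]; ring
    rw [h2]
    refine h1.trans ?_
    gcongr
    norm_num
  -- At l = T^(1/6) the term l²τ⁴ has the order τ⁶ = T of the trivial bound on -D/κ²; dividing by l
  -- leaves τ⁵ = T^(5/6).
  · have h1 := h τ hτ0.le
    have h2 : -(τ ^ 6) ≤ D / κ ^ 2 := by
      rw [le_div_iff₀ (by positivity)]; linarith
    have h46 : τ ^ 4 ≤ τ ^ 6 := pow_le_pow_right₀ hτ (by norm_num)
    have t3 : 1 ≤ 3 * (W * L) := by nlinarith
    have t4 : τ ^ 6 * 1 ≤ τ ^ 6 * (3 * (W * L)) := by gcongr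
    have t5 : W * L * τ ^ 4 ≤ W * L * τ ^ 6 := by gcongr
    have t6 : 0 ≤ W * L * τ ^ 6 := by positivity
    have h3 : τ * (α / 4 * V) ≤ 18100 * (W * L * τ ^ 6) := by nlinarith
    have h4 : 100000 * α⁻¹ * σ ^ 3 * κ ^ 9 * τ ^ 5 * a * b = 100000 * (W * L * τ ^ 5) / α := by
      rw [hW, hL]; field_simp
    rw [h4, le_div_iff₀ hα]
    have h5 : τ * (V * α) ≤ τ * (100000 * (W * L * τ ^ 5)) := by nlinarith
    exact le_of_mul_le_mul_left h5 hτ0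

end Chosen

end FairOnline

/-! ### Nonemptiness of the fair class and the one-hypothesis case -/

namespace FairOnline

variable {X : Type u} {H : Finset (X → Bool)} {k T : ℕ} {erm : Batch X → H} {Q : Finset X}
  {P : Params} (adv : Adversary H P.R P.M k) (z : Tape Q P k T)

theorem fairPolicies_nonempty (hconst : HasConstant H)
    (hnull : ∀ past, (adv past).scheme.agg.NoSpontaneous) :
    (fairPolicies erm P adv z 0).Nonempty := by
  classical
  obtain ⟨b, hb⟩ := hconst
  refine ⟨Pi.single ⟨_, hb⟩ 1, single_mem_stdSimplex ℝ _, fun t => ?_⟩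
  have : mix (Pi.single (⟨_, hb⟩ : H) (1 : ℝ)) = fun _ => if b = true then 1 else 0 := by
    funext x
    rw [mix, Finset.sum_eq_single ⟨_, hb⟩ (fun h _ hne => by simp [hne]) (by simp)]
    simp
  rw [this, Round.unfair_eq_zero_iff]
  exact Scheme.report_const (hnull _) _ _ le_rfl

theorem error_mem_Icc {π : H → ℝ} (hπ : π ∈ stdSimplex ℝ H) (x : Fin k → X) (y : Fin k → Bool) :
    error π x y ∈ Set.Icc (0 : ℝ) k := by
  have h0 : ∀ h : H, (∑ i, (if h.1 (x i) ≠ y i then (1 : ℝ) else 0)) ∈ Set.Icc (0 : ℝ) k := fun h => by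
    refine ⟨Finset.sum_nonneg fun i _ => by split_ifs <;> norm_num, ?_⟩
    calc _ ≤ ∑ _i : Fin k, (1 : ℝ) := Finset.sum_le_sum fun i _ => by split_ifs <;> norm_num
      _ = k := by simp
  refine ⟨Finset.sum_nonneg fun h _ => mul_nonneg (hπ.1 h) (h0 h).1, ?_⟩
  calc error π x y ≤ ∑ h, π h * k :=
        Finset.sum_le_sum fun h _ => mul_le_mul_of_nonneg_left (h0 h).2 (hπ.1 h)
    _ = k := by rw [← Finset.sum_mul, hπ.2, one_mul]

theorem regret_le {U : Set (H → ℝ)} (hU : U.Nonempty) {B : ℝ}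
    (h : ∀ π ∈ U, ∑ t : Fin T, error (policyAt erm P adv z t) (roundAt erm P adv z t).x
        (roundAt erm P adv z t).y
      - ∑ t : Fin T, error π (roundAt erm P adv z t).x (roundAt erm P adv z t).y ≤ B) :
    regret erm P adv z U ≤ B := by
  rw [regret, sub_le_comm]
  refine le_csInf (hU.image _) ?_
  rintro _ ⟨π, hπ, rfl⟩
  linarith [h π hπ]

/-- For empty `Q` the chosen ω is a division by zero, hence 0, but the noise space is a single point
and the law is still a probability. -/
theorem isProbabilityMeasure_tapeLaw (h : Q.card = 0 ∨ 0 < P.ω) :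
    IsProbabilityMeasure (tapeLaw Q P k T) ∧ IsProbabilityMeasure (noiseLaw Q k P.ω) := by
  have : IsProbabilityMeasure (noiseLaw Q k P.ω) := by
    rcases h with h | h
    · have : IsEmpty Q := by rw [Finset.card_eq_zero] at h; subst h; infer_instance
      rw [noiseLaw, Measure.pi_of_empty]
      infer_instance
    · exact isProbabilityMeasure_noiseLaw h
  refine ⟨?_, this⟩
  unfold tapeLaw
  infer_instance

/-- With a single hypothesis there is neither regret nor unfairness. -/
theorem regret_and_violationCount_nonpos_of_subsingleton [Subsingleton H]
    (hprob : IsProbabilityMeasure (noiseLaw Q k P.ω)) (hconst : HasConstant H)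
    (hnull : ∀ past, (adv past).scheme.agg.NoSpontaneous) {a : ℝ} (ha : 0 ≤ a) :
    regret erm P adv z (fairPolicies erm P adv z 0) ≤ 0 ∧ violationCount erm P adv z a ≤ 0 := by
  have hpol : ∀ t, policyAt erm P adv z t ∈ stdSimplex ℝ H := fun t => by
    have h1 : ∀ h, policyAt erm P adv z t h = 1 := fun h => by
      rw [policyAt, ftplPolicy]
      simp [Subsingleton.elim _ h]
    have : Unique H := uniqueOfSubsingleton (erm 0)
    exact ⟨fun h => by rw [h1]; norm_num, by simp only [h1]; simp⟩
  have hone : ∀ π ∈ stdSimplex ℝ H, ∀ h, π h = 1 := fun π hπ h => by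
    have := hπ.2
    rwa [Fintype.sum_subsingleton _ h] at this
  constructor
  · refine regret_le adv z (fairPolicies_nonempty adv z hconst hnull) fun π hπ => le_of_eq ?_
    rw [sub_eq_zero]
    refine Finset.sum_congr rfl fun t _ => ?_
    congr 1
    funext h
    rw [hone _ (hpol t), hone _ hπ.1]
  · refine Finset.sum_nonpos fun t _ => le_of_eq ?_
    obtain ⟨b, hb⟩ := hconst
    have : mix (policyAt erm P adv z t) = fun _ => if b = true then 1 else 0 := by
      funext x
      rw [mix, Fintype.sum_subsingleton _ (⟨_, hb⟩ : H), hone _ (hpol t), one_mul]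
    rw [this, Round.unfair_eq_zero_iff]
    exact Scheme.report_const (hnull _) _ _ ha

end FairOnline

/-! ### The bounds on the good event, and the theorem -/

namespace FairOnline

variable {X : Type u} {H : Finset (X → Bool)} {k T : ℕ} {erm : Batch X → H} {Q : Finset X}

theorem regret_and_violationCount_le_of_good {α δ : ℝ}
    (adv : Adversary H (chosenParams k T Q.card α δ).R (chosenParams k T Q.card α δ).M k)
    (z : Tape Q (chosenParams k T Q.card α δ) k T)
    (hconst : HasConstant H) (hsep : IsSeparating H Q) (herm : IsERM erm) (hH : 2 ≤ H.card)
    (hk : 1 ≤ k) (hT : 1 ≤ T) (hQ : 1 ≤ Q.card) (hα : 0 < α) (hα1 : α ≤ 1) (hδ : 0 < δ) (hδ1 : δ ≤ 1)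
    (hmon : ∀ past, (adv past).scheme.agg.IsMonotone)
    (hnull : ∀ past, (adv past).scheme.agg.NoSpontaneous)
    (hgood : failureBound erm Q (chosenParams k T Q.card α δ) adv δ
      (((T : ℝ) ^ (-(1 / 3) : ℝ)) ^ 2 / (5040 * k)) (run erm (chosenParams k T Q.card α δ) adv z T) < 1) :
    regret erm (chosenParams k T Q.card α δ) adv z
        (fairPolicies erm (chosenParams k T Q.card α δ) adv z 0)
      ≤ 100000 * (Q.card : ℝ) ^ (3 / 2 : ℝ) * (k : ℝ) ^ (11 / 2 : ℝ) *
          (T : ℝ) ^ (2 / 3 : ℝ) * Real.log H.card * Real.log (2 / δ) ∧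
    violationCount erm (chosenParams k T Q.card α δ) adv z α
      ≤ 100000 * α⁻¹ * (Q.card : ℝ) ^ (3 / 2 : ℝ) * (k : ℝ) ^ (9 / 2 : ℝ) *
          (T : ℝ) ^ (5 / 6 : ℝ) * Real.log H.card * Real.log (2 / δ) := by
  have hP := chosenParams_admissible (α := α) (δ := δ) hk hT hQ hα hα1 hδ hδ1
  have hk' : (1 : ℝ) ≤ k := by exact_mod_cast hk
  have hT' : (1 : ℝ) ≤ T := by exact_mod_cast hT
  have hs' : (1 : ℝ) ≤ Q.card := by exact_mod_cast hQ
  have hH' : (2 : ℝ) ≤ H.card := by exact_mod_cast hH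
  set σ := (Q.card : ℝ) ^ (1 / 2 : ℝ) with hσ
  set κ := (k : ℝ) ^ (1 / 2 : ℝ) with hκ
  set τ := (T : ℝ) ^ (1 / 6 : ℝ) with hτ
  have hσ1 : 1 ≤ σ := Real.one_le_rpow hs' (by norm_num)
  have hκ1 : 1 ≤ κ := Real.one_le_rpow hk' (by norm_num)
  have hτ1 : 1 ≤ τ := Real.one_le_rpow hT' (by norm_num)
  have hpow : ∀ (x p : ℝ) (n : ℕ), 0 ≤ x → (x ^ p) ^ n = x ^ (p * n) := fun x p n hx => by
    rw [← Real.rpow_natCast, ← Real.rpow_mul hx]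
  have es : (Q.card : ℝ) = σ ^ 2 := by rw [hσ, hpow _ _ _ (Nat.cast_nonneg _)]; norm_num
  have ek : (k : ℝ) = κ ^ 2 := by rw [hκ, hpow _ _ _ (Nat.cast_nonneg _)]; norm_num
  have eT : (T : ℝ) = τ ^ 6 := by rw [hτ, hpow _ _ _ (Nat.cast_nonneg _)]; norm_num
  have es3 : (Q.card : ℝ) ^ (3 / 2 : ℝ) = σ ^ 3 := by
    rw [hσ, hpow _ _ _ (Nat.cast_nonneg _)]; norm_num
  have ek9 : (k : ℝ) ^ (9 / 2 : ℝ) = κ ^ 9 := by rw [hκ, hpow _ _ _ (Nat.cast_nonneg _)]; norm_num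
  have ek11 : (k : ℝ) ^ (11 / 2 : ℝ) = κ ^ 11 := by
    rw [hκ, hpow _ _ _ (Nat.cast_nonneg _)]; norm_num
  have eT4 : (T : ℝ) ^ (2 / 3 : ℝ) = τ ^ 4 := by rw [hτ, hpow _ _ _ (Nat.cast_nonneg _)]; norm_num
  have eT5 : (T : ℝ) ^ (5 / 6 : ℝ) = τ ^ 5 := by rw [hτ, hpow _ _ _ (Nat.cast_nonneg _)]; norm_num
  have eμ : (T : ℝ) ^ (-(1 / 3) : ℝ) = (τ ^ 2)⁻¹ := by
    rw [Real.rpow_neg (Nat.cast_nonneg _), hτ, hpow _ _ _ (Nat.cast_nonneg _)]; norm_num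
  clear_value σ κ τ
  have eω : (chosenParams k T Q.card α δ).ω = Real.exp 1 / (512 * σ ^ 2 * κ ^ 8 * τ ^ 4) := by
    simp only [chosenParams]
    rw [eμ, es, ek]
    field_simp
  have eμ' : (chosenParams k T Q.card α δ).μ = (τ ^ 2)⁻¹ := eμ
  have hσ0 : 0 < σ := by linarith
  have hκ0 : 0 < κ := by linarith
  have hτ0 : 0 < τ := by linarith
  -- This is the noise scale ω/(2√(sk)) of `noiseCost_mgf_le`.
  have hθ' : 0 < (chosenParams k T Q.card α δ).ω / (2 * σ * κ) := by
    exact div_pos hP.ω_pos (mul_pos (mul_pos two_pos hσ0) hκ0)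
  have hθ2 : ((chosenParams k T Q.card α δ).ω / (2 * σ * κ)) ^ 2
      = (chosenParams k T Q.card α δ).ω ^ 2 / (4 * (Q.card * k : ℕ)) := by
    push_cast
    rw [es, ek]
    ring
  have ha : Real.log 2 ≤ Real.log H.card := Real.log_le_log two_pos hH'
  have hb : Real.log 2 ≤ Real.log (2 / δ) :=
    Real.log_le_log two_pos (by rw [le_div_iff₀ hδ]; linarith)
  have hlog : Real.log (2 * H.card / δ) = Real.log H.card + Real.log (2 / δ) := by
    rw [← Real.log_mul (by linarith) (div_pos two_pos hδ).ne']; congr 1; ring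
  have main : ∀ π ∈ fairPolicies erm (chosenParams k T Q.card α δ) adv z 0,
      _ ∧ violationCount erm (chosenParams k T Q.card α δ) adv z α ≤ _ := fun π hπ =>
    final_bounds (κ := κ) (σ := σ) (τ := τ) (α := α) (a := Real.log H.card) (b := Real.log (2 / δ))
      (e := Real.exp 1)
      (D := ∑ t : Fin T, error (policyAt erm (chosenParams k T Q.card α δ) adv z t)
          (roundAt erm (chosenParams k T Q.card α δ) adv z t).x
          (roundAt erm (chosenParams k T Q.card α δ) adv z t).y
        - ∑ t : Fin T, error π (roundAt erm (chosenParams k T Q.card α δ) adv z t).x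
          (roundAt erm (chosenParams k T Q.card α δ) adv z t).y)
      (V := violationCount erm (chosenParams k T Q.card α δ) adv z α)
      hκ1 hσ1 hτ1 hα ha hb exp_one_bounds.1 (by
        have h1 : 0 ≤ ∑ t : Fin T, error (policyAt erm (chosenParams k T Q.card α δ) adv z t)
          (roundAt erm (chosenParams k T Q.card α δ) adv z t).x
          (roundAt erm (chosenParams k T Q.card α δ) adv z t).y := Finset.sum_nonneg fun t _ =>
            (error_mem_Icc (policyAt_mem_stdSimplex adv z hP hsep herm t) _ _).1
        have h2 : ∑ t : Fin T, error π (roundAt erm (chosenParams k T Q.card α δ) adv z t).x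
          (roundAt erm (chosenParams k T Q.card α δ) adv z t).y ≤ ∑ _t : Fin T, (k : ℝ) :=
            Finset.sum_le_sum fun t _ => (error_mem_Icc hπ.1 _ _).2
        rw [Finset.sum_const, Finset.card_univ, Fintype.card_fin, nsmul_eq_mul, eT, ek] at h2
        linarith)
      fun l hl => by
        have h := sum_error_add_lam_mul_le adv z hP hsep herm hmon hgood hQ hθ' hθ2 hl hπ
        rw [hlog, eμ', eμ, eω] at h
        rw [← ek]
        refine h.trans (le_of_eq ?_)
        rw [ek, eT]
        field_simp
        ring
  rw [es3, ek9, ek11, eT4, eT5]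
  obtain ⟨π, hπ⟩ := fairPolicies_nonempty (erm := erm) adv z hconst hnull
  exact ⟨regret_le adv z ⟨π, hπ⟩ fun π hπ => (main π hπ).1, (main π hπ).2⟩

end FairOnline
theorem theorem2 :
    ∃ C : ℝ, 0 < C ∧
      ∀ (X : Type u) (H : Finset (X → Bool)) (Q : Finset X) (erm : FairOnline.Batch X → H)
        (k T : ℕ) (α δ : ℝ)
        (adv : FairOnline.Adversary H (FairOnline.chosenParams k T Q.card α δ).R
          (FairOnline.chosenParams k T Q.card α δ).M k),
        FairOnline.HasConstant H →
        FairOnline.IsSeparating H Q →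
        FairOnline.IsERM erm →
        1 ≤ k → 1 ≤ T → 0 < α → α ≤ 1 → 0 < δ → δ ≤ 1 →
        (∀ past, (adv past).scheme.agg.IsMonotone) →
        (∀ past, (adv past).scheme.agg.NoSpontaneous) →
        ENNReal.ofReal (1 - δ) ≤
          FairOnline.tapeLaw Q (FairOnline.chosenParams k T Q.card α δ) k T
            {z | (FairOnline.fairPolicies erm (FairOnline.chosenParams k T Q.card α δ)
                    adv z 0).Nonempty ∧
                FairOnline.regret erm (FairOnline.chosenParams k T Q.card α δ) adv z
                    (FairOnline.fairPolicies erm (FairOnline.chosenParams k T Q.card α δ) adv z 0)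
                  ≤ C * (Q.card : ℝ) ^ (3 / 2 : ℝ) * (k : ℝ) ^ (11 / 2 : ℝ) *
                      (T : ℝ) ^ (2 / 3 : ℝ) * Real.log H.card * Real.log (2 / δ) ∧
                FairOnline.violationCount erm (FairOnline.chosenParams k T Q.card α δ) adv z α
                  ≤ C * α⁻¹ * (Q.card : ℝ) ^ (3 / 2 : ℝ) * (k : ℝ) ^ (9 / 2 : ℝ) *
                      (T : ℝ) ^ (5 / 6 : ℝ) * Real.log H.card * Real.log (2 / δ)} ∧
        ∀ (z : FairOnline.Tape Q (FairOnline.chosenParams k T Q.card α δ) k T) (t : Fin T),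
          (FairOnline.callsAt erm (FairOnline.chosenParams k T Q.card α δ) adv z t : ℝ)
            ≤ C * (α ^ (-2 : ℤ) * Real.log (2 * k * T / δ)
                + (k : ℝ) ^ 2 * (T : ℝ) ^ (1 / 3 : ℝ)) := by
  refine ⟨100000, by norm_num, ?_⟩
  intro X H Q erm k T α δ adv hconst hsep herm hk hT hα hα1 hδ hδ1 hmon hnull
  refine ⟨?_, fun z t => ?_⟩
  -- For |H| = 1 the factor log |H| vanishes and the bounds must hold with right side 0.
  · rcases Nat.lt_or_ge H.card 2 with hH | hH
    · have hsub : Subsingleton H :=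
        Fintype.card_le_one_iff_subsingleton.1 (by rw [Fintype.card_coe]; omega)
      have hcard : H.card = 1 := by
        have := Finset.card_pos.2 ⟨_, (erm 0).2⟩
        omega
      have hω : Q.card = 0 ∨ 0 < (FairOnline.chosenParams k T Q.card α δ).ω := by
        rcases Nat.eq_zero_or_pos Q.card with h | h
        · exact .inl h
        · exact .inr (FairOnline.chosenParams_admissible hk hT h hα hα1 hδ hδ1).ω_pos
      obtain ⟨hp1, hp2⟩ := FairOnline.isProbabilityMeasure_tapeLaw (k := k) (T := T) hω
      refine le_trans ?_ (measure_mono (s := Set.univ) fun z _ => ?_)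
      · rw [measure_univ, ENNReal.ofReal_le_one]
        linarith
      · obtain ⟨h1, h2⟩ := FairOnline.regret_and_violationCount_nonpos_of_subsingleton (erm := erm)
          adv z hp2 hconst hnull hα.le
        refine ⟨FairOnline.fairPolicies_nonempty adv z hconst hnull, ?_, ?_⟩ <;> simpa [hcard]
    · have hQ : 1 ≤ Q.card := by
        obtain ⟨h, hh, h', hh', hne⟩ := Finset.one_lt_card.1 hH
        obtain ⟨q, hq, -⟩ := hsep h hh h' hh' hne
        exact Finset.card_pos.2 ⟨q, hq⟩
      have hP := FairOnline.chosenParams_admissible (α := α) (δ := δ) hk hT hQ hα hα1 hδ hδ1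
      obtain ⟨hp, -⟩ := FairOnline.isProbabilityMeasure_tapeLaw (Q := Q)
        (P := FairOnline.chosenParams k T Q.card α δ) (k := k) (T := T) (.inr hP.ω_pos)
      -- The good event is not claimed to be measurable. Covering the space by it and the failure
      -- event, and using subadditivity, avoids complements.
      rw [ENNReal.ofReal_sub _ hδ.le, ENNReal.ofReal_one, tsub_le_iff_right,
        ← measure_univ (μ := FairOnline.tapeLaw Q (FairOnline.chosenParams k T Q.card α δ) k T)]
      refine le_trans ?_ (add_le_add_right
        (FairOnline.failureBound_measure_le (erm := erm) adv hP hsep herm) _)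
      refine le_trans (measure_mono fun z _ => ?_) (measure_union_le _ _)
      rcases lt_or_ge (FairOnline.failureBound erm Q (FairOnline.chosenParams k T Q.card α δ) adv δ
        (((T : ℝ) ^ (-(1 / 3) : ℝ)) ^ 2 / (5040 * k))
        (FairOnline.run erm (FairOnline.chosenParams k T Q.card α δ) adv z T)) 1 with hg | hg
      · exact .inl ⟨FairOnline.fairPolicies_nonempty adv z hconst hnull,
          FairOnline.regret_and_violationCount_le_of_good adv z hconst hsep herm hH hk hT hQ hα hα1
            hδ hδ1 hmon hnull hg⟩
      · exact .inr hg
  · rw [FairOnline.callsAt, FairOnline.nextRound_calls]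
    exact FairOnline.chosenParams_calls_le hk hT hα hδ hδ1
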